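/- \textbf{Setting.} Let $d\in\{2,3\}$ and let $\Omega\subset\mathbb R^d$ be a polygonal/polyhedral domain with boundary $\partial\Omega=\Gamma_D\cup\Gamma_R$, let $\kappa\ge 0$, and put $$a(u,v)=\int_\Omega\nabla u\cdot\nabla v\,dx+\int_{\Gamma_R}\kappa uv\,dS,\qquad |||v|||^2=a(v,v).$$ (Boundary values are traces from inside $\Omega$; where $\Omega$ lies on both sides of its boundary both traces count.) Let $\mathcal T_{H,0}$ be a finite conforming simplicial mesh covering $\Omega$, not fitted to $\Omega$, with closed elements $T$ such that $\operatorname{diam}T\le H$ and $T$ contains a ball of radius $H/\sigma$. Let $\mathcal T_H=\{T\in\mathcal T_{H,0}: T\cap\Omega\ne\emptyset\}$, with nodes $\mathcal N$ and nodal basis functions $\varphi_x$, and let $\mathcal V_H=\operatorname{span}\{\varphi_x\}_{x\in\mathcal N}$. An element $T\in\mathcal T_H$ is \emph{interior} if $T\subset\Omega$; the vertices of interior elements are the interior nodes, and $\mathcal N_I$ is the set of these. For a set $A\subset\mathcal T_H$ of elements let $\operatorname{reg}(A)=\operatorname{int}\big(\bigcup_{T\in A}T\cap\Omega\big)$ and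 $A^{+}=\{T\in\mathcal T_H: T\cap T'\neq\emptyset\text{ for some }T'\in A\}$. Starting from $A=\{T\in\mathcal T_H: T\not\subset\Omega\}$ and applying $\ell$ times $A\mapsto A^+$ gives the boundary patches $\omega_\Gamma^\ell=\operatorname{reg}(A)$; starting from $A=\{T\in\mathcal T_H:x\in T\}$ gives the nodal patches $\omega_x^\ell$. Fix $k\ge1$. Let $\mathcal T_h$ be a conforming simplicial mesh of $\overline{\omega_\Gamma^k}$ that refines the coarse mesh there, such that each $t\in\mathcal T_h$ contains a ball of radius $\operatorname{diam}(t)/\sigma$, $\partial\Omega$ is a union of sides of elements of $\mathcal T_h$, and each such side lies in exactly one of $\Gamma_D,\Gamma_R$. Let $\mathcal V_h(\omega_\Gamma^k)$ be the space of functions that are continuous on $\omega_\Gamma^k$ and affine on each $t\in\mathcal T_h$, extended by $0$ to $\Omega$, and let $\mathcal W=(\mathcal V_H+\mathcal V_h(\omega_\Gamma^k))\cap H^1(\Omega)$ (no boundary condition). For $x\in\mathcal N_I$ let $P_xv\in\mathcal V_H|_{\omega_x^0}$ be the $L^2(\omega_x^0)$-orthogonal projection of $v$, let $\mathcal I_Hv=\sum_{x\in\mathcal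 N_I}(P_xv)(x)\varphi_x$, and let $\mathcal V^f=\{v\in\mathcal W:\mathcal I_Hv=0\}$. For $v_H=\sum_{x\in\mathcal N_I}v_x\varphi_x$ the global corrector $Q(v_H)\in\mathcal V^f$ satisfies $Q(v_H)=-v_H$ on $\Gamma_D$ and $$a(Q(v_H),w)=-a(v_H,w)\quad\text{for all }w\in\mathcal V^f\text{ with }w|_{\Gamma_D}=0 .$$ For $x\in\mathcal N_I$ the local corrector $Q^L_x(\varphi_x)\in\mathcal V^f$ vanishes on $\Omega\setminus\omega_x^L$, equals $-\varphi_x$ on $\Gamma_D$, and satisfies $a(Q^L_x(\varphi_x),w)=-a(\varphi_x,w)$ for all $w\in\mathcal V^f$ with $w|_{\Gamma_D}=0$ and $w|_{\Omega\setminus\omega_x^L}=0$. Put $Q^L(v_H)=\sum_{x\in\mathcal N_I}v_xQ^L_x(\varphi_x)$. \textbf{Assumptions,} with parameters $\theta,M,K,\Lambda$: \begin{enumerate} \item every $T\in\mathcal T_H$ shares a vertex with an interior element; \item for every $x\in\mathcal N_I$ and $u\in H^1(\omega_x^0)$: $\inf_{c\in\mathbb R}\|u-c\|_{\omega_x^0}\le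 M\operatorname{diam}(\omega_x^0)\|\nabla u\|_{\omega_x^0}$; \item $\kappa\,|\Gamma_R\cap T|\le K H^{d-2}$ for every $T\in\mathcal T_H$; \item every $x\in\mathcal N_I$ for which $\varphi_x$ does not vanish identically on $\Gamma_D$ is a vertex of an interior element $T$ such that all $t\in\mathcal T_h$ with $t\subset T$ have diameter at most $\theta H$, and $\max_T|g|\le\Lambda\max_y|(P_y(1_Tg))(y)|$ for every affine function $g$, where $y$ runs over the vertices of $T$ and $1_T$ is the indicator function of $T$. \end{enumerate} \textbf{Lemma (Decay of correctors).} For every $\sigma>0$ there is $\theta>0$, depending only on $d$ and $\sigma$, and for all $M,K,\Lambda$ there are $C>0$ and $\gamma\in(0,1)$, depending only on $d,\sigma,M,K,\Lambda$ (and not otherwise on $\Omega$, $\Gamma_D$, $\Gamma_R$, $\kappa$, the meshes, $H$, $k$ or $L$), such that under the assumptions above, for all integers $L\ge3$ and all $v_H=\sum_{x\in\mathcal N_I}v_x\varphi_x$, any correctors as defined above satisfy $$|||(Q-Q^L)(v_H)|||^2\le C\,L^d\,\gamma^{\lfloor (L-3)/3\rfloor}\sum_{x\in\mathcal N_I}v_x^2\,|||Q(\varphi_x)|||^2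 .$$ -/

import Mathlib

open MeasureTheory Filter Topology

noncomputable section

open scoped Classical

namespace LOD

/-- The Euclidean space `ℝ^d`. -/
abbrev E (d : ℕ) : Type := EuclideanSpace ℝ (Fin d)

/-- The closed simplex with vertex set `s`. -/
def simplex {d : ℕ} (s : Finset (E d)) : Set (E d) := convexHull ℝ (s : Set (E d))

/-- A finite conforming (face-to-face) mesh of `d`-simplices in `ℝ^d`; every element is given by
its `d + 1` vertices. -/
structure Mesh (d : ℕ) where
  elems : Finset (Finset (E d))
  card_eq : ∀ s ∈ elems, s.card = d + 1
  indep : ∀ s ∈ elems, AffineIndependent ℝ ((↑) : s → E d)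
  inter_subset : ∀ s ∈ elems, ∀ t ∈ elems,
    simplex s ∩ simplex t ⊆ convexHull ℝ ((s : Set (E d)) ∩ (t : Set (E d)))

/-- The union of the closed elements of a mesh. -/
def Mesh.space {d : ℕ} (K : Mesh d) : Set (E d) := ⋃ s ∈ K.elems, simplex s

/-- The nodal basis function at the node `x`: its value at a point `p` of an element `s` is the
barycentric coordinate of `p` in `s` belonging to `x` (and `0` if `x` is not a vertex of `s`).
On the union of the elements the set below has exactly one member; elsewhere it is empty and the
value is `0`. -/
def Mesh.hat {d : ℕ} (K : Mesh d) (x : E d) (p : E d) : ℝ :=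
  sSup {r : ℝ | ∃ s ∈ K.elems, ∃ w : E d → ℝ, (∀ y ∈ s, 0 ≤ w y) ∧ ∑ y ∈ s, w y = 1 ∧
    ∑ y ∈ s, w y • y = p ∧ r = if x ∈ s then w x else 0}

/-- `v` is a polynomial of total degree at most one on `s`. -/
def IsP1On {d : ℕ} (v : E d → ℝ) (s : Set (E d)) : Prop :=
  ∃ g : E d →ᵃ[ℝ] ℝ, Set.EqOn v g s

/-- The Poincaré constant of the open set `ω` is at most `M`:
`inf_c ‖u - c‖_ω ≤ M diam(ω) ‖∇u‖_ω`. The inequality is required of the locally Lipschitz functions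
in `H¹(ω)` (these are dense in `H¹(ω)`, so this is the inequality for all of `H¹(ω)`); their
gradient exists almost everywhere. -/
def PoincareConstLE {d : ℕ} (ω : Set (E d)) (M : ℝ) : Prop :=
  ∀ u : E d → ℝ, LocallyLipschitzOn ω u →
    MemLp u 2 (volume.restrict ω) → MemLp (gradient u) 2 (volume.restrict ω) →
    ∃ c : ℝ, ∫ y in ω, (u y - c) ^ 2 ≤
      (M * Metric.diam ω) ^ 2 * ∫ y in ω, ‖gradient u y‖ ^ 2

/-- The data of the method: the physical domain `Ω`, its Dirichlet and Robin boundary, the Robin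
coefficient `κ`, the coarse background mesh with mesh size `H` (not fitted to `Ω`), the number `k`
of layers around the boundary in which the coarse space is enriched, and the fine mesh there. -/
structure Setting (d : ℕ) where
  Ω : Set (E d)
  ΓD : Set (E d)
  ΓR : Set (E d)
  κ : ℝ
  coarse : Mesh d
  H : ℝ
  k : ℕ
  fine : Mesh d

namespace Setting

variable {d : ℕ} (S : Setting d)

/-! ### Coarse mesh and patches -/

/-- The elements of the background mesh that are cut or covered by `Ω`. -/
def cutMesh : Finset (Finset (E d)) :=
  S.coarse.elems.filter fun T => (simplex T ∩ S.Ω).Nonempty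

/-- The interior elements: those that are contained in `Ω`. -/
def interiorElems : Finset (Finset (E d)) :=
  S.cutMesh.filter fun T => simplex T ⊆ S.Ω

/-- All nodes of the coarse mesh. -/
def nodes : Finset (E d) := S.cutMesh.biUnion id

/-- The interior nodes: the vertices of the interior elements. -/
def interiorNodes : Finset (E d) := S.interiorElems.biUnion id

/-- Add one layer: all elements that touch an element of `A`. -/
def addLayer (A : Finset (Finset (E d))) : Finset (Finset (E d)) :=
  S.cutMesh.filter fun T => ∃ T' ∈ A, (simplex T ∩ simplex T').Nonempty

/-- The subdomain covered by the elements in `A`. -/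
def region (A : Finset (Finset (E d))) : Set (E d) :=
  interior ((⋃ T ∈ A, simplex T) ∩ S.Ω)

/-- The elements in the `l`-layer patch around the boundary; for `l = 0` those that are not
contained in `Ω`. -/
def boundaryLayer : ℕ → Finset (Finset (E d))
  | 0 => S.cutMesh.filter fun T => ¬ simplex T ⊆ S.Ω
  | l + 1 => S.addLayer (boundaryLayer l)

/-- The enriched region, i.e. the `k`-layer patch around the boundary. -/
def enriched : Set (E d) := S.region (S.boundaryLayer S.k)

/-- The elements in the `l`-layer nodal patch of `x`. -/
def nodeLayer (x : E d) : ℕ → Finset (Finset (E d))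
  | 0 => S.cutMesh.filter fun T => x ∈ simplex T
  | l + 1 => S.addLayer (nodeLayer x l)

/-- The `l`-layer nodal patch `ω_x^l`. -/
def nodePatch (x : E d) (l : ℕ) : Set (E d) := S.region (S.nodeLayer x l)

/-! ### Finite element spaces -/

/-- The coarse nodal basis function `φ_x`. -/
def φ (x : E d) : E d → ℝ := S.coarse.hat x

/-- The coarse finite element space, spanned by the nodal basis functions. -/
def coarseSpace : Submodule ℝ (E d → ℝ) :=
  Submodule.span ℝ ((fun x => S.φ x) '' (S.nodes : Set (E d)))

/-- `v` belongs to the fine finite element space on the enriched region: it is continuous there and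
affine on every element of the fine mesh. -/
def IsFine (v : E d → ℝ) : Prop :=
  ContinuousOn v S.enriched ∧ ∀ t ∈ S.fine.elems, IsP1On v (simplex t ∩ S.enriched)

/-- `v` is the sum of a coarse function and of a fine function on the enriched region (extended by
zero), and belongs to `H¹(Ω)`; for such piecewise affine functions the latter means continuity
in `Ω`. No boundary condition is imposed. -/
def IsReference (v : E d → ℝ) : Prop :=
  ContinuousOn v S.Ω ∧ ∃ vH ∈ S.coarseSpace, ∃ vh, S.IsFine vh ∧
    ∀ p ∈ S.Ω, v p = vH p + S.enriched.indicator vh p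

/-! ### Boundary values and the bilinear form -/

/-- The trace of `v` on the boundary of the fine element `t`, taken from inside `t`. (If `Ω` lies
on both sides of a part of its boundary, the two traces may differ.) -/
def trace (t : Finset (E d)) (v : E d → ℝ) : E d → ℝ :=
  extendFrom (interior (simplex t)) v

/-- `v = 0` on the Dirichlet boundary: the trace vanishes on all sides of fine elements that lie on
the Dirichlet boundary (`t.erase x` are the vertices of the side of `t` opposite to `x`). -/
def ZeroOnD (v : E d → ℝ) : Prop :=
  ∀ t ∈ S.fine.elems, ∀ x ∈ t, simplex (t.erase x) ⊆ S.ΓD →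
    ∀ p ∈ simplex (t.erase x), trace t v p = 0

/-- The bilinear form `a(u,v) = ∫_Ω ∇u·∇v dx + ∫_{Γ_R} κ u v dS`. The Robin boundary is the
union of the sides of fine elements that lie on it. -/
def a (u v : E d → ℝ) : ℝ :=
  (∫ y in S.Ω, inner ℝ (gradient u y) (gradient v y)) +
    ∑ t ∈ S.fine.elems, ∑ x ∈ t with simplex (t.erase x) ⊆ S.ΓR,
      ∫ y in simplex (t.erase x), S.κ * trace t u y * trace t v y ∂(μHE[d - 1])

/-- The squared energy norm `|||v|||²`. -/
def energySq (v : E d → ℝ) : ℝ := S.a v v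

/-! ### Interpolation -/

/-- `p` is the local `L²(ω_x^0)`-projection `P_x v` of `v` to the coarse space. (Coarse functions
that vanish on `ω_x^0` play no role, and `p` is unique on `ω_x^0`.) -/
def IsLocalProj (x : E d) (v p : E d → ℝ) : Prop :=
  p ∈ S.coarseSpace ∧ ∀ w ∈ S.coarseSpace,
    ∫ y in S.nodePatch x 0, p y * w y = ∫ y in S.nodePatch x 0, v y * w y

/-- The value `(P_x v)(x)`. -/
def projValue (x : E d) (v : E d → ℝ) : ℝ :=
  if h : ∃ p, S.IsLocalProj x v p then Classical.choose h x else 0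

/-- The projective Clément interpolation operator `I_H`. -/
def interp (v : E d → ℝ) : E d → ℝ := fun p =>
  ∑ x ∈ S.interiorNodes, S.projValue x v * S.φ x p

/-- The fine scale functions: the kernel of `I_H` (no boundary condition is imposed). -/
def IsFineScale (v : E d → ℝ) : Prop :=
  S.IsReference v ∧ ∀ p ∈ S.Ω, S.interp v p = 0

/-! ### Correctors -/

/-- `q = Q(vH)`: the fine scale function `q` equals `-vH` on the Dirichlet boundary and satisfies
`a(q,w) = -a(vH,w)` for all fine scale functions `w` that vanish on the Dirichlet boundary. -/
def IsCorrector (vH q : E d → ℝ) : Prop :=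
  S.IsFineScale q ∧ S.ZeroOnD (q + vH) ∧
    ∀ w, S.IsFineScale w → S.ZeroOnD w → S.a q w = -S.a vH w

/-- `q = Q_x^L(φ_x)`: the same problem for `vH = φ_x`, posed on the functions that vanish outside
the `L`-layer patch of `x`. -/
def IsLocalCorrector (L : ℕ) (x : E d) (q : E d → ℝ) : Prop :=
  S.IsFineScale q ∧ (∀ p ∈ S.Ω \ S.nodePatch x L, q p = 0) ∧ S.ZeroOnD (q + S.φ x) ∧
    ∀ w, S.IsFineScale w → (∀ p ∈ S.Ω \ S.nodePatch x L, w p = 0) → S.ZeroOnD w →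
      S.a q w = -S.a (S.φ x) w

/-! ### Assumptions -/

/-- The set-up: `Ω` is a domain covered by the background mesh, the fine mesh refines the coarse
mesh in the enriched region, it represents `∂Ω` exactly (so `Ω` is polygonal or polyhedral),
and every boundary side belongs to exactly one of the Dirichlet and the Robin boundary. -/
structure IsSetup : Prop where
  isOpen : IsOpen S.Ω
  isConnected : IsConnected S.Ω
  subset_space : S.Ω ⊆ S.coarse.space
  H_pos : 0 < S.H
  κ_nonneg : 0 ≤ S.κ
  one_le_k : 1 ≤ S.k
  fine_space : S.fine.space = closure S.enriched
  fine_refines : ∀ t ∈ S.fine.elems, ∃ T ∈ S.boundaryLayer S.k, simplex t ⊆ simplex T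
  resolved : ∀ p ∈ frontier S.Ω, ∃ t ∈ S.fine.elems, ∃ x ∈ t,
    p ∈ simplex (t.erase x) ∧ simplex (t.erase x) ⊆ frontier S.Ω
  boundary_eq : S.ΓD ∪ S.ΓR = frontier S.Ω
  boundary_sides : ∀ t ∈ S.fine.elems, ∀ x ∈ t, simplex (t.erase x) ⊆ frontier S.Ω →
    Xor (simplex (t.erase x) ⊆ S.ΓD) (simplex (t.erase x) ⊆ S.ΓR)

/-- The coarse mesh is shape regular and quasi-uniform with mesh size `H`, and the fine mesh is
shape regular, with constant `σ`. -/
structure IsRegular (σ : ℝ) : Prop where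
  coarse_diam : ∀ T ∈ S.coarse.elems, Metric.diam (simplex T) ≤ S.H
  coarse_ball : ∀ T ∈ S.coarse.elems, ∃ c, Metric.ball c (S.H / σ) ⊆ simplex T
  fine_ball : ∀ t ∈ S.fine.elems, ∃ c, Metric.ball c (Metric.diam (simplex t) / σ) ⊆ simplex t

/-- Every element of the coarse mesh shares a vertex with an interior element. -/
def SharesInteriorVertex : Prop :=
  ∀ T ∈ S.cutMesh, ∃ T' ∈ S.interiorElems, (T ∩ T').Nonempty

/-- The surface measure of the Robin boundary inside the coarse element `T`. -/
def robinArea (T : Finset (E d)) : ℝ :=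
  ∑ t ∈ S.fine.elems with simplex t ⊆ simplex T,
    ∑ x ∈ t with simplex (t.erase x) ⊆ S.ΓR, (μHE[d - 1] : Measure (E d)).real (simplex (t.erase x))

/-- Every interior node whose basis function does not vanish on the Dirichlet boundary is a vertex
of an interior element `T` in which the fine elements have diameter at most `θ H` and in which
the local projections are nondegenerate with constant `Λ`: every affine `g` satisfies
`max_T |g| ≤ Λ max_y |P_y(1_T g)(y)|`, where `y` runs over the vertices of `T`. -/
def DirichletNodesRegular (θ Λ : ℝ) : Prop :=
  ∀ z ∈ S.interiorNodes,
    (∃ t ∈ S.fine.elems, ∃ x ∈ t, simplex (t.erase x) ⊆ S.ΓD ∧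
      ∃ p ∈ simplex (t.erase x), S.φ z p ≠ 0) →
    ∃ T ∈ S.interiorElems, z ∈ T ∧
      (∀ t ∈ S.fine.elems, simplex t ⊆ simplex T → Metric.diam (simplex t) ≤ θ * S.H) ∧
      ∀ (g : E d →ᵃ[ℝ] ℝ) (δ : ℝ),
        (∀ y ∈ T, |S.projValue y ((simplex T).indicator g)| ≤ δ) →
        ∀ p ∈ simplex T, |g p| ≤ Λ * δ

/-- The standing assumptions, with the parameters on which the constants may depend. -/
structure IsAdmissible (σ θ M K Λ : ℝ) : Prop where
  setup : S.IsSetup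
  regular : S.IsRegular σ
  sharesInteriorVertex : S.SharesInteriorVertex
  poincare : ∀ x ∈ S.interiorNodes, PoincareConstLE (S.nodePatch x 0) M
  robin : ∀ T ∈ S.cutMesh, S.κ * S.robinArea T * S.H ^ 2 ≤ K * S.H ^ d
  dirichlet : S.DirichletNodesRegular θ Λ

end Setting

end LOD

end

noncomputable section

open scoped Classical

namespace LOD

/-! The reference space consists of the functions that are continuous in `Ω` and affine on every
cell, a cell being a fine element or a coarse element outside the enriched region
(`isReference_iff`). For these functions the energy is a finite sum over cells (`a_eq`), and the
fine scale functions are those annihilated by the functionals `v ↦ (P_x v)(x)` at the interior nodes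
(`isFineScale_iff`). The constants may depend neither on how `∂Ω` cuts the coarse elements nor on
the size of the fine cells. Hence inverse estimates use interior elements or whole cells, and a fine
diameter enters only divided by the inradius of the same cell or multiplied by `1 / H`.

The core is a Caccioppoli argument: the corrector is tested with a copy of itself cut off near `x`.
Two tools are needed.

The first is a Friedrichs inequality. `P_x` reproduces constants and is stable in `L²`, so on
functions with `(P_x v)(x) = 0` the Poincaré inequality becomes `‖v‖ ≤ C H ‖∇v‖` on `ω_x^0`
(`friedrichs`).

The second is a cutoff that stays among the fine scale functions (`exists_fineCutoff`). The product
`η w` is interpolated back to the reference space (`exists_cutoff`), and the values `(P_x R)(x)` of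
the result `R` are removed with dual functions `b_x`, for which `(P_y b_x)(y) = δ_xy`. These vanish
on the Dirichlet boundary, live on the elements at `x` and have energy of order `H^(d-2)`
(`exists_dual`). If `φ_x` vanishes on the Dirichlet boundary, it is its own dual function. Otherwise
`b_x` is a fine interpolant of bubble times affine in an interior element `T`, with the same moments
against coarse functions as an affine `g` on `T` whose local projections are prescribed. The
smallness of `θ` keeps the interpolated bubble form coercive, and `Λ` bounds `g`.

The corrector `q` of `φ_x` is orthogonal to fine scale functions that vanish on the Dirichlet
boundary and on the elements at `x`. Its cutoff `r` is one of them, because on the Dirichlet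
boundary `q = -φ_x` is supported near `x`. As `r = q` far away, `a(q, r) = 0` bounds the energy
outside a patch by the energy in a ring. Hence the tail shrinks by a fixed factor every nine layers
(`tail_step`, `tail_le_pow`). Quasi-optimality of the local corrector turns this into a bound for
one node (`local_error_le`).

For the sum over nodes put `z = (Q - Q^L)(v_H)`. Then `a(z, z)` is the sum of `v_x a(Q φ_x - Q_x^L
φ_x, z)`, and in each term `z` may be replaced by a function that depends only on `z` near the patch
of `x` (`exists_ring`). An element lies in `O(L^d)` such patches (`sum_nodeLayer_le`), so Young's
inequality absorbs the energy of `z` and costs a factor `L^d`, not the number of nodes. -/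

variable {d : ℕ}

/-! ### Simplices and barycentric coordinates -/

/-- `s` is the vertex set of a nondegenerate `d`-simplex in `ℝ^d`. -/
def IsSimplex (s : Finset (E d)) : Prop :=
  s.card = d + 1 ∧ AffineIndependent ℝ ((↑) : s → E d)

lemma Mesh.isSimplex (K : Mesh d) {s : Finset (E d)} (hs : s ∈ K.elems) : IsSimplex s :=
  ⟨K.card_eq s hs, K.indep s hs⟩

lemma IsSimplex.affineSpan_eq_top {s : Finset (E d)} (h : IsSimplex s) :
    affineSpan ℝ (Set.range ((↑) : s → E d)) = ⊤ := by
  rw [h.2.affineSpan_eq_top_iff_card_eq_finrank_add_one]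
  simp [h.1]

/-- The affine basis formed by the vertices of a simplex. -/
def IsSimplex.basis {s : Finset (E d)} (h : IsSimplex s) : AffineBasis s ℝ (E d) :=
  ⟨(↑), h.2, h.affineSpan_eq_top⟩

/-- The barycentric coordinate of `s` belonging to the vertex `y`. -/
def bary (s : Finset (E d)) (y : E d) : E d →ᵃ[ℝ] ℝ :=
  if h : IsSimplex s ∧ y ∈ s then h.1.basis.coord ⟨y, h.2⟩ else 0

lemma bary_of_notMem {s : Finset (E d)} {y : E d} (hy : y ∉ s) : bary s y = 0 := by
  simp [bary, hy]

lemma IsSimplex.bary_eq {s : Finset (E d)} (h : IsSimplex s) (y : s) :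
    bary s (y : E d) = h.basis.coord y := by
  simp [bary, h]

lemma IsSimplex.bary_vertex {s : Finset (E d)} (h : IsSimplex s) {y z : E d} (hy : y ∈ s)
    (hz : z ∈ s) : bary s y z = if y = z then 1 else 0 := by
  have := h.basis.coord_apply ⟨y, hy⟩ ⟨z, hz⟩
  rw [← h.bary_eq] at this
  rw [show h.basis ⟨z, hz⟩ = z from rfl] at this
  simpa using this

lemma IsSimplex.sum_bary {s : Finset (E d)} (h : IsSimplex s) (p : E d) :
    ∑ y ∈ s, bary s y p = 1 := by
  rw [← h.basis.sum_coord_apply_eq_one p, ← Finset.sum_coe_sort]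
  exact Finset.sum_congr rfl fun y _ => by rw [h.bary_eq]

lemma IsSimplex.sum_bary_smul {s : Finset (E d)} (h : IsSimplex s) (p : E d) :
    ∑ y ∈ s, bary s y p • y = p := by
  conv_rhs => rw [← h.basis.linear_combination_coord_eq_self p]
  rw [← Finset.sum_coe_sort]
  exact Finset.sum_congr rfl fun y _ => by rw [h.bary_eq]; rfl

lemma affine_sum {ι : Type*} (g : E d →ᵃ[ℝ] ℝ) (s : Finset ι) (w : ι → ℝ) (z : ι → E d)
    (hw : ∑ i ∈ s, w i = 1) : g (∑ i ∈ s, w i • z i) = ∑ i ∈ s, w i * g (z i) := by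
  have := s.map_affineCombination z w hw g
  rw [s.affineCombination_eq_linear_combination _ _ hw,
    s.affineCombination_eq_linear_combination _ _ hw] at this
  simpa using this

lemma IsSimplex.affine_eq {s : Finset (E d)} (h : IsSimplex s) (g : E d →ᵃ[ℝ] ℝ) (p : E d) :
    g p = ∑ y ∈ s, bary s y p * g y := by
  conv_lhs => rw [← h.sum_bary_smul p]
  exact affine_sum g s _ id (h.sum_bary p)

lemma IsSimplex.bary_unique {s : Finset (E d)} (h : IsSimplex s) {w : E d → ℝ} {p : E d}
    (hw : ∑ y ∈ s, w y = 1) (hp : ∑ y ∈ s, w y • y = p) {y : E d} (hy : y ∈ s) :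
    bary s y p = w y := by
  rw [← hp, affine_sum (bary s y) s w (fun z => z) hw,
    Finset.sum_congr rfl fun z hz => by rw [h.bary_vertex hy hz]]
  simp [hy]

lemma IsSimplex.range_basis {s : Finset (E d)} (h : IsSimplex s) :
    Set.range h.basis = (s : Set (E d)) := by
  change Set.range ((↑) : s → E d) = _
  simp

lemma IsSimplex.mem_simplex {s : Finset (E d)} (h : IsSimplex s) {p : E d} :
    p ∈ simplex s ↔ ∀ y ∈ s, 0 ≤ bary s y p := by
  rw [simplex, ← h.range_basis, h.basis.convexHull_eq_nonneg_coord]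
  constructor
  · intro hp y hy
    rw [h.bary_eq ⟨y, hy⟩]; exact hp _
  · intro hp y
    rw [← h.bary_eq]; exact hp y y.2

lemma IsSimplex.mem_interior {s : Finset (E d)} (h : IsSimplex s) {p : E d} :
    p ∈ interior (simplex s) ↔ ∀ y ∈ s, 0 < bary s y p := by
  rw [simplex, ← h.range_basis, h.basis.interior_convexHull]
  constructor
  · intro hp y hy
    rw [h.bary_eq ⟨y, hy⟩]; exact hp _
  · intro hp y
    rw [← h.bary_eq]; exact hp y y.2

lemma convex_simplex (s : Finset (E d)) : Convex ℝ (simplex s) := convex_convexHull _ _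

lemma isCompact_simplex (s : Finset (E d)) : IsCompact (simplex s) :=
  s.finite_toSet.isCompact_convexHull (𝕜 := ℝ)

lemma isClosed_simplex (s : Finset (E d)) : IsClosed (simplex s) := (isCompact_simplex s).isClosed

lemma measurableSet_simplex (s : Finset (E d)) : MeasurableSet (simplex s) :=
  (isClosed_simplex s).measurableSet

lemma vertex_mem_simplex {s : Finset (E d)} {y : E d} (hy : y ∈ s) : y ∈ simplex s :=
  subset_convexHull ℝ _ hy

lemma IsSimplex.nonempty {s : Finset (E d)} (h : IsSimplex s) : s.Nonempty := by
  rw [← Finset.card_pos, h.1]; omega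

lemma IsSimplex.interior_nonempty {s : Finset (E d)} (h : IsSimplex s) :
    (interior (simplex s)).Nonempty := by
  rw [simplex, interior_convexHull_nonempty_iff_affineSpan_eq_top]
  simpa using h.affineSpan_eq_top

lemma IsSimplex.closure_interior {s : Finset (E d)} (h : IsSimplex s) :
    closure (interior (simplex s)) = simplex s := by
  exact (Convex.closure_interior_eq_closure_of_nonempty_interior (𝕜 := ℝ) (convex_simplex s)
    h.interior_nonempty).trans (isClosed_simplex s).closure_eq

lemma continuous_affine (g : E d →ᵃ[ℝ] ℝ) : Continuous g := g.continuous_of_finiteDimensional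

lemma bary_nonneg {s : Finset (E d)} {p : E d} (hp : p ∈ simplex s) (y : E d) :
    0 ≤ bary s y p := by
  by_cases hy : IsSimplex s ∧ y ∈ s
  · exact hy.1.mem_simplex.1 hp y hy.2
  · simp [bary, hy]

lemma bary_le_one {s : Finset (E d)} {p : E d} (hp : p ∈ simplex s) (y : E d) :
    bary s y p ≤ 1 := by
  by_cases hy : IsSimplex s ∧ y ∈ s
  · rw [← hy.1.sum_bary p]
    exact Finset.single_le_sum (f := fun y => bary s y p) (fun z _ => bary_nonneg hp z) hy.2
  · simp [bary, hy]

lemma IsSimplex.affine_ext {s : Finset (E d)} (h : IsSimplex s) {f g : E d →ᵃ[ℝ] ℝ}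
    (hfg : ∀ y ∈ s, f y = g y) : f = g := by
  ext p
  rw [h.affine_eq f, h.affine_eq g]
  exact Finset.sum_congr rfl fun y hy => by rw [hfg y hy]

lemma affine_ext_of_isOpen {U : Set (E d)} (hU : IsOpen U) (hne : U.Nonempty)
    {f g : E d →ᵃ[ℝ] ℝ} (hfg : Set.EqOn f g U) : f = g := by
  have := hU.affineSpan_eq_top hne
  exact AffineMap.ext_on this hfg

lemma affineMap_sum_apply {ι : Type*} (s : Finset ι) (f : ι → E d →ᵃ[ℝ] ℝ) (p : E d) :
    (∑ i ∈ s, f i) p = ∑ i ∈ s, f i p := by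
  induction s using Finset.induction_on with
  | empty => simp
  | insert a s ha ih => simp [Finset.sum_insert ha, ih]

/-- The affine interpolant of `f` at the vertices of `s`. -/
def affInterp (s : Finset (E d)) (f : E d → ℝ) : E d →ᵃ[ℝ] ℝ := ∑ y ∈ s, f y • bary s y

lemma affInterp_apply (s : Finset (E d)) (f : E d → ℝ) (p : E d) :
    affInterp s f p = ∑ y ∈ s, f y * bary s y p := by
  rw [affInterp, affineMap_sum_apply]
  simp

lemma affInterp_congr {s : Finset (E d)} {f g : E d → ℝ} (h : ∀ y ∈ s, f y = g y) :
    affInterp s f = affInterp s g :=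
  Finset.sum_congr rfl fun y hy => by rw [h y hy]

lemma IsSimplex.affInterp_vertex {s : Finset (E d)} (h : IsSimplex s) (f : E d → ℝ) {y : E d}
    (hy : y ∈ s) : affInterp s f y = f y := by
  rw [affInterp_apply, Finset.sum_congr rfl fun z hz => by rw [h.bary_vertex hz hy]]
  simp [hy]

lemma affInterp_smul (s : Finset (E d)) (c : ℝ) (f : E d → ℝ) :
    affInterp s (c • f) = c • affInterp s f := by
  simp [affInterp, mul_smul, Finset.smul_sum]

lemma abs_affine_le {s : Finset (E d)} (g : E d →ᵃ[ℝ] ℝ) {B : ℝ}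
    (hB : ∀ y ∈ s, |g y| ≤ B) {p : E d} (hp : p ∈ simplex s) : |g p| ≤ B := by
  have hc : Convex ℝ {q | |g q| ≤ B} := by
    have : {q | |g q| ≤ B} = g ⁻¹' (Set.Icc (-B) B) := by
      ext q; simp [abs_le]
    rw [this]; exact (convex_Icc _ _).affine_preimage g
  exact convexHull_min (t := {q | |g q| ≤ B}) (fun y hy => hB y hy) hc hp

lemma convexHull_inter_subset_face {s t : Finset (E d)} (hs : IsSimplex s) {p : E d}
    (hp : p ∈ convexHull ℝ ((s : Set (E d)) ∩ (t : Set (E d)))) {y : E d} (hys : y ∈ s)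
    (hyt : y ∉ t) : bary s y p = 0 := by
  have hc : Convex ℝ {q | bary s y q = 0} :=
    (convex_singleton (0 : ℝ)).affine_preimage (bary s y)
  refine convexHull_min (t := {q | bary s y q = 0}) (fun z hz => ?_) hc hp
  have : y ≠ z := fun h => hyt (h ▸ hz.2)
  simp [hs.bary_vertex hys hz.1, this]

lemma bary_eq_zero_of_mem_face {s : Finset (E d)} (hs : IsSimplex s) {x : E d} (hx : x ∈ s)
    {p : E d} (hp : p ∈ simplex (s.erase x)) : bary s x p = 0 := by
  refine convexHull_inter_subset_face (t := s.erase x) hs ?_ hx (by simp)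
  refine convexHull_mono ?_ hp
  intro y hy
  exact ⟨(Finset.mem_erase.1 hy).2, hy⟩

lemma face_subset (s : Finset (E d)) (x : E d) : simplex (s.erase x) ⊆ simplex s :=
  convexHull_mono (by simp)

lemma interior_inter_face {s : Finset (E d)} (hs : IsSimplex s) {x : E d} (hx : x ∈ s) :
    Disjoint (interior (simplex s)) (simplex (s.erase x)) := by
  rw [Set.disjoint_left]
  intro p hp hp'
  have := hs.mem_interior.1 hp x hx
  rw [bary_eq_zero_of_mem_face hs hx hp'] at this
  exact lt_irrefl _ this

/-- On a common point of two elements the barycentric coordinates of vertices that are not shared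
vanish. -/
lemma Mesh.bary_eq_zero (K : Mesh d) {s t : Finset (E d)} (hs : s ∈ K.elems) (ht : t ∈ K.elems)
    {p : E d} (hps : p ∈ simplex s) (hpt : p ∈ simplex t) {y : E d} (hys : y ∈ s) (hyt : y ∉ t) :
    bary s y p = 0 :=
  convexHull_inter_subset_face (K.isSimplex hs) (K.inter_subset s hs t ht ⟨hps, hpt⟩) hys hyt

lemma Mesh.interior_disjoint (K : Mesh d) {s t : Finset (E d)} (hs : s ∈ K.elems)
    (ht : t ∈ K.elems) (hst : s ≠ t) : Disjoint (interior (simplex s)) (simplex t) := by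
  rw [Set.disjoint_left]
  intro p hps hpt
  have hnot : ¬ s ⊆ t := fun h =>
    hst (Finset.eq_of_subset_of_card_le h (by rw [K.card_eq s hs, K.card_eq t ht]))
  obtain ⟨y, hys, hyt⟩ := Finset.not_subset.1 hnot
  have h1 := (K.isSimplex hs).mem_interior.1 hps y hys
  rw [K.bary_eq_zero hs ht (interior_subset hps) hpt hys hyt] at h1
  exact lt_irrefl _ h1

/-- On common points the barycentric coordinates of two elements agree. -/
lemma Mesh.bary_eq_bary (K : Mesh d) {s t : Finset (E d)} (hs : s ∈ K.elems) (ht : t ∈ K.elems)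
    {p : E d} (hps : p ∈ simplex s) (hpt : p ∈ simplex t) (y : E d) :
    bary s y p = bary t y p := by
  -- By conformity the coordinates of `p` in `s` vanish at vertices outside `t`. Extended by zero
  -- they represent `p` in `t`, and barycentric coordinates are unique.
  have key : ∀ z ∈ t, bary t z p = if z ∈ s then bary s z p else 0 := by
    intro z hz
    have hsub : ∀ f : E d → ℝ, ∑ y ∈ t, (if y ∈ s then f y * bary s y p else 0) =
        ∑ y ∈ s, f y * bary s y p := by
      intro f
      rw [← Finset.sum_filter]
      refine Finset.sum_subset_zero_on_sdiff (fun y hy => (Finset.mem_filter.1 hy).2) ?_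
        (fun _ _ => rfl)
      intro y hy
      rw [Finset.mem_sdiff, Finset.mem_filter] at hy
      rw [K.bary_eq_zero hs ht hps hpt hy.1 (fun h => hy.2 ⟨h, hy.1⟩), mul_zero]
    refine (K.isSimplex ht).bary_unique (w := fun z => if z ∈ s then bary s z p else 0) ?_ ?_ hz
    · simpa [(K.isSimplex hs).sum_bary] using hsub 1
    · conv_rhs => rw [← (K.isSimplex hs).sum_bary_smul p]
      simp only [ite_smul, zero_smul]
      rw [← Finset.sum_filter]
      refine Finset.sum_subset_zero_on_sdiff (fun y hy => (Finset.mem_filter.1 hy).2) ?_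
        (fun _ _ => rfl)
      intro y hy
      rw [Finset.mem_sdiff, Finset.mem_filter] at hy
      rw [K.bary_eq_zero hs ht hps hpt hy.1 (fun h => hy.2 ⟨h, hy.1⟩), zero_smul]
  by_cases hyt : y ∈ t
  · rw [key y hyt]
    split_ifs with hys
    · rfl
    · simp [bary_of_notMem hys]
  · rw [bary_of_notMem hyt]
    by_cases hys : y ∈ s
    · simpa using K.bary_eq_zero hs ht hps hpt hys hyt
    · simp [bary_of_notMem hys]

/-- Uniqueness of barycentric coordinates within an element and conformity between elements make the
set under the supremum a singleton. -/
lemma Mesh.hat_eq (K : Mesh d) {s : Finset (E d)} (hs : s ∈ K.elems) {p : E d}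
    (hp : p ∈ simplex s) (x : E d) : K.hat x p = bary s x p := by
  have : {r : ℝ | ∃ s ∈ K.elems, ∃ w : E d → ℝ, (∀ y ∈ s, 0 ≤ w y) ∧ ∑ y ∈ s, w y = 1 ∧
    ∑ y ∈ s, w y • y = p ∧ r = if x ∈ s then w x else 0} = {bary s x p} := by
    ext r
    simp only [Set.mem_ofPred_eq, Set.mem_singleton_iff]
    constructor
    · rintro ⟨t, ht, w, hw0, hw1, hwp, rfl⟩
      have hT := K.isSimplex ht
      have hpt : p ∈ simplex t := by
        rw [hT.mem_simplex]
        intro y hy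
        rw [hT.bary_unique hw1 hwp hy]; exact hw0 y hy
      rw [K.bary_eq_bary hs ht hp hpt]
      split_ifs with hx
      · exact (hT.bary_unique hw1 hwp hx).symm
      · simp [bary_of_notMem hx]
    · rintro rfl
      have hT := K.isSimplex hs
      refine ⟨s, hs, fun y => bary s y p, fun y _ => bary_nonneg hp y, hT.sum_bary p,
        hT.sum_bary_smul p, ?_⟩
      split_ifs with hx
      · rfl
      · simp [bary_of_notMem hx]
  rw [Mesh.hat, this, csSup_singleton]

/-! ### Gradients of affine functions -/

/-- The gradient of an affine function. -/
def grad : (E d →ᵃ[ℝ] ℝ) →ₗ[ℝ] E d where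
  toFun g := (InnerProductSpace.toDual ℝ (E d)).symm g.linear.toContinuousLinearMap
  map_add' f g := by simp
  map_smul' c f := by simp

lemma inner_grad (g : E d →ᵃ[ℝ] ℝ) (v : E d) : inner ℝ (grad g) v = g.linear v := by
  simp [grad]

lemma affine_sub (g : E d →ᵃ[ℝ] ℝ) (p q : E d) : g p - g q = inner ℝ (grad g) (p - q) := by
  rw [inner_grad]
  have := g.linearMap_vsub p q
  simpa using this.symm

lemma hasGradientAt_affine (g : E d →ᵃ[ℝ] ℝ) (p : E d) : HasGradientAt g (grad g) p := by
  have h1 : HasFDerivAt (fun q => g.linear.toContinuousLinearMap q + g 0)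
      g.linear.toContinuousLinearMap p :=
    g.linear.toContinuousLinearMap.hasFDerivAt.add_const _
  rw [hasGradientAt_iff_hasFDerivAt]
  have h2 : (fun q => g.linear.toContinuousLinearMap q + g 0) = g := by
    rw [g.decomp]; ext q; simp
  rw [h2] at h1
  simpa [grad] using h1

lemma gradient_eq_of_eqOn {U : Set (E d)} (hU : IsOpen U) {v : E d → ℝ} {g : E d →ᵃ[ℝ] ℝ}
    (h : Set.EqOn v g U) {p : E d} (hp : p ∈ U) : gradient v p = grad g := by
  have : v =ᶠ[𝓝 p] g := h.eventuallyEq_of_mem (hU.mem_nhds hp)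
  rw [this.gradient.eq_of_nhds]
  exact (hasGradientAt_affine g p).gradient

lemma abs_affine_sub_le (g : E d →ᵃ[ℝ] ℝ) (p q : E d) : |g p - g q| ≤ ‖grad g‖ * dist p q := by
  rw [affine_sub, dist_eq_norm]
  exact abs_real_inner_le_norm _ _

/-- Along the diameter in the direction of the gradient the function changes by `2 r ‖grad g‖`,
while its two end values lie in `[-B, B]`. -/
lemma norm_grad_le {g : E d →ᵃ[ℝ] ℝ} {z : E d} {r B : ℝ} (hr : 0 < r)
    (h : ∀ p ∈ Metric.ball z r, |g p| ≤ B) : ‖grad g‖ ≤ B / r := by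
  rw [le_div_iff₀ hr]
  by_cases h0 : grad g = 0
  · rw [h0]; simpa using (abs_nonneg _).trans (h z (Metric.mem_ball_self hr))
  have hn : 0 < ‖grad g‖ := norm_pos_iff.2 h0
  have key : ∀ ρ, 0 < ρ → ρ < r → ‖grad g‖ * ρ ≤ B := by
    intro ρ h1 h2
    set u : E d := (ρ / ‖grad g‖) • grad g with hu
    have hun : ‖u‖ = ρ := by
      rw [hu, norm_smul, Real.norm_eq_abs, abs_of_pos (by positivity)]; field_simp
    have e1 := abs_le.1 (h (z + u) (by simpa [hun] using h2))
    have e2 := abs_le.1 (h (z - u) (by simpa [hun] using h2))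
    have e3 := affine_sub g (z + u) (z - u)
    have e4 : (z + u) - (z - u) = (2 : ℝ) • u := by rw [two_smul]; abel
    rw [e4, inner_smul_right, hu, inner_smul_right, real_inner_self_eq_norm_sq] at e3
    have : 2 * (ρ / ‖grad g‖ * ‖grad g‖ ^ 2) = 2 * (‖grad g‖ * ρ) := by field_simp
    linarith [e1.2, e2.1]
  -- The ball is open, so the bound is available only for radii below `r` and is passed to the
  -- limit.
  refine le_of_forall_lt fun c hc => ?_
  by_contra hB
  rw [not_lt] at hB
  obtain ⟨ρ, h1, h2⟩ : ∃ ρ, c / ‖grad g‖ < ρ ∧ ρ < r :=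
    exists_between (by rw [div_lt_iff₀ hn]; linarith)
  have hB0 : 0 ≤ B := (abs_nonneg _).trans (h z (Metric.mem_ball_self hr))
  have hρ : 0 < ρ := lt_of_le_of_lt (by have := hB0.trans hB; positivity) h1
  have := key ρ hρ h2
  rw [div_lt_iff₀ hn] at h1
  linarith

/-- The diameter of a simplex bounds the distance of its points. -/
lemma dist_le_diam_simplex {s : Finset (E d)} {p q : E d} (hp : p ∈ simplex s)
    (hq : q ∈ simplex s) : dist p q ≤ Metric.diam (simplex s) :=
  Metric.dist_le_diam_of_mem (isCompact_simplex s).isBounded hp hq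

lemma grad_const (a : ℝ) : grad (AffineMap.const ℝ (E d) a) = 0 := by
  simp [grad]

lemma IsSimplex.norm_grad_interp_le {s : Finset (E d)} (hs : IsSimplex s) {z : E d} {r V a : ℝ}
    (hr : 0 < r) (hball : Metric.ball z r ⊆ simplex s) {F : E d → ℝ}
    (hF : ∀ y ∈ s, |F y - a| ≤ V) : ‖grad (affInterp s F)‖ ≤ V / r := by
  have h1 : grad (affInterp s F) = grad (affInterp s F - AffineMap.const ℝ (E d) a) := by
    rw [map_sub, grad_const, sub_zero]
  rw [h1]
  refine norm_grad_le hr fun p hp => abs_affine_le _ (fun y hy => ?_) (hball hp)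
  simpa [hs.affInterp_vertex F hy] using hF y hy

/-- Freezing `η` at one vertex splits the product into a multiple of `g` and a remainder with nodal
values at most `G D B`. Only the remainder needs an inverse estimate, and with `D` the diameter of a
shape regular cell the ratio `D / r` is harmless. -/
lemma IsSimplex.norm_grad_interp_mul_le {s : Finset (E d)} (hs : IsSimplex s) {z : E d}
    {r B G D : ℝ} (hr : 0 < r) (hball : Metric.ball z r ⊆ simplex s) {η g : E d →ᵃ[ℝ] ℝ}
    (hη : ∀ y ∈ s, |η y| ≤ 1) (hG : ‖grad η‖ ≤ G) (hD : Metric.diam (simplex s) ≤ D)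
    (hg : ∀ y ∈ s, |g y| ≤ B) :
    ‖grad (affInterp s fun y => η y * g y)‖ ≤ ‖grad g‖ + G * D * B / r := by
  obtain ⟨y₀, hy₀⟩ := hs.nonempty
  have e : affInterp s (fun y => η y * g y) =
      η y₀ • g + affInterp s (fun y => (η y - η y₀) * g y) := by
    refine hs.affine_ext fun y hy => ?_
    simp only [AffineMap.coe_add, Pi.add_apply, AffineMap.coe_smul, Pi.smul_apply, smul_eq_mul,
      hs.affInterp_vertex _ hy]
    ring
  rw [e, map_add, map_smul]
  refine (norm_add_le _ _).trans (add_le_add ?_ ?_)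
  · rw [norm_smul]
    exact mul_le_of_le_one_left (norm_nonneg _) (hη y₀ hy₀)
  · refine hs.norm_grad_interp_le (a := 0) hr hball fun y hy => ?_
    rw [sub_zero, abs_mul]
    have hG0 : 0 ≤ G := (norm_nonneg _).trans hG
    have hD0 : 0 ≤ D := Metric.diam_nonneg.trans hD
    refine mul_le_mul ?_ (hg y hy) (abs_nonneg _) (by positivity)
    refine (abs_affine_sub_le η y y₀).trans (mul_le_mul hG ?_ dist_nonneg hG0)
    exact (dist_le_diam_simplex (vertex_mem_simplex hy) (vertex_mem_simplex hy₀)).trans hD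

/-! ### Norm equivalence on simplices -/

/-- The measure `μ` scales under homotheties like an `n`-dimensional measure. -/
def ScalesLike (μ : Measure (E d)) (n : ℕ) : Prop :=
  ∀ (q : E d) (ρ : ℝ), 0 < ρ → ∀ A : Set (E d),
    μ (AffineMap.homothety q ρ '' A) = ENNReal.ofReal (ρ ^ n) * μ A

lemma scalesLike_volume : ScalesLike (volume : Measure (E d)) d := by
  intro q ρ hρ A
  rw [Measure.addHaar_image_homothety]
  simp [abs_of_pos hρ]

lemma scalesLike_hausdorff (n : ℕ) : ScalesLike (μHE[n] : Measure (E d)) n := by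
  intro q ρ hρ A
  rw [euclideanHausdorffMeasure_homothety_image n q hρ.ne']
  rw [ENNReal.smul_def, smul_eq_mul]
  congr 1
  rw [ENNReal.ofReal]
  congr 1
  ext
  simp [abs_of_pos hρ, hρ.le]

lemma homothety_subset_simplex {s : Finset (E d)} {q : E d} (hq : q ∈ simplex s) {ρ : ℝ}
    (h0 : 0 ≤ ρ) (h1 : ρ ≤ 1) : AffineMap.homothety q ρ '' simplex s ⊆ simplex s := by
  rintro _ ⟨p, hp, rfl⟩
  rw [AffineMap.homothety_eq_lineMap]
  exact (convex_simplex s).lineMap_mem hq hp ⟨h0, h1⟩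

lemma affine_homothety (g : E d →ᵃ[ℝ] ℝ) (q p : E d) (ρ : ℝ) :
    g (AffineMap.homothety q ρ p) = (1 - ρ) * g q + ρ * g p := by
  rw [AffineMap.homothety_eq_lineMap, AffineMap.apply_lineMap, AffineMap.lineMap_apply_ring]

/-- The integral is restricted to a shrunken copy of the simplex on which `f` is at least `m`. Only
the scaling of the measure enters, so volume and surface measure are treated alike and no mass
matrix is computed. -/
lemma setIntegral_ge_of_homothety {μ : Measure (E d)} {n : ℕ} (hμ : ScalesLike μ n)
    {s : Finset (E d)} (hfin : μ (simplex s) ≠ ⊤) {f : E d → ℝ}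
    (hf : ContinuousOn f (simplex s)) (hf0 : ∀ p ∈ simplex s, 0 ≤ f p)
    {q : E d} (hq : q ∈ simplex s) {ρ m : ℝ} (h0 : 0 < ρ) (h1 : ρ ≤ 1)
    (hm : ∀ p ∈ simplex s, m ≤ f (AffineMap.homothety q ρ p)) :
    ρ ^ n * μ.real (simplex s) * m ≤ ∫ p in simplex s, f p ∂μ := by
  set A := AffineMap.homothety q ρ '' simplex s
  have hA : A ⊆ simplex s := homothety_subset_simplex hq h0.le h1
  have hAm : IsCompact A :=
    (isCompact_simplex s).image (AffineMap.homothety q ρ).continuous_of_finiteDimensional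
  have hint : IntegrableOn f (simplex s) μ := by
    obtain ⟨C, hC⟩ := (isCompact_simplex s).exists_bound_of_continuousOn hf
    exact IntegrableOn.of_bound hfin.lt_top
      (hf.aestronglyMeasurable (measurableSet_simplex s)) C
      ((ae_restrict_iff' (measurableSet_simplex s)).2 (ae_of_all _ hC))
  have hAfin : μ A ≠ ⊤ := ne_top_of_le_ne_top hfin (measure_mono hA)
  have hAr : μ.real A = ρ ^ n * μ.real (simplex s) := by
    rw [Measure.real, hμ q ρ h0, ENNReal.toReal_mul, ENNReal.toReal_ofReal (by positivity)]; rfl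
  calc ρ ^ n * μ.real (simplex s) * m = ∫ _ in A, m ∂μ := by
        rw [setIntegral_const, smul_eq_mul, hAr]
    _ ≤ ∫ p in A, f p ∂μ := by
        refine setIntegral_mono_on ?_ (hint.mono_set hA) hAm.measurableSet ?_
        · exact integrableOn_const hAfin
        · rintro _ ⟨p, hp, rfl⟩; exact hm p hp
    _ ≤ ∫ p in simplex s, f p ∂μ :=
        setIntegral_mono_set hint
          ((ae_restrict_iff' (measurableSet_simplex s)).2 (ae_of_all _ hf0))
          (LE.le.eventuallyLE hA)

/-- Shrink by `1/4` towards a vertex where `|g|` is maximal: there `|g|` is at least `3/4 - 1/4 =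
1/2` of the maximum. The factor `4 ^ n` is the loss of measure, the last `4` comes from squaring
`1/2`. -/
lemma vertex_sq_le {μ : Measure (E d)} {n : ℕ} (hμ : ScalesLike μ n)
    {s : Finset (E d)} (hfin : μ (simplex s) ≠ ⊤) (g : E d →ᵃ[ℝ] ℝ) {y : E d} (hy : y ∈ s) :
    μ.real (simplex s) * (g y) ^ 2 ≤ 4 ^ (n + 1) * ∫ p in simplex s, (g p) ^ 2 ∂μ := by
  obtain ⟨y₀, hy₀, hmax⟩ := s.exists_max_image (fun z => |g z|) ⟨y, hy⟩
  have key := setIntegral_ge_of_homothety hμ hfin (f := fun p => (g p) ^ 2) (q := y₀)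
    (ρ := 1 / 4) (m := (g y₀) ^ 2 / 4) ((continuous_affine g).pow 2).continuousOn
    (fun p _ => sq_nonneg _) (vertex_mem_simplex hy₀) (by norm_num) (by norm_num) (by
      intro p hp
      have h1 := abs_affine_le g hmax hp
      simp only [affine_homothety]
      have h2 := sq_le_sq' (abs_le.1 h1).1 (abs_le.1 h1).2
      rw [sq_abs] at h2
      rcases abs_cases (g y₀) with ⟨h, h'⟩ | ⟨h, h'⟩ <;> rw [h] at h1 <;>
        have := abs_le.1 h1 <;> nlinarith)
  have h3 : (g y) ^ 2 ≤ (g y₀) ^ 2 := sq_le_sq.2 (hmax y hy)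
  have h4 : μ.real (simplex s) * (g y) ^ 2 ≤ μ.real (simplex s) * (g y₀) ^ 2 :=
    mul_le_mul_of_nonneg_left h3 measureReal_nonneg
  have h5 : (4 : ℝ) ^ (n + 1) * ((1 / 4) ^ n * μ.real (simplex s) * ((g y₀) ^ 2 / 4)) =
      μ.real (simplex s) * (g y₀) ^ 2 := by
    rw [pow_succ, div_pow, one_pow]; field_simp
  calc _ ≤ _ := h4
    _ = _ := h5.symm
    _ ≤ _ := by gcongr

lemma setIntegral_sq_le {μ : Measure (E d)} {s : Finset (E d)} (hfin : μ (simplex s) ≠ ⊤)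
    (g : E d →ᵃ[ℝ] ℝ) {B : ℝ} (hB : ∀ y ∈ s, |g y| ≤ B) :
    ∫ p in simplex s, (g p) ^ 2 ∂μ ≤ μ.real (simplex s) * B ^ 2 := by
  have := norm_setIntegral_le_of_norm_le_const (f := fun p => (g p) ^ 2) (C := B ^ 2)
    hfin.lt_top (fun p hp => by
      rw [Real.norm_eq_abs, abs_pow]
      exact pow_le_pow_left₀ (abs_nonneg _) (abs_affine_le g hB hp) 2)
  rw [mul_comm]
  exact (le_abs_self _).trans this

lemma volume_simplex_ne_top (s : Finset (E d)) : volume (simplex s) ≠ ⊤ :=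
  (isCompact_simplex s).measure_lt_top.ne

/-- The simplex lies in a Lipschitz image of the unit cube of dimension `n`, whose Hausdorff measure
is Lebesgue measure. -/
lemma hausdorff_simplex_ne_top {s : Finset (E d)} {n : ℕ} (hs : s.card = n + 1) :
    (μHE[n] : Measure (E d)) (simplex s) ≠ ⊤ := by
  obtain ⟨y₀, hy₀⟩ : s.Nonempty := by rw [← Finset.card_pos]; omega
  set ι := {y // y ∈ s.erase y₀}
  have hcard : Fintype.card ι = n := by
    rw [Fintype.card_coe, Finset.card_erase_of_mem hy₀, hs]; rfl
  let A : (ι → ℝ) →ₗ[ℝ] E d := Fintype.linearCombination ℝ (fun y : ι => (y : E d) - y₀)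
  have hA : ∀ w, A w = ∑ y : ι, w y • ((y : E d) - y₀) := fun w =>
    Fintype.linearCombination_apply ..
  let F : (ι → ℝ) → E d := fun w => A.toContinuousLinearMap w + y₀
  have hF : LipschitzWith ‖A.toContinuousLinearMap‖₊ F := by
    intro w w'
    simpa [F] using A.toContinuousLinearMap.lipschitz w w'
  have hsub : simplex s ⊆ F '' Set.Icc 0 1 := by
    intro p hp
    rw [simplex, Finset.mem_convexHull'] at hp
    obtain ⟨w, hw0, hw1, hwp⟩ := hp
    refine ⟨fun y => w y, ⟨fun y => hw0 _ (Finset.mem_of_mem_erase y.2), fun y => ?_⟩, ?_⟩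
    · show w y ≤ 1
      rw [← hw1]
      exact Finset.single_le_sum hw0 (Finset.mem_of_mem_erase y.2)
    · change A (fun y => w y) + y₀ = p
      rw [hA, ← hwp, Finset.sum_coe_sort (s.erase y₀) (fun y => w y • (y - y₀))]
      rw [← Finset.add_sum_erase s w hy₀] at hw1
      rw [← Finset.add_sum_erase s (fun y => w y • y) hy₀]
      simp only [smul_sub, Finset.sum_sub_distrib, ← Finset.sum_smul]
      rw [← eq_sub_iff_add_eq'] at hw1
      rw [hw1, sub_smul, one_smul]
      abel
  have h1 : (μH[n] : Measure (E d)) (simplex s) ≠ ⊤ := by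
    refine ne_top_of_le_ne_top ?_ (measure_mono hsub)
    refine ne_top_of_le_ne_top ?_ (hF.hausdorffMeasure_image_le (Nat.cast_nonneg n) _)
    refine ENNReal.mul_ne_top (by simp) ?_
    have : (μH[(n : ℝ)] : Measure (ι → ℝ)) = volume := by
      rw [← hcard]; exact hausdorffMeasure_pi_real
    rw [this]
    exact isCompact_Icc.measure_lt_top.ne
  rw [Measure.euclideanHausdorffMeasure_def, Measure.smul_apply]
  exact ENNReal.mul_ne_top ENNReal.coe_ne_top h1

lemma face_measure_ne_top {s : Finset (E d)} (hs : IsSimplex s) (hd : 1 ≤ d) {x : E d}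
    (hx : x ∈ s) : (μHE[d - 1] : Measure (E d)) (simplex (s.erase x)) ≠ ⊤ := by
  refine hausdorff_simplex_ne_top ?_
  rw [Finset.card_erase_of_mem hx, hs.1]; omega

/-! ### Pasting along finitely many closed simplices. -/

lemma continuousOn_of_simplex_cover {I : Finset (Finset (E d))} {U : Set (E d)} {v : E d → ℝ}
    (hU : U ⊆ ⋃ c ∈ I, simplex c) (hv : ∀ c ∈ I, ContinuousOn v (simplex c ∩ U)) :
    ContinuousOn v U := by
  intro p hp
  have h1 : U = ⋃ c ∈ (I : Set (Finset (E d))), (simplex c ∩ U) := by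
    ext q
    simp only [Set.mem_iUnion, Set.mem_inter_iff, Finset.mem_coe, exists_prop]
    constructor
    · intro hq
      obtain ⟨c, hc, hqc⟩ := Set.mem_iUnion₂.1 (hU hq)
      exact ⟨c, hc, hqc, hq⟩
    · rintro ⟨c, -, -, hq⟩; exact hq
  have h2 : 𝓝[U] p = ⨆ c ∈ (I : Set (Finset (E d))), 𝓝[simplex c ∩ U] p := by
    rw [← nhdsWithin_biUnion I.finite_toSet]
    exact congrArg (fun A => 𝓝[A] p) h1
  rw [ContinuousWithinAt, h2, tendsto_iSup]
  intro c
  rw [tendsto_iSup]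
  intro hc
  by_cases hpc : p ∈ simplex c
  · exact hv c hc p ⟨hpc, hp⟩
  · have : 𝓝[simplex c ∩ U] p = ⊥ := by
      rw [← not_neBot, ← mem_closure_iff_nhdsWithin_neBot]
      exact fun h => hpc ((isClosed_simplex c).closure_subset
        (closure_mono Set.inter_subset_left h))
    rw [this]; exact tendsto_bot

lemma eqOn_of_eqOn_interior {U : Set (E d)} {v : E d → ℝ} (hv : ContinuousOn v U)
    {c : Finset (E d)} (hc : IsSimplex c) (hcU : interior (simplex c) ⊆ U) {g : E d →ᵃ[ℝ] ℝ}
    (h : Set.EqOn v g (interior (simplex c))) : Set.EqOn v g (simplex c ∩ U) := by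
  rintro p ⟨hpc, hp⟩
  rw [← hc.closure_interior] at hpc
  have : (𝓝[interior (simplex c)] p).NeBot := mem_closure_iff_nhdsWithin_neBot.1 hpc
  have h1 : Tendsto v (𝓝[interior (simplex c)] p) (𝓝 (v p)) :=
    (hv p hp).mono_left (nhdsWithin_mono _ hcU)
  have h2 : Tendsto v (𝓝[interior (simplex c)] p) (𝓝 (g p)) := by
    have := ((continuous_affine g).tendsto p).mono_left
      (nhdsWithin_le_nhds (s := interior (simplex c)))
    exact this.congr' ((h.eventuallyEq_nhdsWithin).symm)
  exact tendsto_nhds_unique h1 h2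

namespace Setting

variable {S : Setting d}

/-! ### The reference cells -/

/-- The elements outside the enriched region. -/
def unrefined (S : Setting d) : Finset (Finset (E d)) := S.cutMesh \ S.boundaryLayer S.k

/-- The cells on which reference functions are affine: the fine elements and the coarse elements
outside the enriched region. -/
def cells (S : Setting d) : Finset (Finset (E d)) := S.fine.elems ∪ S.unrefined

/-- The cells contained in the coarse element `T`. -/
def sub (S : Setting d) (T : Finset (E d)) : Finset (Finset (E d)) :=
  S.cells.filter fun c => simplex c ⊆ simplex T

lemma cut_mem_coarse {T : Finset (E d)} (hT : T ∈ S.cutMesh) : T ∈ S.coarse.elems :=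
  (Finset.mem_filter.1 hT).1

lemma isSimplex_cut {T : Finset (E d)} (hT : T ∈ S.cutMesh) : IsSimplex T :=
  S.coarse.isSimplex (cut_mem_coarse hT)

lemma addLayer_subset (A : Finset (Finset (E d))) : S.addLayer A ⊆ S.cutMesh :=
  Finset.filter_subset _ _

lemma boundaryLayer_subset (l : ℕ) : S.boundaryLayer l ⊆ S.cutMesh := by
  cases l <;> exact Finset.filter_subset _ _

lemma nodeLayer_subset (x : E d) (l : ℕ) : S.nodeLayer x l ⊆ S.cutMesh := by
  cases l <;> exact Finset.filter_subset _ _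

lemma simplex_nonempty_of_cut {T : Finset (E d)} (hT : T ∈ S.cutMesh) : (simplex T).Nonempty :=
  (isSimplex_cut hT).interior_nonempty.mono interior_subset

lemma subset_addLayer {A : Finset (Finset (E d))} (hA : A ⊆ S.cutMesh) : A ⊆ S.addLayer A := by
  intro T hT
  refine Finset.mem_filter.2 ⟨hA hT, T, hT, ?_⟩
  rw [Set.inter_self]; exact simplex_nonempty_of_cut (hA hT)

lemma addLayer_mono {A B : Finset (Finset (E d))} (h : A ⊆ B) : S.addLayer A ⊆ S.addLayer B := by
  intro T hT
  obtain ⟨h1, T', h2, h3⟩ := Finset.mem_filter.1 hT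
  exact Finset.mem_filter.2 ⟨h1, T', h h2, h3⟩

lemma boundaryLayer_mono : Monotone S.boundaryLayer :=
  monotone_nat_of_le_succ fun l => subset_addLayer (boundaryLayer_subset l)

lemma nodeLayer_mono (x : E d) : Monotone (S.nodeLayer x) :=
  monotone_nat_of_le_succ fun l => subset_addLayer (nodeLayer_subset x l)

lemma mem_unrefined {T : Finset (E d)} :
    T ∈ S.unrefined ↔ T ∈ S.cutMesh ∧ T ∉ S.boundaryLayer S.k := Finset.mem_sdiff

lemma unrefined_subset {T : Finset (E d)} (hT : T ∈ S.unrefined) : simplex T ⊆ S.Ω := by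
  obtain ⟨h1, h2⟩ := mem_unrefined.1 hT
  by_contra h
  exact h2 (boundaryLayer_mono (Nat.zero_le _) (Finset.mem_filter.2 ⟨h1, h⟩))

lemma mem_boundaryLayer_zero {T : Finset (E d)} (hT : T ∈ S.cutMesh)
    (h : ¬ simplex T ⊆ S.Ω) : T ∈ S.boundaryLayer 0 := Finset.mem_filter.2 ⟨hT, h⟩

/-- Elements outside the enriched region do not touch elements that leave `Ω`. -/
lemma unrefined_disjoint (hS : S.IsSetup) {T T' : Finset (E d)} (hT : T ∈ S.unrefined)
    (hT' : T' ∈ S.boundaryLayer 0) : Disjoint (simplex T) (simplex T') := by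
  obtain ⟨h1, h2⟩ := mem_unrefined.1 hT
  rw [Set.disjoint_iff_inter_eq_empty, ← Set.not_nonempty_iff_eq_empty]
  intro h
  refine h2 (boundaryLayer_mono hS.one_le_k ?_)
  exact Finset.mem_filter.2 ⟨h1, T', hT', h⟩

lemma region_subset (A : Finset (Finset (E d))) : S.region A ⊆ S.Ω :=
  interior_subset.trans Set.inter_subset_right

lemma isOpen_region (A : Finset (Finset (E d))) : IsOpen (S.region A) := isOpen_interior

lemma interior_inter_subset_region (hS : S.IsSetup) {A : Finset (Finset (E d))}
    {T : Finset (E d)} (hT : T ∈ A) : interior (simplex T) ∩ S.Ω ⊆ S.region A := by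
  refine interior_maximal ?_ (isOpen_interior.inter hS.isOpen)
  rintro p ⟨hp, hpΩ⟩
  exact ⟨Set.mem_biUnion hT (interior_subset hp), hpΩ⟩

lemma inter_subset_closure (hS : S.IsSetup) {T : Finset (E d)} (hT : T ∈ S.cutMesh) :
    simplex T ∩ S.Ω ⊆ closure (interior (simplex T) ∩ S.Ω) := by
  conv_lhs => rw [← (isSimplex_cut hT).closure_interior]
  exact hS.isOpen.closure_inter

/-- If all elements at `p` belonged to `A`, the complement of the finitely many other closed
elements would, within `Ω`, be a neighbourhood of `p` covered by `A`. -/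
lemma exists_elem_of_notMem_region (hS : S.IsSetup) {A : Finset (Finset (E d))} {p : E d}
    (hp : p ∈ S.Ω) (hpA : p ∉ S.region A) : ∃ T ∈ S.cutMesh, T ∉ A ∧ p ∈ simplex T := by
  by_contra! hcon
  refine hpA ?_
  set B := S.cutMesh \ A
  have hcl : IsClosed (⋃ T ∈ B, simplex T) := isClosed_biUnion_finset fun T _ => isClosed_simplex T
  have hpB : p ∈ (⋃ T ∈ B, simplex T)ᶜ := by
    intro h
    obtain ⟨T, hT, hpT⟩ := Set.mem_iUnion₂.1 h
    obtain ⟨h1, h2⟩ := Finset.mem_sdiff.1 hT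
    exact hcon T h1 h2 hpT
  refine mem_interior.2 ⟨(⋃ T ∈ B, simplex T)ᶜ ∩ S.Ω, ?_, hcl.isOpen_compl.inter hS.isOpen,
    hpB, hp⟩
  rintro q ⟨hq, hqΩ⟩
  refine ⟨?_, hqΩ⟩
  obtain ⟨T, hT, hqT⟩ := Set.mem_iUnion₂.1 (hS.subset_space hqΩ)
  have hTc : T ∈ S.cutMesh := Finset.mem_filter.2 ⟨hT, q, hqT, hqΩ⟩
  by_cases hTA : T ∈ A
  · exact Set.mem_biUnion hTA hqT
  · exact absurd (Set.mem_biUnion (Finset.mem_sdiff.2 ⟨hTc, hTA⟩) hqT) hq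

lemma isSimplex_cell {c : Finset (E d)} (hc : c ∈ S.cells) : IsSimplex c := by
  rcases Finset.mem_union.1 hc with h | h
  · exact S.fine.isSimplex h
  · exact isSimplex_cut (mem_unrefined.1 h).1

lemma fine_mem_cells {t : Finset (E d)} (ht : t ∈ S.fine.elems) : t ∈ S.cells :=
  Finset.mem_union_left _ ht

lemma unrefined_mem_cells {T : Finset (E d)} (hT : T ∈ S.unrefined) : T ∈ S.cells :=
  Finset.mem_union_right _ hT

/-- This is where the exact resolution of `∂Ω` is used. A point of the interior outside `Ω` would be
a boundary point, hence on a side of some fine element, but sides do not meet the interiors of fine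
elements. -/
lemma fine_interior_subset (hS : S.IsSetup) {t : Finset (E d)} (ht : t ∈ S.fine.elems) :
    interior (simplex t) ⊆ S.Ω := by
  intro p hp
  by_contra hpΩ
  have h1 : p ∈ closure S.Ω := by
    have : p ∈ closure S.enriched := by
      rw [← hS.fine_space]; exact Set.mem_biUnion ht (interior_subset hp)
    exact closure_mono (region_subset _) this
  have h2 : p ∈ frontier S.Ω := by
    rw [frontier, hS.isOpen.interior_eq]; exact ⟨h1, hpΩ⟩
  obtain ⟨t', ht', x, hx, hpx, -⟩ := hS.resolved p h2
  by_cases h : t = t'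
  · subst h
    exact Set.disjoint_left.1 (interior_inter_face (S.fine.isSimplex ht) hx) hp hpx
  · exact Set.disjoint_left.1 (S.fine.interior_disjoint ht ht' h) hp (face_subset _ _ hpx)

lemma cell_interior_subset (hS : S.IsSetup) {c : Finset (E d)} (hc : c ∈ S.cells) :
    interior (simplex c) ⊆ S.Ω := by
  rcases Finset.mem_union.1 hc with h | h
  · exact fine_interior_subset hS h
  · exact interior_subset.trans (unrefined_subset h)

lemma exists_parent (hS : S.IsSetup) {c : Finset (E d)} (hc : c ∈ S.cells) :
    ∃ T ∈ S.cutMesh, simplex c ⊆ simplex T ∧ (c ∈ S.fine.elems ∧ T ∈ S.boundaryLayer S.k ∨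
      c = T ∧ T ∈ S.unrefined) := by
  rcases Finset.mem_union.1 hc with h | h
  · obtain ⟨T, hT, hcT⟩ := hS.fine_refines c h
    exact ⟨T, boundaryLayer_subset _ hT, hcT, Or.inl ⟨h, hT⟩⟩
  · exact ⟨c, (mem_unrefined.1 h).1, subset_rfl, Or.inr ⟨rfl, h⟩⟩

lemma parent_unique {c T T' : Finset (E d)} (hc : c ∈ S.cells) (hT : T ∈ S.coarse.elems)
    (hT' : T' ∈ S.coarse.elems) (h : simplex c ⊆ simplex T) (h' : simplex c ⊆ simplex T') :
    T = T' := by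
  by_contra hne
  obtain ⟨p, hp⟩ := (isSimplex_cell hc).interior_nonempty
  exact Set.disjoint_left.1 (S.coarse.interior_disjoint hT hT' hne) (interior_mono h hp)
    (h' (interior_subset hp))

lemma mem_sub {c T : Finset (E d)} : c ∈ S.sub T ↔ c ∈ S.cells ∧ simplex c ⊆ simplex T :=
  Finset.mem_filter

lemma fine_of_mem_sub (hS : S.IsSetup) {c T : Finset (E d)} (hT : T ∈ S.boundaryLayer S.k)
    (hc : c ∈ S.sub T) : c ∈ S.fine.elems := by
  obtain ⟨h1, h2⟩ := mem_sub.1 hc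
  obtain ⟨T', hT', h3, h4⟩ := exists_parent hS h1
  have := parent_unique h1 (cut_mem_coarse hT') (cut_mem_coarse (boundaryLayer_subset _ hT)) h3 h2
  subst this
  rcases h4 with h | h
  · exact h.1
  · exact absurd hT (mem_unrefined.1 h.2).2

lemma sub_unrefined (hS : S.IsSetup) {T : Finset (E d)} (hT : T ∈ S.unrefined) :
    S.sub T = {T} := by
  ext c
  rw [Finset.mem_singleton]
  constructor
  · intro hc
    obtain ⟨h1, h2⟩ := mem_sub.1 hc
    obtain ⟨T', hT', h3, h4⟩ := exists_parent hS h1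
    have := parent_unique h1 (cut_mem_coarse hT') (cut_mem_coarse (mem_unrefined.1 hT).1) h3 h2
    subst this
    rcases h4 with h | h
    · exact absurd h.2 (mem_unrefined.1 hT).2
    · exact h.1
  · rintro rfl
    exact mem_sub.2 ⟨unrefined_mem_cells hT, subset_rfl⟩

lemma sum_cells (hS : S.IsSetup) (F : Finset (E d) → ℝ) :
    ∑ c ∈ S.cells, F c = ∑ T ∈ S.cutMesh, ∑ c ∈ S.sub T, F c := by
  have : S.cells = S.cutMesh.biUnion S.sub := by
    ext c
    simp only [Finset.mem_biUnion, mem_sub]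
    constructor
    · intro hc
      obtain ⟨T, hT, h, -⟩ := exists_parent hS hc
      exact ⟨T, hT, hc, h⟩
    · rintro ⟨T, hT, hc, -⟩; exact hc
  rw [this, Finset.sum_biUnion]
  intro T hT T' hT' hne
  rw [Function.onFun, Finset.disjoint_left]
  intro c hc hc'
  exact hne (parent_unique (mem_sub.1 hc).1 (cut_mem_coarse hT) (cut_mem_coarse hT')
    (mem_sub.1 hc).2 (mem_sub.1 hc').2)

lemma exists_cell (hS : S.IsSetup) {p : E d} (hp : p ∈ S.Ω) : ∃ c ∈ S.cells, p ∈ simplex c := by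
  obtain ⟨T, hT, hpT⟩ := Set.mem_iUnion₂.1 (hS.subset_space hp)
  have hTc : T ∈ S.cutMesh := Finset.mem_filter.2 ⟨hT, p, hpT, hp⟩
  by_cases hTk : T ∈ S.boundaryLayer S.k
  · have h1 := closure_mono (interior_inter_subset_region hS hTk) (inter_subset_closure hS hTc ⟨hpT, hp⟩)
    change p ∈ closure S.enriched at h1
    rw [← hS.fine_space] at h1
    obtain ⟨t, ht, hpt⟩ := Set.mem_iUnion₂.1 h1
    exact ⟨t, fine_mem_cells ht, hpt⟩
  · exact ⟨T, unrefined_mem_cells (mem_unrefined.2 ⟨hTc, hTk⟩), hpT⟩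

lemma subset_iUnion_cells (hS : S.IsSetup) : S.Ω ⊆ ⋃ c ∈ S.cells, simplex c := fun _ hp => by
  obtain ⟨c, hc, h⟩ := exists_cell hS hp
  exact Set.mem_biUnion hc h

lemma cell_interior_disjoint (hS : S.IsSetup) {c c' : Finset (E d)} (hc : c ∈ S.cells)
    (hc' : c' ∈ S.cells) (hne : c ≠ c') : Disjoint (interior (simplex c)) (simplex c') := by
  have key : Disjoint (interior (simplex c)) (interior (simplex c')) := by
    obtain ⟨T, hT, h1, h2⟩ := exists_parent hS hc
    obtain ⟨T', hT', h1', h2'⟩ := exists_parent hS hc'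
    by_cases hTT : T = T'
    · subst hTT
      have hf : c ∈ S.fine.elems ∧ c' ∈ S.fine.elems := by
        rcases h2 with h | h <;> rcases h2' with h' | h'
        · exact ⟨h.1, h'.1⟩
        · exact absurd h.2 (mem_unrefined.1 h'.2).2
        · exact absurd h'.2 (mem_unrefined.1 h.2).2
        · exact absurd (h.1.trans h'.1.symm) hne
      exact (S.fine.interior_disjoint hf.1 hf.2 hne).mono_right interior_subset
    · exact (S.coarse.interior_disjoint (cut_mem_coarse hT) (cut_mem_coarse hT') hTT).mono
        (interior_mono h1) (interior_subset.trans h1')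
  rw [← (isSimplex_cell hc').closure_interior]
  exact key.closure_right isOpen_interior

lemma cell_interior_subset_region (hS : S.IsSetup) {A : Finset (Finset (E d))} {T c : Finset (E d)}
    (hT : T ∈ A) (hc : c ∈ S.sub T) : interior (simplex c) ⊆ S.region A := fun _ hp =>
  interior_inter_subset_region hS hT
    ⟨interior_mono (mem_sub.1 hc).2 hp, cell_interior_subset hS (mem_sub.1 hc).1 hp⟩

/-! ### Piecewise affine functions -/

/-- `v` is continuous in `Ω` and affine on every cell. -/
def IsPW (S : Setting d) (v : E d → ℝ) : Prop :=
  ContinuousOn v S.Ω ∧ ∀ c ∈ S.cells, IsP1On v (simplex c ∩ S.Ω)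

/-- The affine function that agrees with `v` in the interior of `c`. -/
def _root_.LOD.piece (c : Finset (E d)) (v : E d → ℝ) : E d →ᵃ[ℝ] ℝ :=
  if h : ∃ g : E d →ᵃ[ℝ] ℝ, Set.EqOn v g (interior (simplex c)) then Classical.choose h else 0

lemma _root_.LOD.IsSimplex.piece_eq {c : Finset (E d)} (hc : IsSimplex c) {v : E d → ℝ}
    {g : E d →ᵃ[ℝ] ℝ} (h : Set.EqOn v g (interior (simplex c))) : piece c v = g := by
  have hex : ∃ g : E d →ᵃ[ℝ] ℝ, Set.EqOn v g (interior (simplex c)) := ⟨g, h⟩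
  rw [piece, dif_pos hex]
  refine affine_ext_of_isOpen isOpen_interior hc.interior_nonempty fun p hp => ?_
  rw [← Classical.choose_spec hex hp, h hp]

lemma piece_eq (hS : S.IsSetup) {c : Finset (E d)} (hc : c ∈ S.cells) {v : E d → ℝ}
    {g : E d →ᵃ[ℝ] ℝ} (h : Set.EqOn v g (simplex c ∩ S.Ω)) : piece c v = g :=
  (isSimplex_cell hc).piece_eq
    (h.mono (Set.subset_inter interior_subset (cell_interior_subset hS hc)))

lemma IsPW.eqOn {v : E d → ℝ} (hv : S.IsPW v) (hS : S.IsSetup) {c : Finset (E d)}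
    (hc : c ∈ S.cells) : Set.EqOn v (piece c v) (simplex c ∩ S.Ω) := by
  obtain ⟨g, hg⟩ := hv.2 c hc
  rw [piece_eq hS hc hg]; exact hg

lemma IsPW.eqOn_interior {v : E d → ℝ} (hv : S.IsPW v) (hS : S.IsSetup) {c : Finset (E d)}
    (hc : c ∈ S.cells) : Set.EqOn v (piece c v) (interior (simplex c)) :=
  (hv.eqOn hS hc).mono (Set.subset_inter interior_subset (cell_interior_subset hS hc))

lemma IsPW.add {u v : E d → ℝ} (hu : S.IsPW u) (hv : S.IsPW v) : S.IsPW (u + v) := by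
  refine ⟨hu.1.add hv.1, fun c hc => ?_⟩
  obtain ⟨f, hf⟩ := hu.2 c hc
  obtain ⟨g, hg⟩ := hv.2 c hc
  exact ⟨f + g, fun p hp => by simp [hf hp, hg hp]⟩

lemma IsPW.smul {v : E d → ℝ} (hv : S.IsPW v) (a : ℝ) : S.IsPW (a • v) := by
  refine ⟨hv.1.const_smul a, fun c hc => ?_⟩
  obtain ⟨g, hg⟩ := hv.2 c hc
  exact ⟨a • g, fun p hp => by simp [hg hp]⟩

/-- The space of piecewise affine functions. -/
def pw (S : Setting d) : Submodule ℝ (E d → ℝ) where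
  carrier := {v | S.IsPW v}
  add_mem' := IsPW.add
  zero_mem' := ⟨continuousOn_const, fun _ _ => ⟨0, fun _ _ => rfl⟩⟩
  smul_mem' a _ hv := IsPW.smul hv a

lemma mem_pw {v : E d → ℝ} : v ∈ S.pw ↔ S.IsPW v := Iff.rfl

lemma IsPW.sub {u v : E d → ℝ} (hu : S.IsPW u) (hv : S.IsPW v) : S.IsPW (u - v) :=
  S.pw.sub_mem hu hv

lemma piece_add (hS : S.IsSetup) {c : Finset (E d)} (hc : c ∈ S.cells) {u v : E d → ℝ}
    (hu : S.IsPW u) (hv : S.IsPW v) : piece c (u + v) = piece c u + piece c v :=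
  piece_eq hS hc fun p hp => by simp [hu.eqOn hS hc hp, hv.eqOn hS hc hp]

lemma piece_smul (hS : S.IsSetup) {c : Finset (E d)} (hc : c ∈ S.cells) {v : E d → ℝ}
    (hv : S.IsPW v) (a : ℝ) : piece c (a • v) = a • piece c v :=
  piece_eq hS hc fun p hp => by simp [hv.eqOn hS hc hp]

lemma piece_sub (hS : S.IsSetup) {c : Finset (E d)} (hc : c ∈ S.cells) {u v : E d → ℝ}
    (hu : S.IsPW u) (hv : S.IsPW v) : piece c (u - v) = piece c u - piece c v :=
  piece_eq hS hc fun p hp => by simp [hu.eqOn hS hc hp, hv.eqOn hS hc hp]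

lemma piece_sum (hS : S.IsSetup) {c : Finset (E d)} (hc : c ∈ S.cells) {ι : Type*}
    (s : Finset ι) {v : ι → E d → ℝ} (hv : ∀ i ∈ s, S.IsPW (v i)) :
    piece c (∑ i ∈ s, v i) = ∑ i ∈ s, piece c (v i) :=
  piece_eq hS hc fun p hp => by
    rw [affineMap_sum_apply, Finset.sum_apply]
    exact Finset.sum_congr rfl fun i hi => (hv i hi).eqOn hS hc hp

/-! ### Coarse functions -/

lemma φ_eq {T : Finset (E d)} (hT : T ∈ S.coarse.elems) {p : E d} (hp : p ∈ simplex T)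
    (x : E d) : S.φ x p = bary T x p := S.coarse.hat_eq hT hp x

/-- The coarse function with nodal values `f` at the points of `N`. -/
def nodal (S : Setting d) (N : Finset (E d)) (f : E d → ℝ) : E d → ℝ := ∑ y ∈ N, f y • S.φ y

lemma nodal_eqOn {T : Finset (E d)} (hT : T ∈ S.coarse.elems) (N : Finset (E d)) (f : E d → ℝ) :
    Set.EqOn (S.nodal N f) (affInterp T fun y => if y ∈ N then f y else 0) (simplex T) := by
  intro p hp
  rw [affInterp_apply, nodal, Finset.sum_apply]
  simp only [Pi.smul_apply, smul_eq_mul, φ_eq hT hp, ite_mul, zero_mul]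
  rw [← Finset.sum_filter, ← Finset.sum_filter_add_sum_filter_not N (· ∈ T)]
  have h2 : ∑ y ∈ N with y ∉ T, f y * bary T y p = 0 :=
    Finset.sum_eq_zero fun y hy => by simp [bary_of_notMem (Finset.mem_filter.1 hy).2]
  rw [h2, add_zero]
  refine Finset.sum_congr ?_ fun _ _ => rfl
  ext y; simp [and_comm]

lemma exists_affine_of_mem_coarseSpace {v : E d → ℝ} (hv : v ∈ S.coarseSpace) {T : Finset (E d)}
    (hT : T ∈ S.coarse.elems) : ∃ g : E d →ᵃ[ℝ] ℝ, Set.EqOn v g (simplex T) := by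
  induction hv using Submodule.span_induction with
  | mem v hv =>
    obtain ⟨x, -, rfl⟩ := hv
    exact ⟨bary T x, fun p hp => φ_eq hT hp x⟩
  | zero => exact ⟨0, fun _ _ => rfl⟩
  | add u v _ _ hu hv =>
    obtain ⟨f, hf⟩ := hu
    obtain ⟨g, hg⟩ := hv
    exact ⟨f + g, fun p hp => by simp [hf hp, hg hp]⟩
  | smul a v _ hv =>
    obtain ⟨g, hg⟩ := hv
    exact ⟨a • g, fun p hp => by simp [hg hp]⟩

lemma nodal_mem_coarseSpace {N : Finset (E d)} (hN : N ⊆ S.nodes) (f : E d → ℝ) :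
    S.nodal N f ∈ S.coarseSpace :=
  Submodule.sum_mem _ fun y hy =>
    Submodule.smul_mem _ _ (Submodule.subset_span ⟨y, hN hy, rfl⟩)

lemma φ_mem_coarseSpace {x : E d} (hx : x ∈ S.nodes) : S.φ x ∈ S.coarseSpace :=
  Submodule.subset_span ⟨x, hx, rfl⟩

lemma subset_iUnion_cut (hS : S.IsSetup) : S.Ω ⊆ ⋃ T ∈ S.cutMesh, simplex T := by
  intro p hp
  obtain ⟨T, hT, hpT⟩ := Set.mem_iUnion₂.1 (hS.subset_space hp)
  exact Set.mem_biUnion (Finset.mem_filter.2 ⟨hT, p, hpT, hp⟩) hpT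

lemma isPW_of_mem_coarseSpace (hS : S.IsSetup) {v : E d → ℝ} (hv : v ∈ S.coarseSpace) :
    S.IsPW v := by
  refine ⟨continuousOn_of_simplex_cover (subset_iUnion_cut hS) fun T hT => ?_, fun c hc => ?_⟩
  · obtain ⟨g, hg⟩ := exists_affine_of_mem_coarseSpace hv (cut_mem_coarse hT)
    exact (continuous_affine g).continuousOn.congr (hg.mono Set.inter_subset_left)
  · obtain ⟨T, hT, hcT, -⟩ := exists_parent hS hc
    obtain ⟨g, hg⟩ := exists_affine_of_mem_coarseSpace hv (cut_mem_coarse hT)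
    exact ⟨g, hg.mono (Set.inter_subset_left.trans hcT)⟩

lemma piece_nodal (hS : S.IsSetup) {c T : Finset (E d)} (hT : T ∈ S.cutMesh) (hc : c ∈ S.sub T)
    (N : Finset (E d)) (f : E d → ℝ) :
    piece c (S.nodal N f) = affInterp T fun y => if y ∈ N then f y else 0 :=
  piece_eq hS (mem_sub.1 hc).1 ((nodal_eqOn (cut_mem_coarse hT) N f).mono
    (Set.inter_subset_left.trans (mem_sub.1 hc).2))

lemma piece_φ (hS : S.IsSetup) {c T : Finset (E d)} (hT : T ∈ S.cutMesh) (hc : c ∈ S.sub T)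
    (x : E d) : piece c (S.φ x) = bary T x :=
  piece_eq hS (mem_sub.1 hc).1 fun _ hp => φ_eq (cut_mem_coarse hT) ((mem_sub.1 hc).2 hp.1) x

/-- The nodes of the elements outside the enriched region. -/
def unrefinedNodes (S : Setting d) : Finset (E d) := S.unrefined.biUnion id

lemma unrefinedNodes_subset : S.unrefinedNodes ⊆ S.nodes := by
  intro y hy
  obtain ⟨T, hT, hyT⟩ := Finset.mem_biUnion.1 hy
  exact Finset.mem_biUnion.2 ⟨T, (mem_unrefined.1 hT).1, hyT⟩

lemma IsPW.eqOn_unrefined {v : E d → ℝ} (hv : S.IsPW v) (hS : S.IsSetup) {T : Finset (E d)}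
    (hT : T ∈ S.unrefined) : Set.EqOn v (S.nodal S.unrefinedNodes v) (simplex T) := by
  intro p hp
  have hTs := isSimplex_cell (unrefined_mem_cells hT)
  have hv' : Set.EqOn v (piece T v) (simplex T) :=
    (hv.eqOn hS (unrefined_mem_cells hT)).mono
      (Set.subset_inter subset_rfl (unrefined_subset hT))
  rw [nodal_eqOn (cut_mem_coarse (mem_unrefined.1 hT).1) _ _ hp, hv' hp]
  congr 1
  refine hTs.affine_ext fun y hy => ?_
  rw [hTs.affInterp_vertex _ hy, if_pos (show y ∈ S.unrefinedNodes from Finset.mem_biUnion.2 ⟨T, hT, hy⟩),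
    hv' (vertex_mem_simplex hy)]

/-- Replaces the sum of the two spaces by a condition on single cells. -/
lemma isReference_iff (hS : S.IsSetup) {v : E d → ℝ} : S.IsReference v ↔ S.IsPW v := by
  constructor
  · rintro ⟨hc, vH, hvH, vh, ⟨-, hvh⟩, hsum⟩
    refine ⟨hc, fun c hcell => ?_⟩
    obtain ⟨T, hT, hcT, h⟩ := exists_parent hS hcell
    obtain ⟨g, hg⟩ := exists_affine_of_mem_coarseSpace hvH (cut_mem_coarse hT)
    rcases h with ⟨hf, hTk⟩ | ⟨rfl, hne⟩
    · obtain ⟨f, hf'⟩ := hvh c hf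
      refine ⟨g + f, eqOn_of_eqOn_interior hc (isSimplex_cell hcell)
        (cell_interior_subset hS hcell) fun p hp => ?_⟩
      have hpe : p ∈ S.enriched :=
        cell_interior_subset_region hS hTk (mem_sub.2 ⟨hcell, hcT⟩) hp
      rw [hsum p (cell_interior_subset hS hcell hp), Set.indicator_of_mem hpe,
        hg (hcT (interior_subset hp)), hf' ⟨interior_subset hp, hpe⟩]
      simp
    · refine ⟨g, eqOn_of_eqOn_interior hc (isSimplex_cell hcell)
        (cell_interior_subset hS hcell) fun p hp => ?_⟩
      have hpe : p ∉ S.enriched := by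
        intro h
        obtain ⟨T', hT', hpT'⟩ := Set.mem_iUnion₂.1 (interior_subset h).1
        have : c ≠ T' := by rintro rfl; exact (mem_unrefined.1 hne).2 hT'
        exact Set.disjoint_left.1 (S.coarse.interior_disjoint (cut_mem_coarse hT)
          (cut_mem_coarse (boundaryLayer_subset _ hT')) this) hp hpT'
      rw [hsum p (cell_interior_subset hS hcell hp), Set.indicator_of_notMem hpe, add_zero,
        hg (interior_subset hp)]
  · intro hv
    -- This coarse function agrees with `v` on all unrefined elements, so the remainder is zero
    -- outside the enriched region and qualifies as a fine function extended by zero.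
    set vH := S.nodal S.unrefinedNodes v
    have hvH : vH ∈ S.coarseSpace := nodal_mem_coarseSpace unrefinedNodes_subset v
    have hvH' := hv.sub (isPW_of_mem_coarseSpace hS hvH)
    refine ⟨hv.1, vH, hvH, v - vH, ⟨hvH'.1.mono (region_subset _), fun t ht => ?_⟩, fun p hp => ?_⟩
    · obtain ⟨g, hg⟩ := hvH'.2 t (fine_mem_cells ht)
      exact ⟨g, hg.mono (Set.inter_subset_inter_right _ (region_subset _))⟩
    · by_cases hpe : p ∈ S.enriched
      · rw [Set.indicator_of_mem hpe]; simp
      · rw [Set.indicator_of_notMem hpe, add_zero]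
        obtain ⟨T, hT, hTk, hpT⟩ := exists_elem_of_notMem_region hS hp hpe
        exact hv.eqOn_unrefined hS (mem_unrefined.2 ⟨hT, hTk⟩) hpT

/-- If a convex combination in an element of vertices of a cell lies in another element, then so do
the vertices that carry weight. -/
lemma vertex_mem_of_bary_pos {K : Mesh d} {T T' t : Finset (E d)} (hT : T ∈ K.elems)
    (hT' : T' ∈ K.elems) (ht : IsSimplex t) (htT : simplex t ⊆ simplex T) {p : E d}
    (hpt : p ∈ simplex t) (hpT' : p ∈ simplex T') {y : E d} (hy : y ∈ t)
    (hpos : bary t y p ≠ 0) : y ∈ simplex T' := by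
  have hyT := htT (vertex_mem_simplex hy)
  have key : ∀ x ∈ T, x ∉ T' → bary T x y = 0 := by
    intro x hx hx'
    have h0 := K.bary_eq_zero hT hT' (htT hpt) hpT' hx hx'
    rw [ht.affine_eq (bary T x) p] at h0
    have h1 := (Finset.sum_eq_zero_iff_of_nonneg fun z hz =>
      mul_nonneg (bary_nonneg hpt z) (bary_nonneg (htT (vertex_mem_simplex hz)) x)).1 h0 y hy
    exact (mul_eq_zero.1 h1).resolve_left hpos
  rw [← (K.isSimplex hT).sum_bary_smul y]
  have hsum := (K.isSimplex hT).sum_bary y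
  have e1 : ∑ x ∈ T with x ∈ T', bary T x y = 1 := by
    rw [← hsum]
    refine Finset.sum_filter_of_ne fun x hx hne => ?_
    by_contra h; exact hne (key x hx h)
  have e2 : ∑ x ∈ T with x ∈ T', bary T x y • x = ∑ x ∈ T, bary T x y • x := by
    refine Finset.sum_filter_of_ne fun x hx hne => ?_
    by_contra h; exact hne (by rw [key x hx h, zero_smul])
  rw [← e2]
  exact (convex_simplex T').sum_mem (fun x _ => bary_nonneg hyT x) e1
    fun x hx => vertex_mem_simplex (Finset.mem_filter.1 hx).2

/-- Nodal values on the fine elements that match at common points in `Ω` and vanish towards the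
elements outside the enriched region define a piecewise affine function. -/
lemma exists_glue (hS : S.IsSetup) (a : Finset (E d) → E d → ℝ)
    (h1 : ∀ c ∈ S.fine.elems, ∀ c' ∈ S.fine.elems, ∀ p ∈ S.Ω, p ∈ simplex c → p ∈ simplex c' →
      ∀ y ∈ c, y ∈ c' → a c y = a c' y)
    (h2 : ∀ c ∈ S.fine.elems, ∀ T ∈ S.unrefined, ∀ p ∈ S.Ω, p ∈ simplex c → p ∈ simplex T →
      ∀ y ∈ c, y ∈ simplex T → a c y = 0)
    (h3 : ∀ T ∈ S.unrefined, ∀ y ∈ T, a T y = 0) :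
    ∃ v, S.IsPW v ∧ ∀ c ∈ S.cells, piece c v = affInterp c (a c) := by
  have h4 : ∀ T ∈ S.unrefined, affInterp T (a T) = 0 := fun T hT =>
    Finset.sum_eq_zero fun y hy => by rw [h3 T hT y hy, zero_smul]
  -- Fine vertices may hang on the faces of `T`. The vertices of `c` with positive weight at a point
  -- of `T` themselves lie in `T`, and there the data are zero.
  have h5 : ∀ c ∈ S.fine.elems, ∀ T ∈ S.unrefined, ∀ p ∈ S.Ω, p ∈ simplex c → p ∈ simplex T →
      affInterp c (a c) p = 0 := by
    intro c hc T hT p hp hpc hpT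
    rw [affInterp_apply]
    refine Finset.sum_eq_zero fun y hy => ?_
    by_cases h0 : bary c y p = 0
    · rw [h0, mul_zero]
    obtain ⟨T', hT', hcT', -⟩ := exists_parent hS (fine_mem_cells hc)
    rw [h2 c hc T hT p hp hpc hpT y hy (vertex_mem_of_bary_pos (cut_mem_coarse hT')
      (cut_mem_coarse (mem_unrefined.1 hT).1) (S.fine.isSimplex hc) hcT' hpc hpT hy h0), zero_mul]
  have h6 : ∀ c ∈ S.cells, ∀ c' ∈ S.cells, ∀ p ∈ S.Ω, p ∈ simplex c → p ∈ simplex c' →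
      affInterp c (a c) p = affInterp c' (a c') p := by
    intro c hc c' hc' p hp hpc hpc'
    rcases Finset.mem_union.1 hc with hc | hc <;> rcases Finset.mem_union.1 hc' with hc' | hc'
    · rw [affInterp_apply, affInterp_apply]
      have e1 : ∀ s t : Finset (E d), s ∈ S.fine.elems → t ∈ S.fine.elems → p ∈ simplex s →
          p ∈ simplex t → ∑ y ∈ s, a s y * bary s y p = ∑ y ∈ s ∩ t, a s y * bary s y p := by
        intro s t hs ht hps hpt
        refine (Finset.sum_subset Finset.inter_subset_left fun y hy hy' => ?_).symm
        rw [S.fine.bary_eq_zero hs ht hps hpt hy fun h => hy' (Finset.mem_inter.2 ⟨hy, h⟩),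
          mul_zero]
      rw [e1 c c' hc hc' hpc hpc', e1 c' c hc' hc hpc' hpc, Finset.inter_comm c' c]
      refine Finset.sum_congr rfl fun y hy => ?_
      obtain ⟨hy1, hy2⟩ := Finset.mem_inter.1 hy
      rw [h1 c hc c' hc' p hp hpc hpc' y hy1 hy2, S.fine.bary_eq_bary hc hc' hpc hpc']
    · rw [h5 c hc c' hc' p hp hpc hpc', h4 c' hc']; rfl
    · rw [h5 c' hc' c hc p hp hpc' hpc, h4 c hc]; rfl
    · rw [h4 c hc, h4 c' hc']
  let v : E d → ℝ := fun p =>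
    if h : ∃ c ∈ S.cells, p ∈ simplex c then affInterp h.choose (a h.choose) p else 0
  have hv : ∀ c ∈ S.cells, Set.EqOn v (affInterp c (a c)) (simplex c ∩ S.Ω) := by
    rintro c hc p ⟨hpc, hp⟩
    have h : ∃ c ∈ S.cells, p ∈ simplex c := ⟨c, hc, hpc⟩
    simp only [v, dif_pos h]
    exact h6 _ h.choose_spec.1 c hc p hp h.choose_spec.2 hpc
  refine ⟨v, ⟨continuousOn_of_simplex_cover (subset_iUnion_cells hS) fun c hc => ?_,
    fun c hc => ⟨_, hv c hc⟩⟩, fun c hc => piece_eq hS hc (hv c hc)⟩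
  exact (continuous_affine _).continuousOn.congr (hv c hc)

/-- Near a common point in `Ω` two pieces of a piecewise affine function agree on the segments to
common points. -/
lemma IsPW.piece_eq_piece {v : E d → ℝ} (hv : S.IsPW v) (hS : S.IsSetup) {c c' : Finset (E d)}
    (hc : c ∈ S.cells) (hc' : c' ∈ S.cells) {p : E d} (hp : p ∈ S.Ω) (hpc : p ∈ simplex c)
    (hpc' : p ∈ simplex c') {y : E d} (hy : y ∈ simplex c) (hy' : y ∈ simplex c') :
    piece c v y = piece c' v y := by
  -- The vertex `y` may lie on `∂Ω`, where `v` can have two traces. The two affine pieces are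
  -- therefore compared at `p` and at a point of the segment towards `y` that is still in `Ω`; these
  -- two values determine the value at `y`.
  have hcont : Continuous fun s : ℝ => AffineMap.lineMap p y s :=
    AffineMap.lineMap_continuous
  have hev : ∀ᶠ s : ℝ in 𝓝 0, (AffineMap.lineMap p y s : E d) ∈ S.Ω := by
    refine hcont.continuousAt.eventually (hS.isOpen.mem_nhds ?_)
    simpa using hp
  obtain ⟨ε, hε, hball⟩ := Metric.eventually_nhds_iff.1 hev
  set s := min (ε / 2) 1
  have hs0 : 0 < s := by positivity
  have hs1 : s ≤ 1 := min_le_right _ _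
  have hsΩ : (AffineMap.lineMap p y s : E d) ∈ S.Ω := by
    apply hball
    rw [Real.dist_eq, sub_zero, abs_of_pos hs0]
    linarith [min_le_left (ε / 2) 1]
  have e1 := hv.eqOn hS hc ⟨(convex_simplex c).lineMap_mem hpc hy ⟨hs0.le, hs1⟩, hsΩ⟩
  have e2 := hv.eqOn hS hc' ⟨(convex_simplex c').lineMap_mem hpc' hy' ⟨hs0.le, hs1⟩, hsΩ⟩
  have e3 := hv.eqOn hS hc ⟨hpc, hp⟩
  have e4 := hv.eqOn hS hc' ⟨hpc', hp⟩
  rw [AffineMap.apply_lineMap, AffineMap.lineMap_apply_ring] at e1 e2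
  have e5 : s * piece c v y = s * piece c' v y := by
    rw [← e3] at e1; rw [← e4] at e2; linarith
  exact mul_left_cancel₀ hs0.ne' e5

end Setting

/-! ### Null frontiers and integrability on simplices. -/

lemma interior_ae_eq (s : Finset (E d)) :
    (interior (simplex s) : Set (E d)) =ᵐ[volume] simplex s :=
  interior_ae_eq_of_null_frontier ((convex_simplex s).addHaar_frontier volume)

lemma setIntegral_interior (s : Finset (E d)) (f : E d → ℝ) :
    ∫ p in interior (simplex s), f p = ∫ p in simplex s, f p :=
  setIntegral_congr_set (interior_ae_eq s)

lemma IsSimplex.face_nonempty {s : Finset (E d)} (hs : IsSimplex s) (hd : 1 ≤ d) {x : E d}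
    (hx : x ∈ s) : (s.erase x).Nonempty := by
  rw [← Finset.card_pos, Finset.card_erase_of_mem hx, hs.1]; omega

lemma integrableOn_simplex {μ : Measure (E d)} {s : Finset (E d)} (hfin : μ (simplex s) ≠ ⊤)
    {f : E d → ℝ} (hf : ContinuousOn f (simplex s)) : IntegrableOn f (simplex s) μ := by
  obtain ⟨C, hC⟩ := (isCompact_simplex s).exists_bound_of_continuousOn hf
  exact IntegrableOn.of_bound hfin.lt_top
    (hf.aestronglyMeasurable (measurableSet_simplex s)) C
    ((ae_restrict_iff' (measurableSet_simplex s)).2 (ae_of_all _ hC))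

namespace Setting

variable {S : Setting d}

/-! ### Integrals over patches -/

/-- The two sets differ only on the frontiers of finitely many convex cells, which are null. -/
lemma region_ae_eq (hS : S.IsSetup) {A : Finset (Finset (E d))} (hA : A ⊆ S.cutMesh) :
    (S.region A : Set (E d)) =ᵐ[volume] ⋃ c ∈ A.biUnion S.sub, interior (simplex c) := by
  have h1 : (⋃ c ∈ A.biUnion S.sub, interior (simplex c)) ⊆ S.region A := by
    refine Set.iUnion₂_subset fun c hc => ?_
    obtain ⟨T, hT, hcT⟩ := Finset.mem_biUnion.1 hc
    exact cell_interior_subset_region hS hT hcT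
  have h2 : S.region A \ (⋃ c ∈ A.biUnion S.sub, interior (simplex c)) ⊆
      ⋃ c ∈ S.cells, frontier (simplex c) := by
    rintro p ⟨hp, hpn⟩
    obtain ⟨c, hc, hpc⟩ := exists_cell hS (region_subset A hp)
    refine Set.mem_biUnion hc ?_
    rw [(isClosed_simplex c).frontier_eq]
    refine ⟨hpc, fun hpi => hpn ?_⟩
    obtain ⟨T', hT', hcT', -⟩ := exists_parent hS hc
    obtain ⟨T, hT, hpT⟩ := Set.mem_iUnion₂.1 (interior_subset hp).1
    have : T' = T := by
      by_contra hne
      exact Set.disjoint_left.1 (S.coarse.interior_disjoint (cut_mem_coarse hT')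
        (cut_mem_coarse (hA hT)) hne) (interior_mono hcT' hpi) hpT
    subst this
    exact Set.mem_biUnion (Finset.mem_biUnion.2 ⟨T', hT, mem_sub.2 ⟨hc, hcT'⟩⟩) hpi
  have h3 : volume (S.region A \ (⋃ c ∈ A.biUnion S.sub, interior (simplex c))) = 0 := by
    refine measure_mono_null h2 ((measure_biUnion_null_iff S.cells.countable_toSet).2 ?_)
    exact fun c _ => (convex_simplex c).addHaar_frontier volume
  exact (ae_le_set.2 h3).antisymm (LE.le.eventuallyLE h1)

lemma sub_pairwiseDisjoint {A : Finset (Finset (E d))} (hA : A ⊆ S.cutMesh) :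
    Set.PairwiseDisjoint (A : Set (Finset (E d))) S.sub := by
  intro T hT T' hT' hne
  rw [Function.onFun, Finset.disjoint_left]
  intro c hc hc'
  exact hne (parent_unique (mem_sub.1 hc).1 (cut_mem_coarse (hA hT)) (cut_mem_coarse (hA hT'))
    (mem_sub.1 hc).2 (mem_sub.1 hc').2)

lemma integrableOn_region (hS : S.IsSetup) {A : Finset (Finset (E d))} (hA : A ⊆ S.cutMesh)
    {F : Type*} [NormedAddCommGroup F]
    {f : E d → F} (hf : ∀ T ∈ A, ∀ c ∈ S.sub T, IntegrableOn f (interior (simplex c))) :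
    IntegrableOn f (S.region A) := by
  rw [integrableOn_congr_set_ae (region_ae_eq hS hA), integrableOn_finset_iUnion]
  intro c hc
  obtain ⟨T, hT, hcT⟩ := Finset.mem_biUnion.1 hc
  exact hf T hT c hcT

lemma setIntegral_region (hS : S.IsSetup) {A : Finset (Finset (E d))} (hA : A ⊆ S.cutMesh)
    {f : E d → ℝ} (hf : ∀ T ∈ A, ∀ c ∈ S.sub T, IntegrableOn f (interior (simplex c))) :
    ∫ p in S.region A, f p = ∑ T ∈ A, ∑ c ∈ S.sub T, ∫ p in interior (simplex c), f p := by
  rw [setIntegral_congr_set (region_ae_eq hS hA), integral_biUnion_finset,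
    Finset.sum_biUnion (sub_pairwiseDisjoint hA)]
  · exact fun c _ => isOpen_interior.measurableSet
  · intro c hc c' hc' hne
    obtain ⟨T, -, hcT⟩ := Finset.mem_biUnion.1 hc
    obtain ⟨T', -, hcT'⟩ := Finset.mem_biUnion.1 hc'
    exact (cell_interior_disjoint hS (mem_sub.1 hcT).1 (mem_sub.1 hcT').1 hne).mono_right
      interior_subset
  · intro c hc
    obtain ⟨T, hT, hcT⟩ := Finset.mem_biUnion.1 hc
    exact hf T hT c hcT

/-- Integrals over patches of functions given cell by cell. -/
lemma setIntegral_region_of_eqOn (hS : S.IsSetup) {A : Finset (Finset (E d))}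
    (hA : A ⊆ S.cutMesh) {f : E d → ℝ} {F : Finset (E d) → E d → ℝ}
    (hF : ∀ c, ContinuousOn (F c) (simplex c))
    (hf : ∀ T ∈ A, ∀ c ∈ S.sub T, Set.EqOn f (F c) (interior (simplex c))) :
    IntegrableOn f (S.region A) ∧
    ∫ p in S.region A, f p = ∑ T ∈ A, ∑ c ∈ S.sub T, ∫ p in simplex c, F c p := by
  have h1 : ∀ T ∈ A, ∀ c ∈ S.sub T, IntegrableOn f (interior (simplex c)) := fun T hT c hc =>
    ((integrableOn_simplex (volume_simplex_ne_top c) (hF c)).mono_set interior_subset).congr_fun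
      (hf T hT c hc).symm isOpen_interior.measurableSet
  refine ⟨integrableOn_region hS hA h1, ?_⟩
  rw [setIntegral_region hS hA h1]
  refine Finset.sum_congr rfl fun T hT => Finset.sum_congr rfl fun c hc => ?_
  rw [setIntegral_congr_fun isOpen_interior.measurableSet (hf T hT c hc), setIntegral_interior]

lemma region_cutMesh (hS : S.IsSetup) : S.region S.cutMesh = S.Ω := by
  rw [region, Set.inter_eq_right.2 (subset_iUnion_cut hS), hS.isOpen.interior_eq]

/-! ### The energy in terms of cells -/

/-- The affine piece is continuous up to the boundary of `t`, so the limit from inside that defines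
the trace exists and is its value. From here on boundary values are values of pieces. -/
lemma trace_eq (hS : S.IsSetup) {t : Finset (E d)} (ht : t ∈ S.fine.elems) {v : E d → ℝ}
    (hv : S.IsPW v) {p : E d} (hp : p ∈ simplex t) : trace t v p = piece t v p := by
  have hts := S.fine.isSimplex ht
  refine extendFrom_eq (by rwa [hts.closure_interior]) ?_
  have := ((continuous_affine (piece t v)).tendsto p).mono_left
    (nhdsWithin_le_nhds (s := interior (simplex t)))
  exact this.congr' ((hv.eqOn_interior hS (fine_mem_cells ht)).eventuallyEq_nhdsWithin).symm

lemma boundary_disjoint (hS : S.IsSetup) : Disjoint S.Ω (frontier S.Ω) := by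
  rw [frontier, hS.isOpen.interior_eq]; exact disjoint_sdiff_self_right

lemma robin_subset (hS : S.IsSetup) : S.ΓR ⊆ frontier S.Ω := by
  rw [← hS.boundary_eq]; exact Set.subset_union_right

lemma dirichlet_subset (hS : S.IsSetup) : S.ΓD ⊆ frontier S.Ω := by
  rw [← hS.boundary_eq]; exact Set.subset_union_left

/-- An element that contains a boundary side lies in the layer around the boundary. -/
lemma mem_boundaryLayer_of_face (hS : S.IsSetup) (hd : 1 ≤ d) {c T : Finset (E d)}
    (hT : T ∈ S.cutMesh) (hc : c ∈ S.sub T) {x : E d} (hx : x ∈ c)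
    (hface : simplex (c.erase x) ⊆ frontier S.Ω) : T ∈ S.boundaryLayer 0 := by
  obtain ⟨hcc, hcT⟩ := mem_sub.1 hc
  obtain ⟨y, hy⟩ := (isSimplex_cell hcc).face_nonempty hd hx
  refine mem_boundaryLayer_zero hT fun hTΩ => ?_
  exact Set.disjoint_left.1 (boundary_disjoint hS) (hTΩ (hcT (face_subset c x
    (vertex_mem_simplex hy)))) (hface (vertex_mem_simplex hy))

/-- The vertices of `c` opposite to the sides on the Robin boundary. -/
def robinVerts (S : Setting d) (c : Finset (E d)) : Finset (E d) :=
  c.filter fun x => simplex (c.erase x) ⊆ S.ΓR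

lemma robinVerts_eq_empty (hS : S.IsSetup) (hd : 1 ≤ d) {c T : Finset (E d)}
    (hT : T ∈ S.cutMesh) (hc : c ∈ S.sub T) (hTb : T ∉ S.boundaryLayer 0) :
    S.robinVerts c = ∅ := by
  rw [robinVerts, Finset.filter_eq_empty_iff]
  exact fun x hx h => hTb (mem_boundaryLayer_of_face hS hd hT hc hx (h.trans (robin_subset hS)))

/-- The contribution of the cell `c` to the bilinear form. -/
def form (S : Setting d) (c : Finset (E d)) (f g : E d →ᵃ[ℝ] ℝ) : ℝ :=
  volume.real (simplex c) * inner ℝ (grad f) (grad g) +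
    ∑ x ∈ S.robinVerts c, ∫ y in simplex (c.erase x), S.κ * f y * g y ∂(μHE[d - 1])

lemma form_comm (c : Finset (E d)) (f g : E d →ᵃ[ℝ] ℝ) : S.form c f g = S.form c g f := by
  simp only [form, real_inner_comm (grad f)]
  congr 1
  refine Finset.sum_congr rfl fun x _ => ?_
  congr 1
  ext y; ring

lemma robin_integrableOn (hd : 1 ≤ d) {c : Finset (E d)} (hc : IsSimplex c) {x : E d}
    (hx : x ∈ S.robinVerts c) (f g : E d →ᵃ[ℝ] ℝ) :
    IntegrableOn (fun y => S.κ * f y * g y) (simplex (c.erase x)) (μHE[d - 1]) := by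
  refine integrableOn_simplex (face_measure_ne_top hc hd (Finset.mem_filter.1 hx).1) ?_
  exact ((continuous_const.mul (continuous_affine f)).mul (continuous_affine g)).continuousOn

lemma form_add_left (hd : 1 ≤ d) {c : Finset (E d)} (hc : IsSimplex c) (f f' g : E d →ᵃ[ℝ] ℝ) :
    S.form c (f + f') g = S.form c f g + S.form c f' g := by
  have : ∀ x ∈ S.robinVerts c,
      ∫ y in simplex (c.erase x), S.κ * (f + f') y * g y ∂(μHE[d - 1]) =
      ∫ y in simplex (c.erase x), S.κ * f y * g y ∂(μHE[d - 1]) +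
      ∫ y in simplex (c.erase x), S.κ * f' y * g y ∂(μHE[d - 1]) := by
    intro x hx
    rw [← integral_add (robin_integrableOn hd hc hx f g) (robin_integrableOn hd hc hx f' g)]
    congr 1
    ext y
    simp only [AffineMap.coe_add, Pi.add_apply]; ring
  simp only [form, map_add, inner_add_left, Finset.sum_congr rfl this, Finset.sum_add_distrib]
  ring

lemma form_smul_left (c : Finset (E d)) (a : ℝ) (f g : E d →ᵃ[ℝ] ℝ) :
    S.form c (a • f) g = a * S.form c f g := by
  have : ∀ x ∈ S.robinVerts c,
      ∫ y in simplex (c.erase x), S.κ * (a • f) y * g y ∂(μHE[d - 1]) =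
      a * ∫ y in simplex (c.erase x), S.κ * f y * g y ∂(μHE[d - 1]) := by
    intro x _
    rw [← integral_const_mul]
    congr 1
    ext y
    simp only [AffineMap.coe_smul, Pi.smul_apply, smul_eq_mul]; ring
  simp only [form, map_smul, real_inner_smul_left, Finset.sum_congr rfl this, ← Finset.mul_sum]
  ring

lemma robin_integral_nonneg (hS : S.IsSetup) (c : Finset (E d)) (g : E d →ᵃ[ℝ] ℝ) :
    0 ≤ ∑ x ∈ S.robinVerts c, ∫ y in simplex (c.erase x), S.κ * g y * g y ∂(μHE[d - 1]) := by
  refine Finset.sum_nonneg fun x _ => integral_nonneg fun y => ?_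
  change 0 ≤ S.κ * g y * g y
  rw [mul_assoc]
  exact mul_nonneg hS.κ_nonneg (mul_self_nonneg _)

lemma form_nonneg (hS : S.IsSetup) (c : Finset (E d)) (g : E d →ᵃ[ℝ] ℝ) : 0 ≤ S.form c g g :=
  add_nonneg (mul_nonneg measureReal_nonneg real_inner_self_nonneg) (robin_integral_nonneg hS c g)

/-- The contribution of the coarse element `T` to the bilinear form. -/
def energyForm (hS : S.IsSetup) (hd : 1 ≤ d) (T : Finset (E d)) : LinearMap.BilinForm ℝ S.pw :=
  LinearMap.mk₂ ℝ (fun u v => ∑ c ∈ S.sub T, S.form c (piece c u.1) (piece c v.1))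
    (fun u u' v => by
      rw [← Finset.sum_add_distrib]
      refine Finset.sum_congr rfl fun c hc => ?_
      have hcc := (mem_sub.1 hc).1
      rw [← form_add_left hd (isSimplex_cell hcc), ← piece_add hS hcc u.2 u'.2]; rfl)
    (fun a u v => by
      rw [smul_eq_mul, Finset.mul_sum]
      refine Finset.sum_congr rfl fun c hc => ?_
      have hcc := (mem_sub.1 hc).1
      rw [← form_smul_left, ← piece_smul hS hcc u.2]; rfl)
    (fun u v v' => by
      rw [← Finset.sum_add_distrib]
      refine Finset.sum_congr rfl fun c hc => ?_
      have hcc := (mem_sub.1 hc).1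
      rw [form_comm, form_comm c (piece c u.1), form_comm c (piece c u.1),
        ← form_add_left hd (isSimplex_cell hcc), ← piece_add hS hcc v.2 v'.2]; rfl)
    (fun a u v => by
      rw [smul_eq_mul, Finset.mul_sum]
      refine Finset.sum_congr rfl fun c hc => ?_
      have hcc := (mem_sub.1 hc).1
      rw [form_comm, form_comm c (piece c u.1), ← form_smul_left, ← piece_smul hS hcc v.2]; rfl)

lemma energyForm_apply (hS : S.IsSetup) (hd : 1 ≤ d) (T : Finset (E d)) (u v : S.pw) :
    energyForm hS hd T u v = ∑ c ∈ S.sub T, S.form c (piece c u.1) (piece c v.1) := rfl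

lemma energyForm_nonneg (hS : S.IsSetup) (hd : 1 ≤ d) (T : Finset (E d)) (u : S.pw) :
    0 ≤ energyForm hS hd T u u :=
  Finset.sum_nonneg fun c _ => form_nonneg hS c _

lemma energyForm_isSymm (hS : S.IsSetup) (hd : 1 ≤ d) (T : Finset (E d)) :
    (energyForm hS hd T).IsSymm :=
  ⟨fun _ _ => Finset.sum_congr rfl fun c _ => form_comm c _ _⟩

/-- Gradients are constant on cells. Unrefined cells lie inside `Ω` and have no Robin sides, so the
surface terms can be summed over all cells. -/
lemma a_eq (hS : S.IsSetup) (hd : 1 ≤ d) {u v : E d → ℝ} (hu : S.IsPW u) (hv : S.IsPW v) :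
    S.a u v = ∑ T ∈ S.cutMesh, energyForm hS hd T ⟨u, hu⟩ ⟨v, hv⟩ := by
  have h1 : ∫ y in S.Ω, inner ℝ (gradient u y) (gradient v y) =
      ∑ T ∈ S.cutMesh, ∑ c ∈ S.sub T,
        volume.real (simplex c) * inner ℝ (grad (piece c u)) (grad (piece c v)) := by
    have := (setIntegral_region_of_eqOn hS (A := S.cutMesh) subset_rfl
      (f := fun y => inner ℝ (gradient u y) (gradient v y))
      (F := fun c _ => inner ℝ (grad (piece c u)) (grad (piece c v)))
      (fun c => continuousOn_const) (fun T hT c hc p hp => by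
        have hcc := (mem_sub.1 hc).1
        simp only [gradient_eq_of_eqOn isOpen_interior (hu.eqOn_interior hS hcc) hp,
          gradient_eq_of_eqOn isOpen_interior (hv.eqOn_interior hS hcc) hp])).2
    rw [region_cutMesh hS] at this
    rw [this]
    simp only [setIntegral_const, smul_eq_mul]
  have h2 : ∑ t ∈ S.fine.elems, ∑ x ∈ t with simplex (t.erase x) ⊆ S.ΓR,
      ∫ y in simplex (t.erase x), S.κ * trace t u y * trace t v y ∂(μHE[d - 1]) =
      ∑ c ∈ S.cells, ∑ x ∈ S.robinVerts c,
        ∫ y in simplex (c.erase x), S.κ * piece c u y * piece c v y ∂(μHE[d - 1]) := by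
    rw [← Finset.sum_subset (s₁ := S.fine.elems) (s₂ := S.cells) Finset.subset_union_left]
    · refine Finset.sum_congr rfl fun t ht => Finset.sum_congr rfl fun x hx => ?_
      refine setIntegral_congr_fun (measurableSet_simplex _) fun p hp => ?_
      have hp' := face_subset _ _ hp
      simp only [trace_eq hS ht hu hp', trace_eq hS ht hv hp']
    · intro c hc hc'
      have hT : c ∈ S.unrefined := (Finset.mem_union.1 hc).resolve_left hc'
      rw [robinVerts_eq_empty hS hd (mem_unrefined.1 hT).1 (mem_sub.2 ⟨hc, subset_rfl⟩)
        fun h => (mem_unrefined.1 hT).2 (boundaryLayer_mono (Nat.zero_le _) h),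
        Finset.sum_empty]
  rw [a, h1, h2, sum_cells hS, ← Finset.sum_add_distrib]
  refine Finset.sum_congr rfl fun T _ => ?_
  rw [energyForm_apply, ← Finset.sum_add_distrib]
  rfl

/-! ### Volumes and packing -/

/-- The volume of the unit ball of `ℝ^d`. -/
def _root_.LOD.unitVol (d : ℕ) : ℝ := volume.real (Metric.ball (0 : E d) 1)

lemma _root_.LOD.unitVol_pos : 0 < unitVol d :=
  ENNReal.toReal_pos (Metric.measure_ball_pos _ _ one_pos).ne' measure_ball_lt_top.ne

lemma _root_.LOD.volume_ball_eq (x : E d) {r : ℝ} (hr : 0 < r) :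
    volume.real (Metric.ball x r) = unitVol d * r ^ d := by
  rw [unitVol, Measure.real, Measure.addHaar_ball_of_pos _ _ hr]
  simp [ENNReal.toReal_mul, Measure.real, hr.le, mul_comm]

lemma _root_.LOD.volume_closedBall_eq (x : E d) {r : ℝ} (hr : 0 ≤ r) :
    volume.real (Metric.closedBall x r) = unitVol d * r ^ d := by
  rw [unitVol, Measure.real, Measure.addHaar_closedBall _ _ hr]
  simp [ENNReal.toReal_mul, Measure.real, hr, mul_comm]

variable {σ : ℝ}

lemma volume_elem_ge (hS : S.IsSetup) (hR : S.IsRegular σ) (hσ : 0 < σ) {T : Finset (E d)}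
    (hT : T ∈ S.coarse.elems) : unitVol d * (S.H / σ) ^ d ≤ volume.real (simplex T) := by
  obtain ⟨c, hc⟩ := hR.coarse_ball T hT
  rw [← volume_ball_eq c (div_pos hS.H_pos hσ)]
  exact measureReal_mono hc (volume_simplex_ne_top T)

lemma volume_elem_le (hS : S.IsSetup) (hR : S.IsRegular σ) {T : Finset (E d)}
    (hT : T ∈ S.coarse.elems) : volume.real (simplex T) ≤ unitVol d * S.H ^ d := by
  obtain ⟨y, hy⟩ := (S.coarse.isSimplex hT).nonempty
  rw [← volume_closedBall_eq y hS.H_pos.le]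
  refine measureReal_mono (fun p hp => ?_) measure_closedBall_lt_top.ne
  exact (dist_le_diam_simplex hp (vertex_mem_simplex hy)).trans (hR.coarse_diam T hT)

/-- Volume packing: the elements have disjoint interiors and each contains a ball of radius `H / σ`.
The volume of the unit ball cancels. -/
lemma card_le_of_subset_closedBall (hS : S.IsSetup) (hR : S.IsRegular σ) (hσ : 0 < σ)
    {A : Finset (Finset (E d))} (hA : A ⊆ S.coarse.elems) {p : E d} {r : ℝ} (hr : 0 ≤ r)
    (h : ∀ T ∈ A, simplex T ⊆ Metric.closedBall p r) : (A.card : ℝ) ≤ (σ * r / S.H) ^ d := by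
  have hH := hS.H_pos
  have h1 : ∑ T ∈ A, volume.real (simplex T) ≤ unitVol d * r ^ d := by
    rw [← volume_closedBall_eq p hr]
    have hfin : ∀ T ∈ A, volume (interior (simplex T)) ≠ ⊤ := fun T _ =>
      ne_top_of_le_ne_top (volume_simplex_ne_top T) (measure_mono interior_subset)
    have : ∀ T ∈ A, volume.real (simplex T) = volume.real (interior (simplex T)) := fun T _ =>
      (measureReal_congr (interior_ae_eq T)).symm
    rw [Finset.sum_congr rfl this, ← measureReal_biUnion_finset (h := hfin)]
    · exact measureReal_mono (Set.iUnion₂_subset fun T hT => interior_subset.trans (h T hT))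
        measure_closedBall_lt_top.ne
    · intro T hT T' hT' hne
      exact (S.coarse.interior_disjoint (hA hT) (hA hT') hne).mono_right interior_subset
    · exact fun T _ => isOpen_interior.measurableSet
  have h2 : A.card * (unitVol d * (S.H / σ) ^ d) ≤ ∑ T ∈ A, volume.real (simplex T) := by
    rw [← nsmul_eq_mul]
    exact Finset.card_nsmul_le_sum _ _ _ fun T hT => volume_elem_ge hS hR hσ (hA hT)
  have h3 := h2.trans h1
  have hω := unitVol_pos (d := d)
  have h4 : (A.card : ℝ) * (S.H / σ) ^ d ≤ r ^ d := by
    refine le_of_mul_le_mul_left ?_ hω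
    linarith
  calc (A.card : ℝ) = A.card * (S.H / σ) ^ d * (σ / S.H) ^ d := by
        rw [mul_assoc, ← mul_pow]
        have : S.H / σ * (σ / S.H) = 1 := by field_simp
        rw [this, one_pow, mul_one]
    _ ≤ r ^ d * (σ / S.H) ^ d := by gcongr
    _ = _ := by rw [← mul_pow]; congr 1; ring

lemma card_neighbours_le (hS : S.IsSetup) (hR : S.IsRegular σ) (hσ : 0 < σ) {T : Finset (E d)}
    (hT : T ∈ S.coarse.elems) :
    ((S.addLayer {T}).card : ℝ) ≤ (2 * σ) ^ d := by
  obtain ⟨y, hy⟩ := (S.coarse.isSimplex hT).nonempty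
  have := card_le_of_subset_closedBall hS hR hσ (A := S.addLayer {T})
    (fun T' hT' => cut_mem_coarse (addLayer_subset _ hT')) (p := y) (r := 2 * S.H)
    (by linarith [hS.H_pos]) (by
      intro T' hT' p hp
      obtain ⟨h1, T'', h2, q, hq, hq'⟩ := Finset.mem_filter.1 hT'
      rw [Finset.mem_singleton] at h2; subst h2
      have e1 := (dist_le_diam_simplex hp hq).trans (hR.coarse_diam T' (cut_mem_coarse h1))
      have e2 := (dist_le_diam_simplex hq' (vertex_mem_simplex hy)).trans (hR.coarse_diam _ hT)
      have := dist_triangle p q y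
      rw [Metric.mem_closedBall]; linarith)
  have hH := hS.H_pos
  have e : σ * (2 * S.H) / S.H = 2 * σ := by field_simp
  rwa [e] at this

/-- Every cell is shape regular. -/
lemma cell_ball (hR : S.IsRegular σ) (hσ : 0 < σ) {c : Finset (E d)}
    (hc : c ∈ S.cells) : ∃ z, Metric.ball z (Metric.diam (simplex c) / σ) ⊆ simplex c := by
  rcases Finset.mem_union.1 hc with h | h
  · exact hR.fine_ball c h
  · have hT := cut_mem_coarse (mem_unrefined.1 h).1
    obtain ⟨z, hz⟩ := hR.coarse_ball c hT
    refine ⟨z, (Metric.ball_subset_ball ?_).trans hz⟩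
    have := hR.coarse_diam c hT
    gcongr

lemma _root_.LOD.IsSimplex.diam_pos {c : Finset (E d)} (hc : IsSimplex c) (hd : 1 ≤ d) :
    0 < Metric.diam (simplex c) := by
  have h1 : 1 < c.card := by rw [hc.1]; omega
  obtain ⟨x, hx, y, hy, hne⟩ := Finset.one_lt_card.1 h1
  exact (dist_pos.2 hne).trans_le
    (dist_le_diam_simplex (vertex_mem_simplex hx) (vertex_mem_simplex hy))

lemma sum_volume_sub_le (hS : S.IsSetup) (T : Finset (E d)) :
    ∑ c ∈ S.sub T, volume.real (simplex c) ≤ volume.real (simplex T) := by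
  have hfin : ∀ c ∈ S.sub T, volume (interior (simplex c)) ≠ ⊤ := fun c _ =>
    ne_top_of_le_ne_top (volume_simplex_ne_top c) (measure_mono interior_subset)
  have : ∀ c ∈ S.sub T, volume.real (simplex c) = volume.real (interior (simplex c)) :=
    fun c _ => (measureReal_congr (interior_ae_eq c)).symm
  rw [Finset.sum_congr rfl this, ← measureReal_biUnion_finset (h := hfin)]
  · exact measureReal_mono (Set.iUnion₂_subset fun c hc =>
      interior_subset.trans (mem_sub.1 hc).2) (volume_simplex_ne_top T)
  · intro c hc c' hc' hne
    exact (cell_interior_disjoint hS (mem_sub.1 hc).1 (mem_sub.1 hc').1 hne).mono_right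
      interior_subset
  · exact fun c _ => isOpen_interior.measurableSet

end Setting

namespace Setting

variable {S : Setting d}

/-! ### Regularity of piecewise affine functions -/

lemma IsPW.exists_bound {v : E d → ℝ} (hv : S.IsPW v) (hS : S.IsSetup) :
    ∃ C, ∀ p ∈ S.Ω, |v p| ≤ C := by
  have h1 : ∀ c : Finset (E d), ∃ C, ∀ p ∈ simplex c, ‖piece c v p‖ ≤ C := fun c =>
    (isCompact_simplex c).exists_bound_of_continuousOn (continuous_affine _).continuousOn
  choose C hC using h1
  refine ⟨∑ c ∈ S.cells, |C c|, fun p hp => ?_⟩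
  obtain ⟨c, hc, hpc⟩ := exists_cell hS hp
  rw [hv.eqOn hS hc ⟨hpc, hp⟩]
  refine (hC c p hpc).trans ((le_abs_self _).trans ?_)
  exact Finset.single_le_sum (f := fun c => |C c|) (fun _ _ => abs_nonneg _) hc

lemma volume_Ω_lt_top (hS : S.IsSetup) : volume S.Ω < ⊤ := by
  refine (measure_mono (subset_iUnion_cut hS)).trans_lt ?_
  exact (measure_biUnion_lt_top S.cutMesh.finite_toSet
    fun T _ => (volume_simplex_ne_top T).lt_top)

lemma volume_region_lt_top (hS : S.IsSetup) (A : Finset (Finset (E d))) :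
    volume (S.region A) < ⊤ :=
  (measure_mono (region_subset A)).trans_lt (volume_Ω_lt_top hS)

lemma isFiniteMeasure_region (hS : S.IsSetup) (A : Finset (Finset (E d))) :
    IsFiniteMeasure (volume.restrict (S.region A)) :=
  isFiniteMeasure_restrict.2 (volume_region_lt_top hS A).ne

lemma IsPW.memLp {v : E d → ℝ} (hv : S.IsPW v) (hS : S.IsSetup) (A : Finset (Finset (E d))) :
    MemLp v 2 (volume.restrict (S.region A)) := by
  have := isFiniteMeasure_region hS A
  obtain ⟨C, hC⟩ := hv.exists_bound hS
  have hm := (isOpen_region (S := S) A).measurableSet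
  refine MemLp.of_bound ((hv.1.mono (region_subset A)).aestronglyMeasurable hm) C ?_
  exact (ae_restrict_iff' hm).2 (ae_of_all _ fun p hp => hC p (region_subset A hp))

/-- Makes the Poincaré assumption applicable. On a segment in `Ω` the function is continuous with
finitely many possible slopes, so the bound is propagated along the segment by continuous induction.
-/
lemma IsPW.exists_lipschitz {v : E d → ℝ} (hv : S.IsPW v) (hS : S.IsSetup) :
    ∃ K : NNReal, ∀ B ⊆ S.Ω, Convex ℝ B → LipschitzOnWith K v B := by
  set K : ℝ := ∑ c ∈ S.cells, ‖grad (piece c v)‖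
  have hK0 : 0 ≤ K := Finset.sum_nonneg fun _ _ => norm_nonneg _
  refine ⟨⟨K, hK0⟩, fun B hB hconv => LipschitzOnWith.of_dist_le_mul fun q hq q' hq' => ?_⟩
  change |v q - v q'| ≤ K * dist q q'
  set γ : ℝ → E d := fun s => AffineMap.lineMap q q' s with hγ
  have hγc : Continuous γ := AffineMap.lineMap_continuous
  have hγB : ∀ s ∈ Set.Icc (0 : ℝ) 1, γ s ∈ S.Ω := fun s hs => hB (hconv.lineMap_mem hq hq' hs)
  have hdist : ∀ s t, dist (γ s) (γ t) = |s - t| * dist q q' := by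
    intro s t; simp [hγ, dist_lineMap_lineMap, Real.dist_eq]
  set h : ℝ → ℝ := fun s => v (γ s)
  have hh : ContinuousOn h (Set.Icc 0 1) := hv.1.comp hγc.continuousOn hγB
  have hlip : ∀ c ∈ S.cells, ∀ s ∈ Set.Icc (0 : ℝ) 1, ∀ t ∈ Set.Icc (0 : ℝ) 1,
      γ s ∈ simplex c → γ t ∈ simplex c → |h s - h t| ≤ K * dist q q' * |s - t| := by
    intro c hc s hs t ht hsc htc
    simp only [h]
    rw [hv.eqOn hS hc ⟨hsc, hγB s hs⟩, hv.eqOn hS hc ⟨htc, hγB t ht⟩]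
    refine (abs_affine_sub_le _ _ _).trans ?_
    rw [hdist, mul_assoc, mul_comm (dist q q')]
    refine mul_le_mul_of_nonneg_right ?_ (by positivity)
    exact Finset.single_le_sum (f := fun c => ‖grad (piece c v)‖) (fun _ _ => norm_nonneg _) hc
  have hsub : Set.Icc (0 : ℝ) 1 ⊆ {s | |h s - h 0| ≤ K * dist q q' * s} := by
    refine IsClosed.Icc_subset_of_forall_exists_gt ?_ (by simp) ?_
    · have hc1 : ContinuousOn (fun s => |h s - h 0| - K * dist q q' * s) (Set.Icc 0 1) :=
        (hh.sub continuousOn_const).abs.sub (by fun_prop)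
      have := hc1.preimage_isClosed_of_isClosed isClosed_Icc (isClosed_Iic (a := (0 : ℝ)))
      convert! this using 1
      ext s
      simp [and_comm]
    · rintro t ⟨ht, ht0, ht1⟩ y hy
      set y' := min y 1
      have hty : t < y' := lt_min hy ht1
      have hev : ∀ᶠ s in 𝓝[>] t, s ∈ Set.Ioo t y' := Ioo_mem_nhdsGT hty
      -- As there are finitely many cells, one of them contains points of the segment arbitrarily
      -- close to `γ t` on the right. It is closed, hence contains `γ t` too, and the slope of that
      -- cell advances the bound.
      obtain ⟨c, hc, hfr⟩ : ∃ c ∈ S.cells, ∃ᶠ s in 𝓝[>] t, γ s ∈ simplex c := by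
        by_contra! hcon
        have : ∀ᶠ s in 𝓝[>] t, ∀ c ∈ S.cells, γ s ∉ simplex c := by
          rw [Filter.eventually_all_finset]
          intro c hc
          simpa using hcon c hc
        obtain ⟨s, hs1, hs2⟩ := (this.and hev).exists
        obtain ⟨c, hc, hsc⟩ := exists_cell hS
          (hγB s ⟨ht0.trans hs2.1.le, hs2.2.le.trans (min_le_right _ _)⟩)
        exact hs1 c hc hsc
      have htc : γ t ∈ simplex c := by
        have hcl : IsClosed (γ ⁻¹' simplex c) := (isClosed_simplex c).preimage hγc
        have hfr' : ∃ᶠ s in 𝓝 t, s ∈ γ ⁻¹' simplex c := hfr.filter_mono nhdsWithin_le_nhds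
        exact hcl.closure_subset (mem_closure_iff_frequently.2 hfr')
      obtain ⟨s, hs1, hs2⟩ := (hfr.and_eventually hev).exists
      have hs01 : s ∈ Set.Icc (0 : ℝ) 1 :=
        ⟨ht0.trans hs2.1.le, hs2.2.le.trans (min_le_right _ _)⟩
      refine ⟨s, ?_, hs2.1, hs2.2.le.trans (min_le_left _ _)⟩
      have e1 := hlip c hc s hs01 t ⟨ht0, ht1.le⟩ hs1 htc
      rw [abs_of_pos (sub_pos.2 hs2.1)] at e1
      have e2 := abs_sub_le (h s) (h t) (h 0)
      change |h t - h 0| ≤ _ at ht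
      change |h s - h 0| ≤ _
      linarith
  have := hsub (Set.right_mem_Icc.2 zero_le_one)
  rw [abs_sub_comm]
  simpa [h, hγ] using this

lemma IsPW.locallyLipschitzOn {v : E d → ℝ} (hv : S.IsPW v) (hS : S.IsSetup)
    (A : Finset (Finset (E d))) : LocallyLipschitzOn (S.region A) v := by
  obtain ⟨K, hK⟩ := hv.exists_lipschitz hS
  intro p hp
  obtain ⟨ε, hε, hball⟩ := Metric.isOpen_iff.1 hS.isOpen p (region_subset A hp)
  exact ⟨K, Metric.ball p ε, mem_nhdsWithin_of_mem_nhds (Metric.ball_mem_nhds p hε),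
    hK _ hball (convex_ball p ε)⟩

lemma IsPW.memLp_gradient {v : E d → ℝ} (hv : S.IsPW v) (hS : S.IsSetup)
    {A : Finset (Finset (E d))} (hA : A ⊆ S.cutMesh) :
    MemLp (gradient v) 2 (volume.restrict (S.region A)) := by
  have := isFiniteMeasure_region hS A
  have hg : ∀ c ∈ S.cells, ∀ p ∈ interior (simplex c), gradient v p = grad (piece c v) :=
    fun c hc p hp => gradient_eq_of_eqOn isOpen_interior (hv.eqOn_interior hS hc) hp
  refine MemLp.of_bound (C := ∑ c ∈ S.cells, ‖grad (piece c v)‖)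
    (integrableOn_region hS hA fun T _ c hc => ?_).aestronglyMeasurable ?_
  · have h1 : IntegrableOn (fun _ : E d => grad (piece c v)) (interior (simplex c)) :=
      integrableOn_const (ne_top_of_le_ne_top (volume_simplex_ne_top c)
        (measure_mono interior_subset))
    exact h1.congr_fun (fun p hp => (hg c (mem_sub.1 hc).1 p hp).symm)
      isOpen_interior.measurableSet
  · rw [Measure.restrict_congr_set (region_ae_eq hS hA)]
    have hm : MeasurableSet (⋃ c ∈ A.biUnion S.sub, interior (simplex c)) :=
      (isOpen_biUnion fun _ _ => isOpen_interior).measurableSet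
    refine (ae_restrict_iff' hm).2 (ae_of_all _ fun p hp => ?_)
    obtain ⟨c, hc, hpc⟩ := Set.mem_iUnion₂.1 hp
    obtain ⟨T, -, hcT⟩ := Finset.mem_biUnion.1 hc
    rw [hg c (mem_sub.1 hcT).1 p hpc]
    exact Finset.single_le_sum (f := fun c => ‖grad (piece c v)‖) (fun _ _ => norm_nonneg _)
      (mem_sub.1 hcT).1

/-! ### Norms on coarse elements -/

/-- The squared `L²` norm on the coarse element `T`. -/
def mass (S : Setting d) (T : Finset (E d)) (v : E d → ℝ) : ℝ :=
  ∑ c ∈ S.sub T, ∫ p in simplex c, (piece c v p) ^ 2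

/-- The squared `L²` norm of the gradient on the coarse element `T`. -/
def dirichletForm (S : Setting d) (T : Finset (E d)) (v : E d → ℝ) : ℝ :=
  ∑ c ∈ S.sub T, volume.real (simplex c) * ‖grad (piece c v)‖ ^ 2

lemma mass_nonneg (T : Finset (E d)) (v : E d → ℝ) : 0 ≤ S.mass T v :=
  Finset.sum_nonneg fun _ _ => integral_nonneg fun _ => sq_nonneg _

lemma dirichletForm_le (hS : S.IsSetup) (hd : 1 ≤ d) (T : Finset (E d)) (v : S.pw) :
    S.dirichletForm T v.1 ≤ energyForm hS hd T v v := by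
  rw [energyForm_apply]
  refine Finset.sum_le_sum fun c _ => ?_
  rw [form, real_inner_self_eq_norm_sq]
  exact le_add_of_nonneg_right (robin_integral_nonneg hS c _)

lemma IsPW.setIntegral_sq {v : E d → ℝ} (hv : S.IsPW v) (hS : S.IsSetup)
    {A : Finset (Finset (E d))} (hA : A ⊆ S.cutMesh) :
    ∫ p in S.region A, (v p) ^ 2 = ∑ T ∈ A, S.mass T v :=
  (setIntegral_region_of_eqOn hS hA (F := fun c p => (piece c v p) ^ 2)
    (fun c => ((continuous_affine _).pow 2).continuousOn) fun T _ c hc p hp => by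
      simp only [hv.eqOn_interior hS (mem_sub.1 hc).1 hp]).2

lemma IsPW.setIntegral_gradient_sq {v : E d → ℝ} (hv : S.IsPW v) (hS : S.IsSetup)
    {A : Finset (Finset (E d))} (hA : A ⊆ S.cutMesh) :
    ∫ p in S.region A, ‖gradient v p‖ ^ 2 = ∑ T ∈ A, S.dirichletForm T v := by
  rw [(setIntegral_region_of_eqOn hS hA (F := fun c _ => ‖grad (piece c v)‖ ^ 2)
    (fun c => continuousOn_const) fun T _ c hc p hp => by
      simp only [gradient_eq_of_eqOn isOpen_interior
        (hv.eqOn_interior hS (mem_sub.1 hc).1) hp]).2]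
  simp only [setIntegral_const, smul_eq_mul, dirichletForm]

/-! ### The local projections -/

lemma mem_interiorElems {T : Finset (E d)} :
    T ∈ S.interiorElems ↔ T ∈ S.cutMesh ∧ simplex T ⊆ S.Ω := Finset.mem_filter

lemma exists_interiorElem {x : E d} (hx : x ∈ S.interiorNodes) :
    ∃ T ∈ S.interiorElems, x ∈ T := by
  simpa using Finset.mem_biUnion.1 hx

lemma mem_interiorNodes {x : E d} {T : Finset (E d)} (hT : T ∈ S.interiorElems) (hx : x ∈ T) :
    x ∈ S.interiorNodes := Finset.mem_biUnion.2 ⟨T, hT, hx⟩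

lemma interiorNodes_subset : S.interiorNodes ⊆ S.nodes := by
  intro x hx
  obtain ⟨T, hT, hxT⟩ := exists_interiorElem hx
  exact Finset.mem_biUnion.2 ⟨T, (mem_interiorElems.1 hT).1, hxT⟩

lemma mem_Ω_of_interiorNode {x : E d} (hx : x ∈ S.interiorNodes) : x ∈ S.Ω := by
  obtain ⟨T, hT, hxT⟩ := exists_interiorElem hx
  exact (mem_interiorElems.1 hT).2 (vertex_mem_simplex hxT)

lemma mem_nodeLayer_zero {x : E d} {T : Finset (E d)} :
    T ∈ S.nodeLayer x 0 ↔ T ∈ S.cutMesh ∧ x ∈ simplex T := Finset.mem_filter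

lemma coarse_memLp (hS : S.IsSetup) (x : E d) (w : S.coarseSpace) :
    MemLp w.1 2 (volume.restrict (S.nodePatch x 0)) :=
  (isPW_of_mem_coarseSpace hS w.2).memLp hS _

/-- Coarse functions as elements of `L²(ω_x^0)`. -/
def coarseToLp (hS : S.IsSetup) (x : E d) :
    S.coarseSpace →ₗ[ℝ] Lp ℝ 2 (volume.restrict (S.nodePatch x 0)) where
  toFun w := (coarse_memLp hS x w).toLp
  map_add' u v := MemLp.toLp_add (coarse_memLp hS x u) (coarse_memLp hS x v)
  map_smul' a v := MemLp.toLp_const_smul a (coarse_memLp hS x v)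

/-- Orthogonal projection in `L²(ω_x^0)` onto the finite-dimensional image of the coarse space. A
preimage need not be unique, since a coarse function may vanish on the patch. -/
lemma exists_isLocalProj (hS : S.IsSetup) (x : E d) {v : E d → ℝ}
    (hv : MemLp v 2 (volume.restrict (S.nodePatch x 0))) : ∃ p, S.IsLocalProj x v p := by
  have : FiniteDimensional ℝ S.coarseSpace :=
    FiniteDimensional.span_of_finite ℝ (S.nodes.finite_toSet.image _)
  set W := LinearMap.range (coarseToLp hS x)
  obtain ⟨p, hp⟩ : W.starProjection hv.toLp ∈ W := Submodule.starProjection_apply_mem _ _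
  refine ⟨p.1, p.2, fun w hw => ?_⟩
  have h1 := W.starProjection_inner_eq_zero hv.toLp (coarseToLp hS x ⟨w, hw⟩) ⟨_, rfl⟩
  rw [inner_sub_left, sub_eq_zero, ← hp] at h1
  rw [L2.inner_def, L2.inner_def] at h1
  have e1 := hv.coeFn_toLp
  have e2 := (coarse_memLp hS x p).coeFn_toLp
  have e3 := (coarse_memLp hS x ⟨w, hw⟩).coeFn_toLp
  have h2 : ∫ a in S.nodePatch x 0, inner ℝ ((hv.toLp : E d → ℝ) a)
      ((coarseToLp hS x ⟨w, hw⟩ : E d → ℝ) a) = ∫ y in S.nodePatch x 0, v y * w y := by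
    refine integral_congr_ae ?_
    filter_upwards [e1, e3] with a h h'
    change inner ℝ _ (((coarse_memLp hS x ⟨w, hw⟩).toLp : E d → ℝ) a) = _
    rw [h, h']; simp [mul_comm]
  have h3 : ∫ a in S.nodePatch x 0, inner ℝ ((coarseToLp hS x p : E d → ℝ) a)
      ((coarseToLp hS x ⟨w, hw⟩ : E d → ℝ) a) = ∫ y in S.nodePatch x 0, p.1 y * w y := by
    refine integral_congr_ae ?_
    filter_upwards [e2, e3] with a h h'
    change inner ℝ (((coarse_memLp hS x p).toLp : E d → ℝ) a)
      (((coarse_memLp hS x ⟨w, hw⟩).toLp : E d → ℝ) a) = _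
    rw [h, h']; simp [mul_comm]
  rw [← h2, ← h3]; exact h1.symm

lemma coarse_mul_integrable (hS : S.IsSetup) (x : E d) {v w : E d → ℝ}
    (hv : MemLp v 2 (volume.restrict (S.nodePatch x 0))) (hw : w ∈ S.coarseSpace) :
    IntegrableOn (fun y => v y * w y) (S.nodePatch x 0) :=
  hv.integrable_mul (coarse_memLp hS x ⟨w, hw⟩)

variable {σ : ℝ}

/-- The inverse estimate for coarse functions at an interior node. -/
lemma coarse_sq_le (hS : S.IsSetup) (hR : S.IsRegular σ) (hσ : 0 < σ) {x : E d}
    (hx : x ∈ S.interiorNodes) {p : E d → ℝ} (hp : p ∈ S.coarseSpace) :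
    unitVol d * (S.H / σ) ^ d * (p x) ^ 2 ≤
      4 ^ (d + 1) * ∫ y in S.nodePatch x 0, (p y) ^ 2 := by
  -- An interior element contributes its full volume to the patch; a cut element could meet `Ω` in
  -- an arbitrarily small piece.
  obtain ⟨T, hT, hxT⟩ := exists_interiorElem hx
  obtain ⟨hTc, hTΩ⟩ := mem_interiorElems.1 hT
  obtain ⟨g, hg⟩ := exists_affine_of_mem_coarseSpace hp (cut_mem_coarse hTc)
  have hxs := vertex_mem_simplex hxT
  have hTl : T ∈ S.nodeLayer x 0 := mem_nodeLayer_zero.2 ⟨hTc, hxs⟩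
  have h1 := vertex_sq_le scalesLike_volume (volume_simplex_ne_top T) g hxT
  have h2 : ∫ y in simplex T, (g y) ^ 2 ≤ ∫ y in S.nodePatch x 0, (p y) ^ 2 := by
    rw [← setIntegral_interior T (fun y => (g y) ^ 2),
      setIntegral_congr_fun (g := fun y => (p y) ^ 2) isOpen_interior.measurableSet
        fun y hy => by simp only [hg (interior_subset hy)]]
    refine setIntegral_mono_set ?_ (ae_of_all _ fun y => sq_nonneg _) ?_
    · simpa [sq] using coarse_mul_integrable hS x (coarse_memLp hS x ⟨p, hp⟩) hp
    · refine LE.le.eventuallyLE fun y hy => ?_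
      exact interior_inter_subset_region hS hTl ⟨hy, hTΩ (interior_subset hy)⟩
  rw [hg hxs]
  calc _ ≤ volume.real (simplex T) * (g x) ^ 2 := by
        gcongr; exact volume_elem_ge hS hR hσ (cut_mem_coarse hTc)
    _ ≤ _ := h1
    _ ≤ _ := by gcongr

/-- The difference has norm zero on the patch, and the inverse estimate `coarse_sq_le` controls its
value at `x`. So the choice in `projValue` does not matter. -/
lemma isLocalProj_unique (hS : S.IsSetup) (hR : S.IsRegular σ) (hσ : 0 < σ) {x : E d}
    (hx : x ∈ S.interiorNodes) {v p q : E d → ℝ} (hp : S.IsLocalProj x v p)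
    (hq : S.IsLocalProj x v q) : p x = q x := by
  have hsub := S.coarseSpace.sub_mem hp.1 hq.1
  have h1 : ∫ y in S.nodePatch x 0, ((p - q) y) ^ 2 = 0 := by
    have h2 := (hp.2 _ hsub).trans (hq.2 _ hsub).symm
    have h3 := integral_sub (coarse_mul_integrable hS x (coarse_memLp hS x ⟨p, hp.1⟩) hsub)
      (coarse_mul_integrable hS x (coarse_memLp hS x ⟨q, hq.1⟩) hsub)
    rw [h2, sub_self] at h3
    rw [← h3]
    congr 1; ext y; simp only [Pi.sub_apply]; ring
  have h4 := coarse_sq_le hS hR hσ hx hsub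
  rw [h1, mul_zero] at h4
  have h5 : 0 < unitVol d * (S.H / σ) ^ d :=
    mul_pos unitVol_pos (pow_pos (div_pos hS.H_pos hσ) d)
  have h6 : ((p - q) x) ^ 2 ≤ 0 := by
    by_contra h; rw [not_le] at h; linarith [mul_pos h5 h]
  have h7 : (p - q) x = 0 := pow_eq_zero_iff two_ne_zero |>.1 (le_antisymm h6 (sq_nonneg _))
  exact sub_eq_zero.1 h7

lemma IsLocalProj.projValue_eq (hS : S.IsSetup) (hR : S.IsRegular σ) (hσ : 0 < σ) {x : E d}
    (hx : x ∈ S.interiorNodes) {v p : E d → ℝ} (hp : S.IsLocalProj x v p) :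
    S.projValue x v = p x := by
  have h : ∃ p, S.IsLocalProj x v p := ⟨p, hp⟩
  rw [projValue, dif_pos h]
  exact isLocalProj_unique hS hR hσ hx (Classical.choose_spec h) hp

lemma projValue_congr {x : E d} {v v' : E d → ℝ}
    (h : ∀ w ∈ S.coarseSpace,
      ∫ y in S.nodePatch x 0, v y * w y = ∫ y in S.nodePatch x 0, v' y * w y) :
    S.projValue x v = S.projValue x v' := by
  have : S.IsLocalProj x v = S.IsLocalProj x v' := by
    ext p
    refine and_congr_right fun _ => forall₂_congr fun w hw => ?_
    rw [h w hw]
  rw [projValue, projValue, this]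

lemma projValue_congr_eqOn {x : E d} {v v' : E d → ℝ} (h : Set.EqOn v v' (S.nodePatch x 0)) :
    S.projValue x v = S.projValue x v' :=
  projValue_congr fun w _ => setIntegral_congr_fun (isOpen_region _).measurableSet
    fun y hy => by simp only [h hy]

lemma projValue_coarse (hS : S.IsSetup) (hR : S.IsRegular σ) (hσ : 0 < σ) {x : E d}
    (hx : x ∈ S.interiorNodes) {w : E d → ℝ} (hw : w ∈ S.coarseSpace) :
    S.projValue x w = w x :=
  IsLocalProj.projValue_eq hS hR hσ hx ⟨hw, fun _ _ => rfl⟩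

lemma projValue_add (hS : S.IsSetup) (hR : S.IsRegular σ) (hσ : 0 < σ) {x : E d}
    (hx : x ∈ S.interiorNodes) {u v : E d → ℝ}
    (hu : MemLp u 2 (volume.restrict (S.nodePatch x 0)))
    (hv : MemLp v 2 (volume.restrict (S.nodePatch x 0))) :
    S.projValue x (u + v) = S.projValue x u + S.projValue x v := by
  obtain ⟨p, hp⟩ := exists_isLocalProj hS x hu
  obtain ⟨q, hq⟩ := exists_isLocalProj hS x hv
  rw [hp.projValue_eq hS hR hσ hx, hq.projValue_eq hS hR hσ hx]
  refine IsLocalProj.projValue_eq hS hR hσ hx (p := p + q)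
    ⟨S.coarseSpace.add_mem hp.1 hq.1, fun w hw => ?_⟩
  simp only [Pi.add_apply, add_mul]
  rw [integral_add (coarse_mul_integrable hS x (coarse_memLp hS x ⟨p, hp.1⟩) hw)
    (coarse_mul_integrable hS x (coarse_memLp hS x ⟨q, hq.1⟩) hw),
    integral_add (coarse_mul_integrable hS x hu hw) (coarse_mul_integrable hS x hv hw),
    hp.2 w hw, hq.2 w hw]

lemma projValue_smul (hS : S.IsSetup) (hR : S.IsRegular σ) (hσ : 0 < σ) {x : E d}
    (hx : x ∈ S.interiorNodes) {v : E d → ℝ}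
    (hv : MemLp v 2 (volume.restrict (S.nodePatch x 0))) (a : ℝ) :
    S.projValue x (a • v) = a * S.projValue x v := by
  obtain ⟨p, hp⟩ := exists_isLocalProj hS x hv
  rw [hp.projValue_eq hS hR hσ hx]
  refine IsLocalProj.projValue_eq hS hR hσ hx (p := a • p)
    ⟨S.coarseSpace.smul_mem a hp.1, fun w hw => ?_⟩
  simp only [Pi.smul_apply, smul_eq_mul, mul_assoc]
  rw [integral_const_mul, integral_const_mul, hp.2 w hw]

/-- The inverse estimate is applied to the projection, whose `L²` norm does not exceed that of `v`.
-/
lemma projValue_sq_le (hS : S.IsSetup) (hR : S.IsRegular σ) (hσ : 0 < σ) {x : E d}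
    (hx : x ∈ S.interiorNodes) {v : E d → ℝ}
    (hv : MemLp v 2 (volume.restrict (S.nodePatch x 0))) :
    unitVol d * (S.H / σ) ^ d * (S.projValue x v) ^ 2 ≤
      4 ^ (d + 1) * ∫ y in S.nodePatch x 0, (v y) ^ 2 := by
  obtain ⟨p, hp⟩ := exists_isLocalProj hS x hv
  rw [hp.projValue_eq hS hR hσ hx]
  refine (coarse_sq_le hS hR hσ hx hp.1).trans ?_
  have hpp : IntegrableOn (fun y => p y * p y) (S.nodePatch x 0) :=
    coarse_mul_integrable hS x (coarse_memLp hS x ⟨p, hp.1⟩) hp.1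
  have hvp := coarse_mul_integrable hS x hv hp.1
  have hvv : IntegrableOn (fun y => v y * v y) (S.nodePatch x 0) := hv.integrable_mul hv
  have h0 : 0 ≤ ∫ y in S.nodePatch x 0, (v y - p y) ^ 2 := integral_nonneg fun y => sq_nonneg _
  have h1 : ∫ y in S.nodePatch x 0, (v y - p y) ^ 2 =
      (∫ y in S.nodePatch x 0, v y * v y) - 2 * (∫ y in S.nodePatch x 0, v y * p y) +
        ∫ y in S.nodePatch x 0, p y * p y := by
    have hs : IntegrableOn (fun y => v y * v y - 2 * (v y * p y)) (S.nodePatch x 0) :=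
      hvv.sub (hvp.const_mul 2)
    rw [← integral_const_mul, ← integral_sub hvv (hvp.const_mul 2), ← integral_add hs hpp]
    congr 1; ext y; ring
  rw [h1, ← hp.2 p hp.1] at h0
  have h2 : ∫ y in S.nodePatch x 0, (p y) ^ 2 ≤ ∫ y in S.nodePatch x 0, (v y) ^ 2 := by
    simp only [sq]; linarith
  gcongr

/-! ### The inequality of Friedrichs for fine scale functions -/

lemma nodePatch_subset_closedBall (hR : S.IsRegular σ) (x : E d) :
    S.nodePatch x 0 ⊆ Metric.closedBall x S.H := by
  intro p hp
  obtain ⟨T, hT, hpT⟩ := Set.mem_iUnion₂.1 (interior_subset hp).1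
  obtain ⟨hTc, hxT⟩ := mem_nodeLayer_zero.1 hT
  exact (dist_le_diam_simplex hpT hxT).trans (hR.coarse_diam T (cut_mem_coarse hTc))

lemma nodal_const (hS : S.IsSetup) (a : ℝ) {p : E d} (hp : p ∈ S.Ω) :
    S.nodal S.nodes (fun _ => a) p = a := by
  obtain ⟨T, hT, hpT⟩ := Set.mem_iUnion₂.1 (subset_iUnion_cut hS hp)
  rw [nodal_eqOn (cut_mem_coarse hT) _ _ hpT, affInterp_apply]
  have : ∀ y ∈ T, (if y ∈ S.nodes then a else 0) * bary T y p = a * bary T y p := fun y hy => by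
    rw [if_pos (show y ∈ S.nodes from Finset.mem_biUnion.2 ⟨T, hT, hy⟩)]
  rw [Finset.sum_congr rfl this, ← Finset.mul_sum, (isSimplex_cut hT).sum_bary, mul_one]

/-- Let `a` be the constant of the Poincaré inequality. Since `P_x` fixes constants and `(P_x v)(x)
= 0`, the number `-a` is the value of `P_x (v - a)` at `x`. By `L²` stability `a` is controlled by
`‖v - a‖`, which the Poincaré inequality bounds. -/
lemma friedrichs (hS : S.IsSetup) (hR : S.IsRegular σ) (hσ : 0 < σ) {M : ℝ} {x : E d}
    (hx : x ∈ S.interiorNodes) (hM : PoincareConstLE (S.nodePatch x 0) M) {v : E d → ℝ}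
    (hv : S.IsPW v) (hv0 : S.projValue x v = 0) :
    ∑ T ∈ S.nodeLayer x 0, S.mass T v ≤ (8 + 8 * 4 ^ (d + 1) * σ ^ d) * M ^ 2 * S.H ^ 2 *
      ∑ T ∈ S.nodeLayer x 0, S.dirichletForm T v := by
  have hH := hS.H_pos
  rw [← hv.setIntegral_sq hS (nodeLayer_subset x 0),
    ← hv.setIntegral_gradient_sq hS (nodeLayer_subset x 0)]
  obtain ⟨a, ha⟩ := hM v (hv.locallyLipschitzOn hS _) (hv.memLp hS _)
    (hv.memLp_gradient hS (nodeLayer_subset x 0))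
  change _ ≤ _ * ∫ p in S.nodePatch x 0, ‖gradient v p‖ ^ 2
  change ∫ p in S.nodePatch x 0, _ ≤ _
  set G := ∫ p in S.nodePatch x 0, ‖gradient v p‖ ^ 2
  have hG : 0 ≤ G := integral_nonneg fun p => sq_nonneg _
  set I := ∫ y in S.nodePatch x 0, (v y - a) ^ 2
  have hI : I ≤ 4 * M ^ 2 * S.H ^ 2 * G := by
    refine ha.trans (mul_le_mul_of_nonneg_right ?_ hG)
    have hdiam : Metric.diam (S.nodePatch x 0) ≤ 2 * S.H :=
      (Metric.diam_mono (nodePatch_subset_closedBall hR x) Metric.isBounded_closedBall).trans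
        (Metric.diam_closedBall hH.le)
    have h0 := Metric.diam_nonneg (s := S.nodePatch x 0)
    calc _ = M ^ 2 * (Metric.diam (S.nodePatch x 0)) ^ 2 := by ring
      _ ≤ M ^ 2 * (2 * S.H) ^ 2 := by gcongr
      _ = _ := by ring
  have hfin := isFiniteMeasure_region hS (S.nodeLayer x 0)
  change IsFiniteMeasure (volume.restrict (S.nodePatch x 0)) at hfin
  have hvL : MemLp v 2 (volume.restrict (S.nodePatch x 0)) := hv.memLp hS _
  have hcL : MemLp (fun _ : E d => a) 2 (volume.restrict (S.nodePatch x 0)) := memLp_const a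
  have hvol : volume.real (S.nodePatch x 0) ≤ unitVol d * S.H ^ d := by
    rw [← volume_closedBall_eq x hH.le]
    exact measureReal_mono (nodePatch_subset_closedBall hR x) measure_closedBall_lt_top.ne
  have hw1 := nodal_mem_coarseSpace (S := S) (N := S.nodes) subset_rfl (fun _ => -a)
  -- In `Ω` the constant is the coarse function with all nodal values `-a`, which the projection
  -- reproduces.
  have hproj : S.projValue x (v + fun _ => -a) = -a := by
    have e1 : S.projValue x (v + fun _ => -a) =
        S.projValue x (v + S.nodal S.nodes fun _ => -a) :=
      projValue_congr_eqOn fun p hp => by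
        simp only [Pi.add_apply, nodal_const hS (-a) (region_subset _ hp)]
    rw [e1, projValue_add hS hR hσ hx hvL (coarse_memLp hS x ⟨_, hw1⟩), hv0, zero_add,
      projValue_coarse hS hR hσ hx hw1, nodal_const hS (-a) (mem_Ω_of_interiorNode hx)]
  have hsq := projValue_sq_le hS hR hσ hx (v := v + fun _ => -a) (hvL.add (memLp_const (-a)))
  rw [hproj] at hsq
  have hI' : ∫ y in S.nodePatch x 0, ((v + fun _ => -a : E d → ℝ) y) ^ 2 = I := by
    simp only [I, Pi.add_apply, sub_eq_add_neg]
  rw [hI'] at hsq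
  have ha2 : volume.real (S.nodePatch x 0) * a ^ 2 ≤ 4 ^ (d + 1) * σ ^ d * I := by
    calc _ ≤ unitVol d * S.H ^ d * a ^ 2 := by gcongr
      _ = σ ^ d * (unitVol d * (S.H / σ) ^ d * (-a) ^ 2) := by rw [div_pow]; field_simp
      _ ≤ σ ^ d * (4 ^ (d + 1) * I) := by gcongr
      _ = _ := by ring
  have hint : IntegrableOn (fun y => (v y - a) ^ 2) (S.nodePatch x 0) :=
    (hvL.sub hcL).integrable_sq
  have hmono : ∫ y in S.nodePatch x 0, (v y) ^ 2 ≤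
      ∫ y in S.nodePatch x 0, (2 * (v y - a) ^ 2 + 2 * a ^ 2) := by
    refine integral_mono hvL.integrable_sq ((hint.const_mul 2).add (integrable_const _)) ?_
    intro y
    change (v y) ^ 2 ≤ 2 * (v y - a) ^ 2 + 2 * a ^ 2
    nlinarith [sq_nonneg (v y - 2 * a)]
  rw [integral_add (hint.const_mul 2) (integrable_const _), integral_const_mul,
    setIntegral_const, smul_eq_mul] at hmono
  have h4 : (0 : ℝ) ≤ 4 ^ (d + 1) * σ ^ d := by positivity
  calc _ ≤ _ := hmono
    _ ≤ (2 + 2 * (4 ^ (d + 1) * σ ^ d)) * I := by change 2 * I + _ ≤ _; linarith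
    _ ≤ (2 + 2 * (4 ^ (d + 1) * σ ^ d)) * (4 * M ^ 2 * S.H ^ 2 * G) := by gcongr
    _ = _ := by ring

end Setting

/-- Both integrals are compared with the largest vertex value of `g`. It will be applied to the
sides of cells, where only vertex values of a cutoff are under control. -/
lemma setIntegral_sq_le_of_abs_le {μ : Measure (E d)} {n : ℕ} (hμ : ScalesLike μ n)
    {s : Finset (E d)} (hs : s.Nonempty) (hfin : μ (simplex s) ≠ ⊤) {f g : E d →ᵃ[ℝ] ℝ}
    (h : ∀ y ∈ s, |f y| ≤ |g y|) :
    ∫ p in simplex s, (f p) ^ 2 ∂μ ≤ 4 ^ (n + 1) * ∫ p in simplex s, (g p) ^ 2 ∂μ := by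
  obtain ⟨y₀, hy₀, hmax⟩ := s.exists_max_image (fun z => |g z|) hs
  refine (setIntegral_sq_le hfin f fun y hy => (h y hy).trans (hmax y hy)).trans ?_
  rw [sq_abs]
  exact vertex_sq_le hμ hfin g hy₀

namespace Setting

variable {S : Setting d} {σ : ℝ}

lemma mem_addLayer_singleton {T T' : Finset (E d)} (hT' : T' ∈ S.cutMesh) {p : E d}
    (h : p ∈ simplex T) (h' : p ∈ simplex T') : T' ∈ S.addLayer {T} :=
  Finset.mem_filter.2 ⟨hT', T, Finset.mem_singleton_self T, p, h', h⟩

/-- The squared `L²` norm on the elements that touch `T`. -/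
def patchMass (S : Setting d) (T : Finset (E d)) (v : E d → ℝ) : ℝ :=
  ∑ T' ∈ S.addLayer {T}, S.mass T' v

lemma patchMass_nonneg (T : Finset (E d)) (v : E d → ℝ) : 0 ≤ S.patchMass T v :=
  Finset.sum_nonneg fun _ _ => mass_nonneg _ _

lemma mass_le_patchMass {T : Finset (E d)} (hT : T ∈ S.cutMesh) (v : E d → ℝ) :
    S.mass T v ≤ S.patchMass T v := by
  obtain ⟨p, hp⟩ := simplex_nonempty_of_cut hT
  exact Finset.single_le_sum (f := fun T' => S.mass T' v) (fun _ _ => mass_nonneg _ _)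
    (mem_addLayer_singleton hT hp hp)

/-! ### Cutoff in the reference space -/

/-- The product of a piecewise affine function with a coarse function `η`, interpolated back to the
reference space. -/
lemma exists_cutoff (hS : S.IsSetup) (η : E d → ℝ) {w : E d → ℝ} (hw : S.IsPW w) :
    ∃ R, S.IsPW R ∧ ∀ T ∈ S.cutMesh, ∀ c ∈ S.sub T, piece c R =
      affInterp T (fun y => if y ∈ S.unrefinedNodes then η y * w y else 0) +
      affInterp c (fun y => affInterp T η y *
        (piece c w - affInterp T fun y => if y ∈ S.unrefinedNodes then w y else 0) y) := by
  -- Interpolating `η w` cell by cell could be discontinuous at fine vertices hanging on unrefined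
  -- elements. So `w` is split into the coarse function `u`, whose product with `η` is interpolated
  -- coarsely, and `w - u`, which vanishes on unrefined elements and is treated on the fine mesh.
  set u := S.nodal S.unrefinedNodes w
  have hu : S.IsPW u := isPW_of_mem_coarseSpace hS (nodal_mem_coarseSpace unrefinedNodes_subset w)
  have huη := isPW_of_mem_coarseSpace hS
    (nodal_mem_coarseSpace unrefinedNodes_subset fun y => η y * w y)
  have hwu := hw.sub hu
  have h0 : ∀ T ∈ S.unrefined, piece T (w - u) = 0 := fun T hT =>
    piece_eq hS (unrefined_mem_cells hT) fun p hp => by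
      simp [u, hw.eqOn_unrefined hS hT hp.1]
  obtain ⟨J, hJ, hJp⟩ := exists_glue hS (fun c y => S.nodal S.nodes η y * piece c (w - u) y)
    (fun c hc c' hc' p hp hpc hpc' y hy hy' => by
      rw [hwu.piece_eq_piece hS (fine_mem_cells hc) (fine_mem_cells hc') hp hpc hpc'
        (vertex_mem_simplex hy) (vertex_mem_simplex hy')])
    (fun c hc T hT p hp hpc hpT y hy hyT => by
      rw [hwu.piece_eq_piece hS (fine_mem_cells hc) (unrefined_mem_cells hT) hp hpc hpT
        (vertex_mem_simplex hy) hyT, h0 T hT]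
      simp)
    (fun T hT y hy => by rw [h0 T hT]; simp)
  refine ⟨_, huη.add hJ, fun T hT c hc => ?_⟩
  have hcc := (mem_sub.1 hc).1
  rw [piece_add hS hcc huη hJ, piece_nodal hS hT hc, hJp c hcc, piece_sub hS hcc hw hu,
    piece_nodal hS hT hc]
  congr 1
  refine affInterp_congr fun y hy => ?_
  rw [nodal_eqOn (cut_mem_coarse hT) _ _ ((mem_sub.1 hc).2 (vertex_mem_simplex hy))]
  congr 2
  exact affInterp_congr fun z hz => if_pos (Finset.mem_biUnion.2 ⟨T, hT, hz⟩)

/-- `R` is the interpolated product of `η` and `w`. -/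
def IsCutoff (S : Setting d) (η w R : E d → ℝ) : Prop :=
  S.IsPW R ∧ ∀ T ∈ S.cutMesh, ∀ c ∈ S.sub T, piece c R =
      affInterp T (fun y => if y ∈ S.unrefinedNodes then η y * w y else 0) +
      affInterp c (fun y => affInterp T η y *
        (piece c w - affInterp T fun y => if y ∈ S.unrefinedNodes then w y else 0) y)

lemma IsCutoff.piece_of_const {η w R : E d → ℝ} (h : S.IsCutoff η w R)
    {T c : Finset (E d)} (hT : T ∈ S.cutMesh) (hc : c ∈ S.sub T) {a : ℝ}
    (hη : ∀ y ∈ T, η y = a) : piece c R = a • piece c w := by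
  have hTs := isSimplex_cut hT
  have hcs := isSimplex_cell (mem_sub.1 hc).1
  have e1 : affInterp T η = AffineMap.const ℝ (E d) a :=
    hTs.affine_ext fun y hy => by simp [hTs.affInterp_vertex η hy, hη y hy]
  have e2 : affInterp T (fun y => if y ∈ S.unrefinedNodes then η y * w y else 0) =
      a • affInterp T (fun y => if y ∈ S.unrefinedNodes then w y else 0) := by
    rw [← affInterp_smul]
    exact affInterp_congr fun y hy => by simp [hη y hy]
  rw [h.2 T hT c hc, e1, e2]
  refine hcs.affine_ext fun y hy => ?_
  simp only [AffineMap.coe_add, Pi.add_apply, hcs.affInterp_vertex _ hy, AffineMap.coe_smul,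
    Pi.smul_apply, smul_eq_mul, AffineMap.const_apply, AffineMap.coe_sub, Pi.sub_apply]
  ring

lemma notMem_unrefinedNodes (hS : S.IsSetup) {T : Finset (E d)} (hT : T ∈ S.boundaryLayer 0)
    {y : E d} (hy : y ∈ T) : y ∉ S.unrefinedNodes := by
  intro h
  obtain ⟨T', hT', hyT'⟩ := Finset.mem_biUnion.1 h
  exact Set.disjoint_left.1 (unrefined_disjoint hS hT' hT) (vertex_mem_simplex hyT')
    (vertex_mem_simplex hy)

/-- With `k ≥ 1` no vertex of an element that leaves `Ω` belongs to an unrefined element, so the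
coarse parts vanish. Vertex values on boundary sides are then plain products, as the Robin and the
Dirichlet terms require. -/
lemma IsCutoff.piece_of_boundary {η w R : E d → ℝ} (h : S.IsCutoff η w R) (hS : S.IsSetup)
    {T c : Finset (E d)} (hT : T ∈ S.boundaryLayer 0) (hc : c ∈ S.sub T) :
    piece c R = affInterp c (fun y => affInterp T η y * piece c w y) := by
  have e : ∀ f : E d → ℝ, affInterp T (fun y => if y ∈ S.unrefinedNodes then f y else 0) = 0 := by
    intro f
    refine Finset.sum_eq_zero fun y hy => ?_
    simp only [if_neg (notMem_unrefinedNodes hS hT hy), zero_smul]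
  rw [h.2 T (boundaryLayer_subset 0 hT) c hc, e, e, zero_add, sub_zero]

/-- The node belongs to a whole unrefined element touching `T`, and the inverse estimate is used
there. This is why `patchMass` includes the neighbours. -/
lemma node_sq_le (hS : S.IsSetup) (hR : S.IsRegular σ) (hσ : 0 < σ) {T : Finset (E d)}
    {w : E d → ℝ} (hw : S.IsPW w) {y : E d} (hy : y ∈ T)
    (hyu : y ∈ S.unrefinedNodes) :
    unitVol d * (S.H / σ) ^ d * (w y) ^ 2 ≤ 4 ^ (d + 1) * S.patchMass T w := by
  obtain ⟨T', hT', hyT'⟩ := Finset.mem_biUnion.1 hyu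
  change y ∈ T' at hyT'
  have hT'c := (mem_unrefined.1 hT').1
  have hys := vertex_mem_simplex hyT'
  have h1 : w y = piece T' w y :=
    hw.eqOn hS (unrefined_mem_cells hT') ⟨hys, unrefined_subset hT' hys⟩
  have h2 : ∫ p in simplex T', (piece T' w p) ^ 2 = S.mass T' w := by
    rw [mass, sub_unrefined hS hT', Finset.sum_singleton]
  have h3 := vertex_sq_le scalesLike_volume (volume_simplex_ne_top T') (piece T' w) hyT'
  rw [h2] at h3
  have h4 : S.mass T' w ≤ S.patchMass T w :=
    Finset.single_le_sum (f := fun T' => S.mass T' w) (fun _ _ => mass_nonneg _ _)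
      (mem_addLayer_singleton hT'c (vertex_mem_simplex hy) hys)
  rw [h1]
  calc _ ≤ volume.real (simplex T') * (piece T' w y) ^ 2 := by
        gcongr; exact volume_elem_ge hS hR hσ (cut_mem_coarse hT'c)
    _ ≤ _ := h3
    _ ≤ _ := by gcongr

/-- Cellwise bounds for the interpolated product. -/
lemma IsCutoff.cell_bounds {η w R : E d → ℝ} (h : S.IsCutoff η w R) (hS : S.IsSetup)
    (hd : 1 ≤ d) (hR : S.IsRegular σ) (hσ : 0 < σ)
    (hη : ∀ y, |η y| ≤ 1) {T c : Finset (E d)} (hT : T ∈ S.cutMesh) (hc : c ∈ S.sub T)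
    {B D : ℝ} (hB : ∀ y ∈ c, |piece c w y| ≤ B) (hD0 : 0 ≤ D)
    (hD : ∀ y ∈ T, y ∈ S.unrefinedNodes → |w y| ≤ D) :
    (∀ y ∈ c, |piece c R y| ≤ B + 2 * D) ∧
      ‖grad (piece c R)‖ ≤ ‖grad (piece c w)‖ + (2 * σ + σ ^ 2) * (B + D) / S.H := by
  have hH := hS.H_pos
  obtain ⟨hcc, hcT⟩ := mem_sub.1 hc
  have hcs := isSimplex_cell hcc
  have hTs := isSimplex_cut hT
  have hB0 : 0 ≤ B := by
    obtain ⟨y, hy⟩ := hcs.nonempty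
    exact (abs_nonneg _).trans (hB y hy)
  obtain ⟨z, hz⟩ := hR.coarse_ball T (cut_mem_coarse hT)
  obtain ⟨z', hz'⟩ := cell_ball hR hσ hcc
  have hHσ : 0 < S.H / σ := div_pos hH hσ
  have hdc := hcs.diam_pos hd
  have hdσ : 0 < Metric.diam (simplex c) / σ := div_pos hdc hσ
  set U := affInterp T (fun y => if y ∈ S.unrefinedNodes then η y * w y else 0)
  set U' := affInterp T (fun y => if y ∈ S.unrefinedNodes then w y else 0)
  have hUv : ∀ y ∈ T, |(if y ∈ S.unrefinedNodes then η y * w y else 0)| ≤ D := by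
    intro y hy
    split_ifs with hyu
    · rw [abs_mul]
      exact (mul_le_of_le_one_left (abs_nonneg _) (hη y)).trans (hD y hy hyu)
    · simpa using hD0
  have hUv' : ∀ y ∈ T, |(if y ∈ S.unrefinedNodes then w y else 0)| ≤ D := by
    intro y hy
    split_ifs with hyu
    · exact hD y hy hyu
    · simpa using hD0
  have hU : ∀ p ∈ simplex T, |U p| ≤ D := fun p hp =>
    abs_affine_le U (fun y hy => by rw [hTs.affInterp_vertex _ hy]; exact hUv y hy) hp
  have hU' : ∀ p ∈ simplex T, |U' p| ≤ D := fun p hp =>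
    abs_affine_le U' (fun y hy => by rw [hTs.affInterp_vertex _ hy]; exact hUv' y hy) hp
  have hE : ∀ p ∈ simplex T, |affInterp T η p| ≤ 1 := fun p hp =>
    abs_affine_le _ (fun y hy => by rw [hTs.affInterp_vertex _ hy]; exact hη y) hp
  have gU : ‖grad U‖ ≤ D / (S.H / σ) := norm_grad_le hHσ fun p hp => hU p (hz hp)
  have gU' : ‖grad U'‖ ≤ D / (S.H / σ) := norm_grad_le hHσ fun p hp => hU' p (hz hp)
  have gE : ‖grad (affInterp T η)‖ ≤ 1 / (S.H / σ) := norm_grad_le hHσ fun p hp => hE p (hz hp)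
  have hcv : ∀ y ∈ c, y ∈ simplex T := fun y hy => hcT (vertex_mem_simplex hy)
  have hdiff : ∀ y ∈ c, |(piece c w - U') y| ≤ B + D := fun y hy =>
    (abs_sub _ _).trans (add_le_add (hB y hy) (hU' y (hcv y hy)))
  have e := h.2 T hT c hc
  rw [e]
  constructor
  · intro y hy
    simp only [AffineMap.coe_add, Pi.add_apply, hcs.affInterp_vertex _ hy]
    refine (abs_add_le _ _).trans ?_
    have h1 := hU y (hcv y hy)
    have h2 : |affInterp T η y * (piece c w - U') y| ≤ B + D := by
      rw [abs_mul]
      exact (mul_le_of_le_one_left (abs_nonneg _) (hE y (hcv y hy))).trans (hdiff y hy)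
    linarith
  · have h1 := hcs.norm_grad_interp_mul_le hdσ hz' (fun y hy => hE y (hcv y hy)) gE le_rfl hdiff
    have h2 : ‖grad (piece c w - U')‖ ≤ ‖grad (piece c w)‖ + D / (S.H / σ) := by
      rw [map_sub]; exact (norm_sub_le _ _).trans (add_le_add le_rfl gU')
    rw [map_add]
    -- The diameter of the cell cancels against its inradius, so only the scale `H` of `η` survives.
    have h3 : 1 / (S.H / σ) * Metric.diam (simplex c) * (B + D) / (Metric.diam (simplex c) / σ) =
        σ ^ 2 * (B + D) / S.H := by field_simp
    have h4 : D / (S.H / σ) = σ * D / S.H := by field_simp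
    rw [h3] at h1
    rw [h4] at gU h2
    have h5 : (2 * σ + σ ^ 2) * (B + D) / S.H =
        σ * D / S.H + σ * D / S.H + σ ^ 2 * (B + D) / S.H + 2 * σ * B / S.H := by ring
    have h6 : 0 ≤ 2 * σ * B / S.H := by positivity
    rw [h5]
    calc _ ≤ _ := norm_add_le _ _
      _ ≤ _ := by linarith

lemma exists_node_bound (hS : S.IsSetup) (hR : S.IsRegular σ) (hσ : 0 < σ) (T : Finset (E d))
    {w : E d → ℝ} (hw : S.IsPW w) :
    ∃ D, 0 ≤ D ∧ (∀ y ∈ T, y ∈ S.unrefinedNodes → |w y| ≤ D) ∧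
      unitVol d * (S.H / σ) ^ d * D ^ 2 = 4 ^ (d + 1) * S.patchMass T w := by
  have h5 : 0 < unitVol d * (S.H / σ) ^ d :=
    mul_pos unitVol_pos (pow_pos (div_pos hS.H_pos hσ) d)
  have h0 : 0 ≤ 4 ^ (d + 1) * S.patchMass T w / (unitVol d * (S.H / σ) ^ d) :=
    div_nonneg (mul_nonneg (by positivity) (patchMass_nonneg T w)) h5.le
  refine ⟨Real.sqrt (4 ^ (d + 1) * S.patchMass T w / (unitVol d * (S.H / σ) ^ d)),
    Real.sqrt_nonneg _, fun y hy hyu => Real.abs_le_sqrt ?_, ?_⟩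
  · rw [le_div_iff₀ h5, mul_comm]
    exact node_sq_le hS hR hσ hw hy hyu
  · rw [Real.sq_sqrt h0, mul_div_cancel₀ _ h5.ne']

lemma exists_cell_bound (c : Finset (E d)) (hc : IsSimplex c) (g : E d →ᵃ[ℝ] ℝ) :
    ∃ B, (∀ y ∈ c, |g y| ≤ B) ∧
      volume.real (simplex c) * B ^ 2 ≤ 4 ^ (d + 1) * ∫ p in simplex c, (g p) ^ 2 := by
  obtain ⟨y₀, hy₀, hmax⟩ := c.exists_max_image (fun z => |g z|) hc.nonempty
  refine ⟨|g y₀|, hmax, ?_⟩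
  rw [sq_abs]
  exact vertex_sq_le scalesLike_volume (volume_simplex_ne_top c) g hy₀

lemma sum_volume_mul_le (hS : S.IsSetup) (hR : S.IsRegular σ) (hσ : 0 < σ) {T : Finset (E d)}
    (hT : T ∈ S.cutMesh) {D X : ℝ} (h : unitVol d * (S.H / σ) ^ d * D ^ 2 = X) :
    ∑ c ∈ S.sub T, volume.real (simplex c) * D ^ 2 ≤ σ ^ d * X := by
  have hH := hS.H_pos
  rw [← Finset.sum_mul, ← h]
  calc _ ≤ unitVol d * S.H ^ d * D ^ 2 := by
        gcongr
        exact (sum_volume_sub_le hS T).trans (volume_elem_le hS hR (cut_mem_coarse hT))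
    _ = _ := by rw [div_pow]; field_simp

lemma IsCutoff.mass_le {η w R : E d → ℝ} (h : S.IsCutoff η w R) (hw : S.IsPW w) (hS : S.IsSetup)
    (hd : 1 ≤ d) (hR : S.IsRegular σ) (hσ : 0 < σ)
    (hη : ∀ y, |η y| ≤ 1) {T : Finset (E d)} (hT : T ∈ S.cutMesh) :
    S.mass T R ≤ (2 + 8 * σ ^ d) * 4 ^ (d + 1) * S.patchMass T w := by
  obtain ⟨D, hD0, hD, hDe⟩ := exists_node_bound hS hR hσ T hw
  have h1 : ∀ c ∈ S.sub T, ∫ p in simplex c, (piece c R p) ^ 2 ≤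
      2 * (4 ^ (d + 1) * ∫ p in simplex c, (piece c w p) ^ 2) +
        8 * (volume.real (simplex c) * D ^ 2) := by
    intro c hc
    obtain ⟨B, hB, hBi⟩ := exists_cell_bound c (isSimplex_cell (mem_sub.1 hc).1) (piece c w)
    have h2 := (h.cell_bounds hS hd hR hσ hη hT hc hB hD0 hD).1
    refine (setIntegral_sq_le (volume_simplex_ne_top c) _ h2).trans ?_
    have h3 : (B + 2 * D) ^ 2 ≤ 2 * B ^ 2 + 8 * D ^ 2 := by nlinarith [sq_nonneg (B - 2 * D)]
    have h4 := mul_le_mul_of_nonneg_left h3 (measureReal_nonneg (μ := volume) (s := simplex c))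
    linarith
  have h5 := sum_volume_mul_le hS hR hσ hT hDe
  have h6 := mass_le_patchMass hT w
  calc S.mass T R ≤ _ := Finset.sum_le_sum h1
    _ = 2 * (4 ^ (d + 1) * S.mass T w) + 8 * ∑ c ∈ S.sub T, volume.real (simplex c) * D ^ 2 := by
        rw [Finset.sum_add_distrib, ← Finset.mul_sum, ← Finset.mul_sum, ← Finset.mul_sum]; rfl
    _ ≤ 2 * (4 ^ (d + 1) * S.patchMass T w) + 8 * (σ ^ d * (4 ^ (d + 1) * S.patchMass T w)) := by
        gcongr
    _ = _ := by ring

lemma robin_le_of_abs_le (hS : S.IsSetup) (hd : 1 ≤ d) {c : Finset (E d)} (hc : IsSimplex c)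
    {f g : E d →ᵃ[ℝ] ℝ} (h : ∀ y ∈ c, |f y| ≤ |g y|) :
    ∑ x ∈ S.robinVerts c, ∫ y in simplex (c.erase x), S.κ * f y * f y ∂(μHE[d - 1]) ≤
      4 ^ d * ∑ x ∈ S.robinVerts c, ∫ y in simplex (c.erase x), S.κ * g y * g y ∂(μHE[d - 1]) := by
  rw [Finset.mul_sum]
  refine Finset.sum_le_sum fun x hx => ?_
  have hxc := (Finset.mem_filter.1 hx).1
  have key := setIntegral_sq_le_of_abs_le (scalesLike_hausdorff (d - 1)) (hc.face_nonempty hd hxc)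
    (face_measure_ne_top hc hd hxc) (f := f) (g := g)
    fun y hy => h y (Finset.mem_of_mem_erase hy)
  rw [Nat.sub_add_cancel hd] at key
  simp only [mul_assoc, ← sq]
  rw [integral_const_mul, integral_const_mul, mul_left_comm]
  exact mul_le_mul_of_nonneg_left key hS.κ_nonneg

/-- Stability of the interpolated product in the energy norm. -/
lemma IsCutoff.energy_le {η w : E d → ℝ} {R : S.pw} (h : S.IsCutoff η w R.1) (hw : S.IsPW w)
    (hS : S.IsSetup) (hd : 1 ≤ d) (hR : S.IsRegular σ) (hσ : 0 < σ)
    (hη : ∀ y, |η y| ≤ 1) {T : Finset (E d)} (hT : T ∈ S.cutMesh) :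
    energyForm hS hd T R R ≤ (2 + 4 ^ d) * energyForm hS hd T ⟨w, hw⟩ ⟨w, hw⟩ +
      4 * (2 * σ + σ ^ 2) ^ 2 * (1 + σ ^ d) * 4 ^ (d + 1) * (S.patchMass T w / S.H ^ 2) := by
  have hH := hS.H_pos
  obtain ⟨D, hD0, hD, hDe⟩ := exists_node_bound hS hR hσ T hw
  set A := 4 * (2 * σ + σ ^ 2) ^ 2 / S.H ^ 2 with hA
  have hA0 : 0 ≤ A := by positivity
  have h1 : ∀ c ∈ S.sub T, S.form c (piece c R.1) (piece c R.1) ≤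
      (2 + 4 ^ d) * S.form c (piece c w) (piece c w) +
        A * ((4 ^ (d + 1) * ∫ p in simplex c, (piece c w p) ^ 2) +
          volume.real (simplex c) * D ^ 2) := by
    intro c hc
    have hcs := isSimplex_cell (mem_sub.1 hc).1
    obtain ⟨B, hB, hBi⟩ := exists_cell_bound c hcs (piece c w)
    have h2 := (h.cell_bounds hS hd hR hσ hη hT hc hB hD0 hD).2
    have hB0 : 0 ≤ B := by
      obtain ⟨y, hy⟩ := hcs.nonempty
      exact (abs_nonneg _).trans (hB y hy)
    have hV := measureReal_nonneg (μ := volume) (s := simplex c)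
    have h3 : ‖grad (piece c R.1)‖ ^ 2 ≤ 2 * ‖grad (piece c w)‖ ^ 2 + A * (B ^ 2 + D ^ 2) := by
      set x := (2 * σ + σ ^ 2) * (B + D) / S.H with hx
      have e1 : ‖grad (piece c R.1)‖ ^ 2 ≤ (‖grad (piece c w)‖ + x) ^ 2 := by gcongr
      have e2 : (‖grad (piece c w)‖ + x) ^ 2 ≤ 2 * ‖grad (piece c w)‖ ^ 2 + 2 * x ^ 2 := by
        nlinarith [sq_nonneg (‖grad (piece c w)‖ - x)]
      have e3 : 2 * x ^ 2 = A / 2 * (B + D) ^ 2 := by rw [hx, hA]; field_simp; ring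
      have e4 : (B + D) ^ 2 ≤ 2 * (B ^ 2 + D ^ 2) := by nlinarith [sq_nonneg (B - D)]
      have e5 : A / 2 * (B + D) ^ 2 ≤ A / 2 * (2 * (B ^ 2 + D ^ 2)) := by gcongr
      linarith
    have h4 : volume.real (simplex c) * ‖grad (piece c R.1)‖ ^ 2 ≤
        2 * (volume.real (simplex c) * ‖grad (piece c w)‖ ^ 2) +
          A * ((4 ^ (d + 1) * ∫ p in simplex c, (piece c w p) ^ 2) +
            volume.real (simplex c) * D ^ 2) := by
      have e1 := mul_le_mul_of_nonneg_left h3 hV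
      have e2 := mul_le_mul_of_nonneg_left hBi hA0
      calc _ ≤ _ := e1
        _ = 2 * (volume.real (simplex c) * ‖grad (piece c w)‖ ^ 2) +
          A * (volume.real (simplex c) * B ^ 2) + A * (volume.real (simplex c) * D ^ 2) := by ring
        _ ≤ _ := by linarith
    have h5 : ∑ x ∈ S.robinVerts c,
        ∫ y in simplex (c.erase x), S.κ * piece c R.1 y * piece c R.1 y ∂(μHE[d - 1]) ≤
        4 ^ d * ∑ x ∈ S.robinVerts c,
          ∫ y in simplex (c.erase x), S.κ * piece c w y * piece c w y ∂(μHE[d - 1]) := by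
      -- Elements inside `Ω` have no Robin sides. On the others the vertex values of `R` are those
      -- of `w` times numbers of modulus at most one.
      by_cases hTb : T ∈ S.boundaryLayer 0
      · refine robin_le_of_abs_le hS hd hcs fun y hy => ?_
        rw [h.piece_of_boundary hS hTb hc, hcs.affInterp_vertex _ hy, abs_mul]
        refine mul_le_of_le_one_left (abs_nonneg _) ?_
        refine abs_affine_le _ (fun z hz => ?_) ((mem_sub.1 hc).2 (vertex_mem_simplex hy))
        rw [(isSimplex_cut hT).affInterp_vertex _ hz]; exact hη z
      · rw [robinVerts_eq_empty hS hd hT hc hTb]; simp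
    have h6 := robin_integral_nonneg hS c (piece c w)
    have h7 : 0 ≤ volume.real (simplex c) * ‖grad (piece c w)‖ ^ 2 := by positivity
    simp only [form, real_inner_self_eq_norm_sq]
    have h8 : (0 : ℝ) ≤ 4 ^ d := by positivity
    have h9 := mul_nonneg h8 h7
    linarith
  have h5 := sum_volume_mul_le hS hR hσ hT hDe
  have h6 := mass_le_patchMass hT w
  rw [energyForm_apply, energyForm_apply]
  calc _ ≤ _ := Finset.sum_le_sum h1
    _ = (2 + 4 ^ d) * ∑ c ∈ S.sub T, S.form c (piece c w) (piece c w) +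
        A * (4 ^ (d + 1) * S.mass T w + ∑ c ∈ S.sub T, volume.real (simplex c) * D ^ 2) := by
        rw [Finset.sum_add_distrib, ← Finset.mul_sum, ← Finset.mul_sum, Finset.sum_add_distrib,
          ← Finset.mul_sum]; rfl
    _ ≤ (2 + 4 ^ d) * ∑ c ∈ S.sub T, S.form c (piece c w) (piece c w) +
        A * (4 ^ (d + 1) * S.patchMass T w + σ ^ d * (4 ^ (d + 1) * S.patchMass T w)) := by
        gcongr
    _ = _ := by rw [hA]; ring

end Setting

/-! ### The bubble function of a simplex -/

/-- The smallest barycentric coordinate. -/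
def bubble (T : Finset (E d)) (p : E d) : ℝ :=
  if h : T.Nonempty then T.inf' h fun y => bary T y p else 0

lemma bubble_le {T : Finset (E d)} {y : E d} (hy : y ∈ T) (p : E d) :
    bubble T p ≤ bary T y p := by
  rw [bubble, dif_pos ⟨y, hy⟩]
  exact Finset.inf'_le (fun y => bary T y p) hy

lemma exists_bubble_eq {T : Finset (E d)} (h : T.Nonempty) (p : E d) :
    ∃ y ∈ T, bubble T p = bary T y p := by
  rw [bubble, dif_pos h]
  exact Finset.exists_mem_eq_inf' h fun y => bary T y p

lemma bubble_nonneg {T : Finset (E d)} (h : T.Nonempty) {p : E d} (hp : p ∈ simplex T) :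
    0 ≤ bubble T p := by
  obtain ⟨y, -, he⟩ := exists_bubble_eq h p
  rw [he]; exact bary_nonneg hp y

lemma bubble_le_one {T : Finset (E d)} (h : T.Nonempty) {p : E d} (hp : p ∈ simplex T) :
    bubble T p ≤ 1 := by
  obtain ⟨y, -, he⟩ := exists_bubble_eq h p
  rw [he]; exact bary_le_one hp y

lemma continuous_bubble (T : Finset (E d)) : Continuous (bubble T) := by
  by_cases h : T.Nonempty
  · have : bubble T = fun p => T.inf' h fun y => bary T y p := by
      ext p; rw [bubble, dif_pos h]
    rw [this]
    exact Continuous.finset_inf'_apply h fun y _ => continuous_affine _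
  · have : bubble T = fun _ => 0 := by
      ext p; rw [bubble, dif_neg h]
    rw [this]; exact continuous_const

lemma abs_bubble_sub_le {T : Finset (E d)} (h : T.Nonempty) {L : ℝ}
    (hL : ∀ y ∈ T, ‖grad (bary T y)‖ ≤ L) (p q : E d) :
    |bubble T p - bubble T q| ≤ L * dist p q := by
  have key : ∀ p q : E d, bubble T p - bubble T q ≤ L * dist p q := by
    intro p q
    obtain ⟨y, hy, he⟩ := exists_bubble_eq h q
    have h1 := bubble_le hy p
    have h2 := (le_abs_self _).trans (abs_affine_sub_le (bary T y) p q)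
    have h3 := mul_le_mul_of_nonneg_right (hL y hy) (dist_nonneg (x := p) (y := q))
    linarith
  rw [abs_le]
  have := key q p
  rw [dist_comm] at this
  exact ⟨by linarith, key p q⟩

/-- At the centre of an inscribed ball the barycentric coordinates are bounded below. -/
lemma IsSimplex.bary_center_ge {T : Finset (E d)} (hT : IsSimplex T) (hd : 1 ≤ d) {z : E d}
    {r D : ℝ} (hr : 0 < r) (hball : Metric.ball z r ⊆ simplex T) (hD0 : 0 < D)
    (hD : Metric.diam (simplex T) ≤ D) {y : E d} (hy : y ∈ T) : r / D ≤ bary T y z := by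
  have h1 : ‖grad (bary T y - AffineMap.const ℝ (E d) (bary T y z))‖ ≤ bary T y z / r := by
    refine norm_grad_le (z := z) hr fun p hp => ?_
    -- Nonnegativity at `p` and at its reflection in `z` shows that the coordinate deviates from its
    -- value at `z` by at most that value. This bounds the gradient from above.
    have hp' : z + z - p ∈ Metric.ball z r := by
      rw [Metric.mem_ball, dist_eq_norm] at hp ⊢
      rwa [show z + z - p - z = -(p - z) by abel, norm_neg]
    have e1 := bary_nonneg (hball hp) y
    have e2 := bary_nonneg (hball hp') y
    have e3 := affine_sub (bary T y) (z + z - p) z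
    have e4 := affine_sub (bary T y) p z
    rw [show z + z - p - z = -(p - z) by abel, inner_neg_right, ← e4] at e3
    simp only [AffineMap.coe_sub, Pi.sub_apply, AffineMap.const_apply]
    rw [abs_le]
    constructor <;> linarith
  rw [map_sub, grad_const, sub_zero, le_div_iff₀ hr] at h1
  -- Conversely, the coordinate drops from `1` to `0` between two vertices at distance at most `D`,
  -- which bounds the gradient from below.
  obtain ⟨y', hy', hne⟩ : ∃ y' ∈ T, y' ≠ y := by
    have : 1 < T.card := by rw [hT.1]; omega
    exact Finset.exists_mem_ne this y
  have h2 := abs_affine_sub_le (bary T y) y y'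
  rw [hT.bary_vertex hy hy, hT.bary_vertex hy hy', if_pos rfl, if_neg hne.symm, sub_zero,
    abs_one] at h2
  have h3 : dist y y' ≤ D :=
    (dist_le_diam_simplex (vertex_mem_simplex hy) (vertex_mem_simplex hy')).trans hD
  have h4 : 1 ≤ ‖grad (bary T y)‖ * D :=
    h2.trans (mul_le_mul_of_nonneg_left h3 (norm_nonneg _))
  rw [div_le_iff₀ hD0]
  calc r = 1 * r := (one_mul r).symm
    _ ≤ ‖grad (bary T y)‖ * D * r := by gcongr
    _ = ‖grad (bary T y)‖ * r * D := by ring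
    _ ≤ _ := by gcongr

/-- Weighted by the bubble function, affine functions keep their size in the mean. -/
lemma IsSimplex.integral_bubble_ge {T : Finset (E d)} (hT : IsSimplex T) {z : E d} {σ : ℝ}
    (hσ : 0 < σ) (hz : z ∈ simplex T) (hbary : ∀ y ∈ T, 1 / σ ≤ bary T y z) (g : E d →ᵃ[ℝ] ℝ)
    {m : ℝ} {y : E d} (hy : y ∈ T) (hm : |g y| = m) (hmax : ∀ v ∈ T, |g v| ≤ m) :
    (1 / (4 * σ)) ^ d * volume.real (simplex T) * (m ^ 2 / (16 * σ ^ 3)) ≤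
      ∫ p in simplex T, bubble T p * (g p) ^ 2 := by
  have hσ1 : 1 ≤ σ := by
    have := (hbary y hy).trans (bary_le_one hz y)
    rwa [div_le_one hσ] at this
  have hm0 : 0 ≤ m := hm ▸ abs_nonneg _
  have hys := vertex_mem_simplex hy
  -- The midpoint between `z`, where no coordinate is small, and the vertex `y`, where `|g|` is
  -- maximal, is good for both factors: all coordinates are at least `1/(2σ)` and `|g q| ≥ m/σ`.
  -- Shrinking `T` towards `q` by `1/(4σ)` loses at most half of either bound.
  set q : E d := AffineMap.homothety y (1 / 2 : ℝ) z with hqdef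
  have hq : q ∈ simplex T :=
    homothety_subset_simplex hys (by norm_num) (by norm_num) ⟨z, hz, rfl⟩
  have hgq : ∀ f : E d →ᵃ[ℝ] ℝ, f q = (f y + f z) / 2 := by
    intro f; rw [hqdef, affine_homothety]; ring
  set ρ : ℝ := 1 / (4 * σ) with hρ
  have hρ0 : 0 < ρ := by positivity
  have hρ1 : ρ ≤ 1 / 4 := by
    rw [hρ]; apply one_div_le_one_div_of_le <;> linarith
  set s := 1 / σ with hs
  have hs0 : 0 < s := by positivity
  have hρs : ρ = s / 4 := by rw [hρ, hs]; field_simp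
  have hbq : ∀ v ∈ T, s / 2 ≤ bary T v q := by
    intro v hv
    rw [hgq]
    have := hbary v hv
    have := bary_nonneg hys v
    linarith
  have hgq' : s * m ≤ |g q| := by
    have e1 : g z = bary T y z * g y + ∑ v ∈ T.erase y, bary T v z * g v := by
      rw [hT.affine_eq g z, ← Finset.add_sum_erase T _ hy]
    have e2 : |∑ v ∈ T.erase y, bary T v z * g v| ≤ (1 - bary T y z) * m := by
      refine (Finset.abs_sum_le_sum_abs _ _).trans ?_
      have e3 : ∑ v ∈ T.erase y, bary T v z = 1 - bary T y z := by
        rw [← hT.sum_bary z, ← Finset.add_sum_erase T _ hy]; ring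
      rw [← e3, Finset.sum_mul]
      refine Finset.sum_le_sum fun v hv => ?_
      rw [abs_mul, abs_of_nonneg (bary_nonneg hz v)]
      exact mul_le_mul_of_nonneg_left (hmax v (Finset.mem_of_mem_erase hv)) (bary_nonneg hz v)
    rw [hgq, e1]
    set R := ∑ v ∈ T.erase y, bary T v z * g v
    have e4 : g y + (bary T y z * g y + R) = (1 + bary T y z) * g y + R := by ring
    rw [e4, abs_div, abs_two, le_div_iff₀ two_pos]
    have e5 : |(1 + bary T y z) * g y| = (1 + bary T y z) * m := by
      rw [abs_mul, hm, abs_of_nonneg]; linarith [bary_nonneg hz y]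
    have e6 := abs_sub_abs_le_abs_add ((1 + bary T y z) * g y) R
    rw [e5] at e6
    have e7 := mul_le_mul_of_nonneg_right (hbary y hy) hm0
    linarith
  have hσm : m ^ 2 / (16 * σ ^ 3) = s / 4 * (s * m / 2) ^ 2 := by rw [hs]; field_simp; ring
  rw [hσm]
  refine setIntegral_ge_of_homothety scalesLike_volume (volume_simplex_ne_top T)
    ((continuous_bubble T).mul ((continuous_affine g).pow 2)).continuousOn
    (fun p hp => mul_nonneg (bubble_nonneg hT.nonempty hp) (sq_nonneg _)) hq hρ0
    (hρ1.trans (by norm_num)) fun p hp => ?_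
  have h1 : s / 4 ≤ bubble T (AffineMap.homothety q ρ p) := by
    obtain ⟨v, hv, he⟩ := exists_bubble_eq hT.nonempty (AffineMap.homothety q ρ p)
    rw [he, affine_homothety]
    have e1 := mul_nonneg hρ0.le (bary_nonneg hp v)
    have e2 : 3 / 4 * (s / 2) ≤ (1 - ρ) * bary T v q :=
      mul_le_mul (by linarith) (hbq v hv) (by linarith) (by linarith)
    linarith
  have h2 : s * m / 2 ≤ |g (AffineMap.homothety q ρ p)| := by
    rw [affine_homothety]
    have e1 := abs_sub_abs_le_abs_add ((1 - ρ) * g q) (ρ * g p)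
    have e2 : 3 / 4 * (s * m) ≤ |(1 - ρ) * g q| := by
      rw [abs_mul, abs_of_nonneg (by linarith)]
      exact mul_le_mul (by linarith) hgq' (by positivity) (by linarith)
    have e3 : |ρ * g p| ≤ s / 4 * m := by
      rw [abs_mul, abs_of_pos hρ0, hρs]
      exact mul_le_mul_of_nonneg_left (abs_affine_le g hmax hp) (by linarith)
    linarith
  have h3 : (s * m / 2) ^ 2 ≤ (g (AffineMap.homothety q ρ p)) ^ 2 := by
    rw [← sq_abs (g _)]; gcongr
  exact mul_le_mul h1 h3 (by positivity) (by linarith)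

/-! ### Dimension of the affine functions, for solving square linear systems. -/

instance : Module.Finite ℝ (E d →ᵃ[ℝ] ℝ) := by
  let b : (E d →ᵃ[ℝ] ℝ) →ₗ[ℝ] ((E d →ₗ[ℝ] ℝ) × ℝ) :=
    { toFun := fun g => (g.linear, g 0)
      map_add' := fun f g => rfl
      map_smul' := fun a g => rfl }
  refine Module.Finite.of_injective b fun f g h => ?_
  have h1 : f.linear = g.linear := congrArg Prod.fst h
  have h2 : f 0 = g 0 := congrArg Prod.snd h
  ext p
  rw [f.decomp, g.decomp]
  simp [h1, h2]

lemma IsSimplex.finrank_affine {T : Finset (E d)} (hT : IsSimplex T) :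
    Module.finrank ℝ (E d →ᵃ[ℝ] ℝ) = Module.finrank ℝ (T → ℝ) := by
  let e : (E d →ᵃ[ℝ] ℝ) →ₗ[ℝ] (T → ℝ) :=
    { toFun := fun g y => g y
      map_add' := fun f g => rfl
      map_smul' := fun a g => rfl }
  refine (LinearEquiv.ofBijective e ⟨fun f g h => ?_, fun a => ?_⟩).finrank_eq
  · exact hT.affine_ext fun y hy => congrFun h ⟨y, hy⟩
  · refine ⟨affInterp T fun y => if h : y ∈ T then a ⟨y, h⟩ else 0, ?_⟩
    ext y
    change affInterp T _ (y : E d) = a y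
    rw [hT.affInterp_vertex _ y.2, dif_pos y.2]

namespace Setting

variable {S : Setting d} {σ : ℝ}

/-! ### Bubble functions on the fine mesh. -/

lemma mem_of_node_mem_simplex {y : E d} (hy : y ∈ S.nodes) {T : Finset (E d)}
    (hT : T ∈ S.coarse.elems) (h : y ∈ simplex T) : y ∈ T := by
  obtain ⟨T', hT', hyT'⟩ := Finset.mem_biUnion.1 hy
  change y ∈ T' at hyT'
  by_contra hyT
  have := S.coarse.bary_eq_zero (cut_mem_coarse hT') hT (vertex_mem_simplex hyT') h hyT' hyT
  rw [(isSimplex_cut hT').bary_vertex hyT' hyT', if_pos rfl] at this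
  exact one_ne_zero this

/-- Some vertex of `T` is not a vertex of `T'`, and its coordinate vanishes on common points. Hence
bubbles extend continuously by zero to all other elements. -/
lemma bubble_eq_zero {T T' : Finset (E d)} (hT : T ∈ S.coarse.elems) (hT' : T' ∈ S.coarse.elems)
    (hne : T ≠ T') {p : E d} (hp : p ∈ simplex T) (hp' : p ∈ simplex T') : bubble T p = 0 := by
  have hnot : ¬ T ⊆ T' := fun h =>
    hne (Finset.eq_of_subset_of_card_le h (by rw [S.coarse.card_eq T hT, S.coarse.card_eq T' hT']))
  obtain ⟨y, hy, hy'⟩ := Finset.not_subset.1 hnot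
  refine le_antisymm ?_ (bubble_nonneg (S.coarse.isSimplex hT).nonempty hp)
  rw [← S.coarse.bary_eq_zero hT hT' hp hp' hy hy']
  exact bubble_le hy p

/-- The fine interpolant of the product of an affine function and the bubble function. -/
lemma exists_bubbleFun (hS : S.IsSetup) {T : Finset (E d)} (hT : T ∈ S.boundaryLayer S.k)
    (g : E d →ᵃ[ℝ] ℝ) : ∃ b, S.IsPW b ∧
      (∀ c ∈ S.sub T, piece c b = affInterp c fun y => bubble T y * g y) ∧
      ∀ T' ∈ S.cutMesh, T' ≠ T → ∀ c ∈ S.sub T', piece c b = 0 := by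
  have hTc := cut_mem_coarse (boundaryLayer_subset _ hT)
  set F : E d → ℝ := fun y => if y ∈ simplex T then bubble T y * g y else 0
  have hF : ∀ T' ∈ S.cutMesh, T' ≠ T → ∀ y ∈ simplex T', F y = 0 := by
    intro T' hT' hne y hy
    simp only [F]
    split_ifs with h
    · rw [bubble_eq_zero hTc (cut_mem_coarse hT') hne.symm h hy, zero_mul]
    · rfl
  have hne : ∀ T' ∈ S.unrefined, T' ≠ T := by
    rintro T' hT' rfl; exact (mem_unrefined.1 hT').2 hT
  obtain ⟨b, hb, hbp⟩ := exists_glue hS (fun _ y => F y) (fun _ _ _ _ _ _ _ _ _ _ _ => rfl)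
    (fun c _ T' hT' p _ _ _ y _ hy => hF T' (mem_unrefined.1 hT').1 (hne T' hT') y hy)
    (fun T' hT' y hy => hF T' (mem_unrefined.1 hT').1 (hne T' hT') y (vertex_mem_simplex hy))
  refine ⟨b, hb, fun c hc => ?_, fun T' hT' hT'ne c hc => ?_⟩
  · rw [hbp c (mem_sub.1 hc).1]
    exact affInterp_congr fun y hy => if_pos ((mem_sub.1 hc).2 (vertex_mem_simplex hy))
  · rw [hbp c (mem_sub.1 hc).1]
    refine Finset.sum_eq_zero fun y hy => ?_
    show F y • _ = 0
    rw [hF T' hT' hT'ne y ((mem_sub.1 hc).2 (vertex_mem_simplex hy)), zero_smul]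

lemma integrableOn_affine_mul (c : Finset (E d)) (f g : E d →ᵃ[ℝ] ℝ) :
    IntegrableOn (fun p => f p * g p) (simplex c) :=
  integrableOn_simplex (volume_simplex_ne_top c)
    ((continuous_affine f).mul (continuous_affine g)).continuousOn

/-- The `L²(T)` product of the interpolated bubble multiple of `g` with `q`. -/
def bubbleForm (S : Setting d) (T : Finset (E d)) :
    (E d →ᵃ[ℝ] ℝ) →ₗ[ℝ] (E d →ᵃ[ℝ] ℝ) →ₗ[ℝ] ℝ :=
  LinearMap.mk₂ ℝ (fun g q => ∑ c ∈ S.sub T, ∫ p in simplex c,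
      affInterp c (fun y => bubble T y * g y) p * q p)
    (fun g g' q => by
      rw [← Finset.sum_add_distrib]
      refine Finset.sum_congr rfl fun c _ => ?_
      rw [← integral_add (integrableOn_affine_mul c _ _)
        (integrableOn_affine_mul c _ _)]
      congr 1; ext p
      rw [← add_mul]; congr 1
      simp only [affInterp_apply, ← Finset.sum_add_distrib]
      refine Finset.sum_congr rfl fun y _ => ?_
      simp only [AffineMap.coe_add, Pi.add_apply]; ring)
    (fun a g q => by
      rw [smul_eq_mul, Finset.mul_sum]
      refine Finset.sum_congr rfl fun c _ => ?_
      rw [← integral_const_mul]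
      congr 1; ext p
      rw [← mul_assoc]; congr 1
      simp only [affInterp_apply, Finset.mul_sum]
      refine Finset.sum_congr rfl fun y _ => ?_
      simp only [AffineMap.coe_smul, Pi.smul_apply, smul_eq_mul]; ring)
    (fun g q q' => by
      rw [← Finset.sum_add_distrib]
      refine Finset.sum_congr rfl fun c _ => ?_
      rw [← integral_add (integrableOn_affine_mul c _ _)
        (integrableOn_affine_mul c _ _)]
      congr 1; ext p
      simp only [AffineMap.coe_add, Pi.add_apply]; ring)
    (fun a g q => by
      rw [smul_eq_mul, Finset.mul_sum]
      refine Finset.sum_congr rfl fun c _ => ?_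
      rw [← integral_const_mul]
      congr 1; ext p
      simp only [AffineMap.coe_smul, Pi.smul_apply, smul_eq_mul]; ring)

lemma bubbleForm_apply (T : Finset (E d)) (g q : E d →ᵃ[ℝ] ℝ) :
    S.bubbleForm T g q = ∑ c ∈ S.sub T, ∫ p in simplex c,
      affInterp c (fun y => bubble T y * g y) p * q p := rfl

/-- The `L²(T)` product of affine functions. -/
def massForm (S : Setting d) (T : Finset (E d)) (g : E d →ᵃ[ℝ] ℝ) : (E d →ᵃ[ℝ] ℝ) →ₗ[ℝ] ℝ where
  toFun q := ∑ c ∈ S.sub T, ∫ p in simplex c, g p * q p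
  map_add' q q' := by
    rw [← Finset.sum_add_distrib]
    refine Finset.sum_congr rfl fun c _ => ?_
    rw [← integral_add (integrableOn_affine_mul c _ _)
      (integrableOn_affine_mul c _ _)]
    congr 1; ext p
    simp only [AffineMap.coe_add, Pi.add_apply]; ring
  map_smul' a q := by
    rw [RingHom.id_apply, smul_eq_mul, Finset.mul_sum]
    refine Finset.sum_congr rfl fun c _ => ?_
    rw [← integral_const_mul]
    congr 1; ext p
    simp only [AffineMap.coe_smul, Pi.smul_apply, smul_eq_mul]; ring

/-- The coercivity constant of `bubbleForm`, up to the volume. -/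
def bubbleConst (d : ℕ) (σ : ℝ) : ℝ := (1 / (4 * σ)) ^ d / (16 * σ ^ 3) / 2

lemma bubbleConst_pos (hσ : 0 < σ) : 0 < bubbleConst d σ := by
  unfold bubbleConst; positivity

lemma norm_grad_bary_le (hS : S.IsSetup) (hR : S.IsRegular σ) (hσ : 0 < σ) {T : Finset (E d)}
    (hT : T ∈ S.coarse.elems) (y : E d) : ‖grad (bary T y)‖ ≤ σ / S.H := by
  obtain ⟨z, hz⟩ := hR.coarse_ball T hT
  have hr := div_pos hS.H_pos hσ
  have := norm_grad_le (g := bary T y) (B := 1) hr fun p hp => by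
    rw [abs_of_nonneg (bary_nonneg (hz hp) y)]; exact bary_le_one (hz hp) y
  rwa [one_div_div] at this

lemma norm_grad_affine_le (hS : S.IsSetup) (hR : S.IsRegular σ) (hσ : 0 < σ) {T : Finset (E d)}
    (hT : T ∈ S.coarse.elems) {g : E d →ᵃ[ℝ] ℝ} {m : ℝ} (hmax : ∀ v ∈ T, |g v| ≤ m) :
    ‖grad g‖ ≤ σ * m / S.H := by
  obtain ⟨z, hz⟩ := hR.coarse_ball T hT
  have hr := div_pos hS.H_pos hσ
  have := norm_grad_le (g := g) (B := m) hr fun p hp => abs_affine_le g hmax (hz hp)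
  rwa [div_div_eq_mul_div, mul_comm m] at this

lemma abs_bubble_mul_sub_le (hS : S.IsSetup) (hR : S.IsRegular σ) (hσ : 0 < σ) {T : Finset (E d)}
    (hT : T ∈ S.coarse.elems) {g : E d →ᵃ[ℝ] ℝ} {m : ℝ} (hmax : ∀ v ∈ T, |g v| ≤ m) {p q : E d}
    (hp : p ∈ simplex T) (hq : q ∈ simplex T) :
    |bubble T p * g p - bubble T q * g q| ≤ 2 * σ * m / S.H * dist p q := by
  have hH := hS.H_pos
  have hTn := (S.coarse.isSimplex hT).nonempty
  have e1 := abs_bubble_sub_le hTn (fun y _ => norm_grad_bary_le hS hR hσ hT y) p q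
  have e2 := abs_affine_sub_le g p q
  have e3 := norm_grad_affine_le hS hR hσ hT hmax
  have e4 : bubble T p * g p - bubble T q * g q =
      (bubble T p - bubble T q) * g p + bubble T q * (g p - g q) := by ring
  rw [e4]
  refine (abs_add_le _ _).trans ?_
  rw [abs_mul, abs_mul, abs_of_nonneg (bubble_nonneg hTn hq)]
  have f1 : |bubble T p - bubble T q| * |g p| ≤ σ / S.H * dist p q * m :=
    mul_le_mul e1 (abs_affine_le g hmax hp) (abs_nonneg _) (by positivity)
  have f2 : bubble T q * |g p - g q| ≤ 1 * (σ * m / S.H * dist p q) :=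
    mul_le_mul (bubble_le_one hTn hq)
      (e2.trans (mul_le_mul_of_nonneg_right e3 dist_nonneg)) (abs_nonneg _) zero_le_one
  calc _ ≤ σ / S.H * dist p q * m + 1 * (σ * m / S.H * dist p q) := add_le_add f1 f2
    _ = _ := by ring

lemma region_singleton {T : Finset (E d)} (hTΩ : simplex T ⊆ S.Ω) :
    S.region {T} = interior (simplex T) := by
  simp [region, Set.inter_eq_left.2 hTΩ]

lemma sum_setIntegral_sub (hS : S.IsSetup) {T : Finset (E d)} (hT : T ∈ S.interiorElems)
    {f : E d → ℝ} (hf : Continuous f) :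
    ∑ c ∈ S.sub T, ∫ p in simplex c, f p = ∫ p in simplex T, f p := by
  obtain ⟨hTc, hTΩ⟩ := mem_interiorElems.1 hT
  have := (setIntegral_region_of_eqOn hS (A := {T}) (by simpa using hTc) (f := f)
    (F := fun _ => f) (fun c => hf.continuousOn) fun _ _ _ _ _ _ => rfl).2
  rw [Finset.sum_singleton] at this
  rw [← this, region_singleton hTΩ, setIntegral_interior]

lemma sum_volume_sub_eq (hS : S.IsSetup) {T : Finset (E d)} (hT : T ∈ S.interiorElems) :
    ∑ c ∈ S.sub T, volume.real (simplex c) = volume.real (simplex T) := by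
  have := sum_setIntegral_sub hS hT (f := fun _ => 1) continuous_const
  simpa using this

/-- The exact bubble gives twice the claimed bound. Bubble times `g` is Lipschitz with constant `2 σ
m / H`, so on cells of diameter at most `θ H`, with `θ` the fraction in `hθ`, its interpolant
differs by at most `bubbleConst d σ * m`. The error consumes only half of the bound. -/
lemma bubbleForm_coercive (hS : S.IsSetup) (hd : 1 ≤ d) (hR : S.IsRegular σ) (hσ : 0 < σ)
    {T : Finset (E d)} (hT : T ∈ S.interiorElems)
    (hθ : ∀ c ∈ S.sub T, Metric.diam (simplex c) ≤ bubbleConst d σ / (2 * σ) * S.H)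
    (g : E d →ᵃ[ℝ] ℝ) {m : ℝ} {y : E d} (hy : y ∈ T) (hm : |g y| = m)
    (hmax : ∀ v ∈ T, |g v| ≤ m) :
    bubbleConst d σ * volume.real (simplex T) * m ^ 2 ≤ S.bubbleForm T g g := by
  have hH := hS.H_pos
  obtain ⟨hTc, hTΩ⟩ := mem_interiorElems.1 hT
  have hTe := cut_mem_coarse hTc
  have hTs := isSimplex_cut hTc
  have hm0 : 0 ≤ m := hm ▸ abs_nonneg _
  obtain ⟨z, hz⟩ := hR.coarse_ball T hTe
  have hHσ : 0 < S.H / σ := div_pos hH hσ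
  have hbary : ∀ v ∈ T, 1 / σ ≤ bary T v z := by
    intro v hv
    have := hTs.bary_center_ge hd hHσ hz hH (hR.coarse_diam T hTe) hv
    rwa [div_div, mul_comm, ← div_div, div_self hH.ne'] at this
  have h1 := hTs.integral_bubble_ge hσ (hz (Metric.mem_ball_self hHσ)) hbary g hy hm hmax
  rw [← sum_setIntegral_sub hS hT (f := fun p => bubble T p * (g p) ^ 2)
    ((continuous_bubble T).mul ((continuous_affine g).pow 2))] at h1
  have h2 : ∀ c ∈ S.sub T, (∫ p in simplex c, bubble T p * (g p) ^ 2) -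
      bubbleConst d σ * m ^ 2 * volume.real (simplex c) ≤
      ∫ p in simplex c, affInterp c (fun y => bubble T y * g y) p * g p := by
    intro c hc
    obtain ⟨hcc, hcT⟩ := mem_sub.1 hc
    have hcs := isSimplex_cell hcc
    have i1 : IntegrableOn (fun p => bubble T p * (g p) ^ 2) (simplex c) :=
      integrableOn_simplex (volume_simplex_ne_top c)
      ((continuous_bubble T).mul ((continuous_affine g).pow 2)).continuousOn
    have i2 := integrableOn_affine_mul c (affInterp c fun y => bubble T y * g y) g
    rw [sub_le_iff_le_add, ← sub_le_iff_le_add']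
    change (∫ p in simplex c, bubble T p * (g p) ^ 2) -
      (∫ p in simplex c, affInterp c (fun y => bubble T y * g y) p * g p) ≤ _
    rw [← integral_sub i1 i2]
    have hmon := norm_setIntegral_le_of_norm_le_const (C := bubbleConst d σ * m ^ 2)
      (f := fun p => bubble T p * (g p) ^ 2 - affInterp c (fun y => bubble T y * g y) p * g p)
      (volume_simplex_ne_top c).lt_top fun p hp => by
        have e1 : |bubble T p * g p - affInterp c (fun y => bubble T y * g y) p| ≤
            bubbleConst d σ * m := by
          have e2 : bubble T p * g p - affInterp c (fun y => bubble T y * g y) p =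
              (AffineMap.const ℝ (E d) (bubble T p * g p) -
                affInterp c (fun y => bubble T y * g y)) p := by simp
          rw [e2]
          refine abs_affine_le _ (fun v hv => ?_) hp
          simp only [AffineMap.coe_sub, Pi.sub_apply, AffineMap.const_apply,
            hcs.affInterp_vertex _ hv]
          have hvs := vertex_mem_simplex hv
          refine (abs_bubble_mul_sub_le hS hR hσ hTe hmax (hcT hp) (hcT hvs)).trans ?_
          have e3 := (dist_le_diam_simplex hp hvs).trans (hθ c hc)
          calc _ ≤ 2 * σ * m / S.H * (bubbleConst d σ / (2 * σ) * S.H) := by gcongr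
            _ = _ := by field_simp
        have e4 : bubble T p * (g p) ^ 2 - affInterp c (fun y => bubble T y * g y) p * g p =
            (bubble T p * g p - affInterp c (fun y => bubble T y * g y) p) * g p := by ring
        rw [e4, Real.norm_eq_abs, abs_mul]
        calc _ ≤ bubbleConst d σ * m * m :=
              mul_le_mul e1 (abs_affine_le g hmax (hcT hp)) (abs_nonneg _)
                (mul_nonneg (bubbleConst_pos hσ).le hm0)
          _ = _ := by ring
    exact (le_abs_self _).trans hmon
  have h3 := Finset.sum_le_sum h2
  rw [Finset.sum_sub_distrib, ← Finset.mul_sum, sum_volume_sub_eq hS hT] at h3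
  rw [bubbleForm_apply]
  refine le_trans ?_ h3
  have h4 : (1 / (4 * σ)) ^ d * volume.real (simplex T) * (m ^ 2 / (16 * σ ^ 3)) =
      2 * (bubbleConst d σ * m ^ 2 * volume.real (simplex T)) := by
    rw [bubbleConst]; ring
  rw [h4] at h1
  linarith

end Setting

namespace Setting

variable {S : Setting d} {σ : ℝ}

/-! ### Functions dual to the local projections -/

lemma memLp_indicator_affine (T : Finset (E d)) (g : E d →ᵃ[ℝ] ℝ) (U : Set (E d)) :
    MemLp ((simplex T).indicator g) 2 (volume.restrict U) := by
  rw [memLp_indicator_iff_restrict (measurableSet_simplex T)]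
  have hfin : IsFiniteMeasure ((volume.restrict U).restrict (simplex T)) :=
    isFiniteMeasure_restrict.2 (ne_top_of_le_ne_top (volume_simplex_ne_top T)
      (Measure.restrict_apply_le U _))
  obtain ⟨C, hC⟩ :=
    (isCompact_simplex T).exists_bound_of_continuousOn (continuous_affine g).continuousOn
  exact MemLp.of_bound (continuous_affine g).aestronglyMeasurable C
    ((ae_restrict_iff' (measurableSet_simplex T)).2 (ae_of_all _ hC))

lemma φ_node {x y : E d} (hy : y ∈ S.nodes) : S.φ x y = if y = x then 1 else 0 := by
  obtain ⟨T, hT, hyT⟩ := Finset.mem_biUnion.1 hy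
  change y ∈ T at hyT
  rw [φ_eq (cut_mem_coarse hT) (vertex_mem_simplex hyT)]
  by_cases hx : x ∈ T
  · rw [(isSimplex_cut hT).bary_vertex hx hyT]
    simp only [eq_comm]
  · rw [bary_of_notMem hx, if_neg (fun h : y = x => hx (h ▸ hyT))]; rfl

/-- The energy of a function with small gradients and without Robin boundary. -/
lemma sum_volume_grad_le (hS : S.IsSetup) (hR : S.IsRegular σ) {T : Finset (E d)}
    (hT : T ∈ S.cutMesh) {f : Finset (E d) → E d →ᵃ[ℝ] ℝ} {B : ℝ}
    (hB : ∀ c ∈ S.sub T, ‖grad (f c)‖ ≤ B / S.H) :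
    (∑ c ∈ S.sub T, volume.real (simplex c) * inner ℝ (grad (f c)) (grad (f c))) * S.H ^ 2 ≤
      unitVol d * B ^ 2 * S.H ^ d := by
  have hH := hS.H_pos
  have h1 : ∑ c ∈ S.sub T, volume.real (simplex c) * inner ℝ (grad (f c)) (grad (f c)) ≤
      ∑ c ∈ S.sub T, volume.real (simplex c) * (B / S.H) ^ 2 := by
    refine Finset.sum_le_sum fun c hc => ?_
    rw [real_inner_self_eq_norm_sq]
    have := hB c hc
    gcongr
  rw [← Finset.sum_mul] at h1
  have h2 := (sum_volume_sub_le hS T).trans (volume_elem_le hS hR (cut_mem_coarse hT))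
  calc _ ≤ unitVol d * S.H ^ d * (B / S.H) ^ 2 * S.H ^ 2 := by
        gcongr
        exact h1.trans (by gcongr)
    _ = _ := by field_simp

/-- The local projections reproduce coarse functions, so `φ_x` is dual to them. Its gradient is at
most `σ / H`, and the Robin part is where `K` enters. -/
lemma exists_dual_coarse (hS : S.IsSetup) (hd : 1 ≤ d) (hR : S.IsRegular σ) (hσ : 0 < σ) {K : ℝ}
    (hK : ∀ T ∈ S.cutMesh, S.κ * S.robinArea T * S.H ^ 2 ≤ K * S.H ^ d)
    {x : E d} (hx : x ∈ S.interiorNodes)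
    (h0 : ∀ t ∈ S.fine.elems, ∀ y ∈ t, simplex (t.erase y) ⊆ S.ΓD →
      ∀ p ∈ simplex (t.erase y), S.φ x p = 0) :
    ∃ b : S.pw, S.ZeroOnD b.1 ∧
      (∀ y ∈ S.interiorNodes, S.projValue y b.1 = if y = x then 1 else 0) ∧
      (∀ T ∈ S.cutMesh, x ∉ T → ∀ c ∈ S.sub T, piece c b.1 = 0) ∧
      ∀ T ∈ S.cutMesh, energyForm hS hd T b b * S.H ^ 2 ≤
        (unitVol d * σ ^ 2 + |K|) * S.H ^ d := by
  have hH := hS.H_pos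
  have hφ := φ_mem_coarseSpace (S := S) (interiorNodes_subset hx)
  have hb := isPW_of_mem_coarseSpace hS hφ
  refine ⟨⟨S.φ x, hb⟩, fun t ht y hy hface p hp => ?_, fun y hy => ?_, fun T hT hxT c hc => ?_,
    fun T hT => ?_⟩
  · have hpt := face_subset _ _ hp
    obtain ⟨T, hT, htT, -⟩ := exists_parent hS (fine_mem_cells ht)
    rw [trace_eq hS ht hb hpt, piece_φ hS hT (mem_sub.2 ⟨fine_mem_cells ht, htT⟩),
      ← φ_eq (cut_mem_coarse hT) (htT hpt)]
    exact h0 t ht y hy hface p hp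
  · rw [projValue_coarse hS hR hσ hy hφ, φ_node (interiorNodes_subset hy)]
  · rw [piece_φ hS hT hc, bary_of_notMem hxT]
  · have e1 : energyForm hS hd T ⟨S.φ x, hb⟩ ⟨S.φ x, hb⟩ =
        (∑ c ∈ S.sub T, volume.real (simplex c) *
          inner ℝ (grad (bary T x)) (grad (bary T x))) +
        ∑ c ∈ S.sub T, ∑ z ∈ S.robinVerts c,
          ∫ y in simplex (c.erase z), S.κ * bary T x y * bary T x y ∂(μHE[d - 1]) := by
      rw [energyForm_apply, ← Finset.sum_add_distrib]
      refine Finset.sum_congr rfl fun c hc => ?_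
      simp only [piece_φ hS hT hc, form]
    have e2 := sum_volume_grad_le hS hR hT (f := fun _ => bary T x)
      fun c _ => norm_grad_bary_le hS hR hσ (cut_mem_coarse hT) x
    have e3 : (∑ c ∈ S.sub T, ∑ z ∈ S.robinVerts c,
        ∫ y in simplex (c.erase z), S.κ * bary T x y * bary T x y ∂(μHE[d - 1])) * S.H ^ 2 ≤
        |K| * S.H ^ d := by
      by_cases hTb : T ∈ S.boundaryLayer 0
      · have f1 : S.sub T = S.fine.elems.filter fun t => simplex t ⊆ simplex T := by
          ext c
          rw [Finset.mem_filter]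
          constructor
          · exact fun hc => ⟨fine_of_mem_sub hS (boundaryLayer_mono (Nat.zero_le _) hTb) hc,
              (mem_sub.1 hc).2⟩
          · exact fun hc => mem_sub.2 ⟨fine_mem_cells hc.1, hc.2⟩
        have f2 : ∑ c ∈ S.sub T, ∑ z ∈ S.robinVerts c,
            ∫ y in simplex (c.erase z), S.κ * bary T x y * bary T x y ∂(μHE[d - 1]) ≤
            S.κ * S.robinArea T := by
          rw [robinArea, ← f1, Finset.mul_sum]
          refine Finset.sum_le_sum fun c hc => ?_
          rw [Finset.mul_sum]
          refine Finset.sum_le_sum fun z hz => ?_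
          have f3 := norm_setIntegral_le_of_norm_le_const (μ := μHE[d - 1]) (C := S.κ)
            (f := fun y => S.κ * bary T x y * bary T x y) (s := simplex (c.erase z))
            (face_measure_ne_top (isSimplex_cell (mem_sub.1 hc).1) hd
              (Finset.mem_filter.1 hz).1).lt_top fun p hp => by
                have hpT := (mem_sub.1 hc).2 (face_subset _ _ hp)
                have g1 := bary_nonneg hpT x
                have g2 := bary_le_one hpT x
                have g3 := hS.κ_nonneg
                rw [Real.norm_eq_abs, abs_of_nonneg (by positivity), mul_assoc]
                exact mul_le_of_le_one_right g3 (mul_le_one₀ g2 g1 g2)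
          exact (le_abs_self _).trans f3
        calc _ ≤ S.κ * S.robinArea T * S.H ^ 2 := by gcongr
          _ ≤ K * S.H ^ d := hK T hT
          _ ≤ _ := by gcongr; exact le_abs_self K
      · rw [Finset.sum_eq_zero fun c hc => by
          rw [robinVerts_eq_empty hS hd hT hc hTb, Finset.sum_empty], zero_mul]
        positivity
    rw [e1, add_mul, add_mul]
    exact add_le_add e2 e3

/-- A function supported in `T` with prescribed local projections. -/
lemma exists_affine_projValue (hS : S.IsSetup) (hR : S.IsRegular σ) (hσ : 0 < σ)
    {T : Finset (E d)} (hT : T ∈ S.interiorElems) {x : E d} {Λ : ℝ}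
    (hΛ : ∀ (g : E d →ᵃ[ℝ] ℝ) (δ : ℝ),
      (∀ y ∈ T, |S.projValue y ((simplex T).indicator g)| ≤ δ) → ∀ p ∈ simplex T, |g p| ≤ Λ * δ) :
    ∃ g : E d →ᵃ[ℝ] ℝ,
      (∀ y ∈ T, S.projValue y ((simplex T).indicator g) = if y = x then 1 else 0) ∧
      ∀ p ∈ simplex T, |g p| ≤ |Λ| := by
  have hTs := isSimplex_cut (mem_interiorElems.1 hT).1
  let e : (E d →ᵃ[ℝ] ℝ) →ₗ[ℝ] (T → ℝ) :=
    { toFun := fun g y => S.projValue y ((simplex T).indicator g)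
      map_add' := fun f g => by
        ext y
        change S.projValue y ((simplex T).indicator (f + g : E d → ℝ)) = _
        rw [Set.indicator_add']
        exact projValue_add hS hR hσ (mem_interiorNodes hT y.2)
          (memLp_indicator_affine T f _) (memLp_indicator_affine T g _)
      map_smul' := fun a g => by
        ext y
        change S.projValue y ((simplex T).indicator (a • g : E d → ℝ)) = _
        have : (simplex T).indicator (a • g : E d → ℝ) = a • (simplex T).indicator g :=
          Set.indicator_const_smul (simplex T) a g
        rw [this]
        exact projValue_smul hS hR hσ (mem_interiorNodes hT y.2) (memLp_indicator_affine T g _) a }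
  -- Nondegeneracy with `δ = 0` gives injectivity of a map between spaces of equal dimension; with
  -- `δ = 1` it bounds the preimage of the unit vector below.
  have hinj : Function.Injective e := by
    rw [← LinearMap.ker_eq_bot, LinearMap.ker_eq_bot']
    intro g hg
    refine hTs.affine_ext fun y hy => ?_
    have := hΛ g 0 (fun z hz => by
      have : S.projValue z ((simplex T).indicator g) = 0 := congrFun hg ⟨z, hz⟩
      rw [this, abs_zero]) y (vertex_mem_simplex hy)
    rw [mul_zero] at this
    exact abs_nonpos_iff.1 this
  obtain ⟨g, hg⟩ := (LinearMap.injective_iff_surjective_of_finrank_eq_finrank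
    hTs.finrank_affine).1 hinj fun y => if (y : E d) = x then 1 else 0
  have hg' : ∀ y ∈ T, S.projValue y ((simplex T).indicator g) = if y = x then 1 else 0 :=
    fun y hy => congrFun hg ⟨y, hy⟩
  refine ⟨g, hg', fun p hp => ?_⟩
  have := hΛ g 1 (fun y hy => by rw [hg' y hy]; split_ifs <;> simp) p hp
  rw [mul_one] at this
  exact this.trans (le_abs_self _)

/-- The weighted bubble with the same coarse moments as the affine function `g` on `T`. -/
lemma exists_bubbleForm_eq (hS : S.IsSetup) (hd : 1 ≤ d) (hR : S.IsRegular σ) (hσ : 0 < σ)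
    {T : Finset (E d)} (hT : T ∈ S.interiorElems)
    (hθ : ∀ c ∈ S.sub T, Metric.diam (simplex c) ≤ bubbleConst d σ / (2 * σ) * S.H)
    {g : E d →ᵃ[ℝ] ℝ} {B : ℝ} (hB : ∀ p ∈ simplex T, |g p| ≤ B) :
    ∃ g' : E d →ᵃ[ℝ] ℝ, (∀ q, S.bubbleForm T g' q = S.massForm T g q) ∧
      ∀ y ∈ T, |g' y| ≤ B / bubbleConst d σ := by
  obtain ⟨hTc, hTΩ⟩ := mem_interiorElems.1 hT
  have hTs := isSimplex_cut hTc
  have hc0 := bubbleConst_pos (d := d) hσ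
  have hvol : 0 < volume.real (simplex T) :=
    (mul_pos unitVol_pos (pow_pos (div_pos hS.H_pos hσ) d)).trans_le
      (volume_elem_ge hS hR hσ (cut_mem_coarse hTc))
  have hmax : ∀ f : E d →ᵃ[ℝ] ℝ, ∃ y ∈ T, ∀ v ∈ T, |f v| ≤ |f y| := fun f =>
    T.exists_max_image (fun z => |f z|) hTs.nonempty
  -- Coercivity makes the moment problem uniquely solvable, as the affine functions and their dual
  -- have the same dimension.
  have hinj : Function.Injective (S.bubbleForm T) := by
    rw [← LinearMap.ker_eq_bot, LinearMap.ker_eq_bot']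
    intro f hf
    obtain ⟨y, hy, hm⟩ := hmax f
    have h1 := bubbleForm_coercive hS hd hR hσ hT hθ f hy rfl hm
    rw [hf, LinearMap.zero_apply] at h1
    have h2 : |f y| = 0 := by
      by_contra hne
      have : 0 < |f y| := lt_of_le_of_ne (abs_nonneg _) (Ne.symm hne)
      exact absurd h1 (not_le.2 (by positivity))
    exact hTs.affine_ext fun v hv => abs_nonpos_iff.1 (h2 ▸ hm v hv)
  obtain ⟨g', hg'⟩ := (LinearMap.injective_iff_surjective_of_finrank_eq_finrank
    (Subspace.dual_finrank_eq (K := ℝ) (V := E d →ᵃ[ℝ] ℝ)).symm).1 hinj (S.massForm T g)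
  have hq : ∀ q, S.bubbleForm T g' q = S.massForm T g q := fun q => by rw [hg']
  refine ⟨g', hq, ?_⟩
  obtain ⟨y, hy, hm⟩ := hmax g'
  have h1 := bubbleForm_coercive hS hd hR hσ hT hθ g' hy rfl hm
  rw [hq] at h1
  -- Testing with `g'` itself, coercivity gives a quadratic lower bound in the maximum of `|g'|` and
  -- this gives a linear upper bound. The volume of `T` cancels.
  have h2 : S.massForm T g g' ≤ B * |g' y| * volume.real (simplex T) := by
    rw [← sum_volume_sub_eq hS hT, Finset.mul_sum]
    refine Finset.sum_le_sum fun c hc => ?_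
    have hcT := (mem_sub.1 hc).2
    have := norm_setIntegral_le_of_norm_le_const (μ := volume) (C := B * |g' y|)
      (f := fun p => g p * g' p) (s := simplex c) (volume_simplex_ne_top c).lt_top fun p hp => by
        rw [Real.norm_eq_abs, abs_mul]
        exact mul_le_mul (hB p (hcT hp)) (abs_affine_le g' hm (hcT hp)) (abs_nonneg _)
          ((abs_nonneg _).trans (hB p (hcT hp)))
    exact (le_abs_self _).trans this
  refine fun v hv => (hm v hv).trans ?_
  rw [le_div_iff₀ hc0]
  by_contra! hcon
  have hB0 : 0 ≤ B := (abs_nonneg _).trans (hB y (vertex_mem_simplex hy))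
  have hm0 : 0 < |g' y| := by
    by_contra h
    have : |g' y| = 0 := le_antisymm (not_lt.1 h) (abs_nonneg _)
    rw [this, zero_mul] at hcon; linarith
  have h3 := mul_lt_mul_of_pos_right hcon (mul_pos hm0 hvol)
  have h4 := h1.trans h2
  nlinarith

/-- A local projection sees a function only through its moments against coarse functions. On `T`
those of `b` equal those of `g`, so at the vertices of `T` the projections of `b` are the prescribed
ones of `g` cut off to `T`. At any other interior node the patch does not contain `T`, and `b` is
zero there. Since `T` lies inside `Ω`, `b` meets neither boundary part. -/
lemma exists_dual_bubble (hS : S.IsSetup) (hd : 1 ≤ d) (hR : S.IsRegular σ) (hσ : 0 < σ)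
    {T : Finset (E d)} (hT : T ∈ S.interiorElems) (hTk : T ∈ S.boundaryLayer S.k) {x : E d}
    (hxT : x ∈ T)
    (hθ : ∀ c ∈ S.sub T, Metric.diam (simplex c) ≤ bubbleConst d σ / (2 * σ) * S.H) {Λ : ℝ}
    (hΛ : ∀ (g : E d →ᵃ[ℝ] ℝ) (δ : ℝ),
      (∀ y ∈ T, |S.projValue y ((simplex T).indicator g)| ≤ δ) → ∀ p ∈ simplex T, |g p| ≤ Λ * δ) :
    ∃ b : S.pw, S.ZeroOnD b.1 ∧
      (∀ y ∈ S.interiorNodes, S.projValue y b.1 = if y = x then 1 else 0) ∧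
      (∀ T' ∈ S.cutMesh, x ∉ T' → ∀ c ∈ S.sub T', piece c b.1 = 0) ∧
      ∀ T' ∈ S.cutMesh, energyForm hS hd T' b b * S.H ^ 2 ≤
        unitVol d * (2 * σ ^ 2 * (|Λ| / bubbleConst d σ)) ^ 2 * S.H ^ d := by
  have hH := hS.H_pos
  obtain ⟨hTc, hTΩ⟩ := mem_interiorElems.1 hT
  obtain ⟨g, hg, hgΛ⟩ := exists_affine_projValue hS hR hσ hT (x := x) hΛ
  obtain ⟨g', hg', hgb⟩ := exists_bubbleForm_eq hS hd hR hσ hT hθ hgΛ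
  obtain ⟨b, hb, hbT, hb0⟩ := exists_bubbleFun hS hTk g'
  set m := |Λ| / bubbleConst d σ with hm
  have hm0 : 0 ≤ m := div_nonneg (abs_nonneg _) (bubbleConst_pos hσ).le
  have hTb : T ∉ S.boundaryLayer 0 := fun h => (Finset.mem_filter.1 h).2 hTΩ
  have hbw : ∀ y : E d, ∀ w ∈ S.coarseSpace, ∫ p in S.nodePatch y 0, b p * w p =
      ∑ T' ∈ S.nodeLayer y 0, ∑ c ∈ S.sub T', ∫ p in simplex c, piece c b p * piece c w p := by
    intro y w hw
    have hwp := isPW_of_mem_coarseSpace hS hw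
    exact (setIntegral_region_of_eqOn hS (nodeLayer_subset y 0)
      (F := fun c p => piece c b p * piece c w p)
      (fun c => ((continuous_affine _).mul (continuous_affine _)).continuousOn)
      fun T' _ c hc p hp => by
        simp only [hb.eqOn_interior hS (mem_sub.1 hc).1 hp,
          hwp.eqOn_interior hS (mem_sub.1 hc).1 hp]).2
  have hb0' : ∀ w : E d → ℝ, ∀ T' ∈ S.cutMesh, T' ≠ T →
      ∑ c ∈ S.sub T', ∫ p in simplex c, piece c b p * piece c w p = 0 := by
    intro w T' hT' hne
    exact Finset.sum_eq_zero fun c hc => by simp [hb0 T' hT' hne c hc]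
  refine ⟨⟨b, hb⟩, fun t ht y hy hface p hp => ?_, fun y hy => ?_, fun T' hT' hxT' c hc => ?_,
    fun T' hT' => ?_⟩
  · obtain ⟨T', hT', htT', -⟩ := exists_parent hS (fine_mem_cells ht)
    have htc := mem_sub.2 ⟨fine_mem_cells ht, htT'⟩
    have hT'b := mem_boundaryLayer_of_face hS hd hT' htc hy (hface.trans (dirichlet_subset hS))
    have hne : T' ≠ T := fun h => hTb (h ▸ hT'b)
    rw [trace_eq hS ht hb (face_subset _ _ hp), hb0 T' hT' hne t htc]; rfl
  · by_cases hyT : y ∈ T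
    · rw [← hg y hyT]
      refine projValue_congr fun w hw => ?_
      rw [hbw y w hw]
      have hwp := isPW_of_mem_coarseSpace hS hw
      have key : ∀ T' ∈ S.nodeLayer y 0, ∀ c ∈ S.sub T',
          Set.EqOn (fun p => (simplex T).indicator g p * w p)
            (fun p => (if c ∈ S.sub T then g p else 0) * piece c w p) (interior (simplex c)) := by
        intro T' hT' c hc p hp
        obtain ⟨hcc, hcT'⟩ := mem_sub.1 hc
        have hT'c := nodeLayer_subset y 0 hT'
        simp only [hwp.eqOn_interior hS hcc hp]
        congr 1
        by_cases hne : T' = T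
        · subst hne
          rw [if_pos hc, Set.indicator_of_mem (hcT' (interior_subset hp))]
        · rw [if_neg fun h => hne (parent_unique hcc (cut_mem_coarse hT'c) (cut_mem_coarse hTc)
            hcT' (mem_sub.1 h).2), Set.indicator_of_notMem]
          exact Set.disjoint_left.1 (S.coarse.interior_disjoint (cut_mem_coarse hT'c)
            (cut_mem_coarse hTc) hne) (interior_mono hcT' hp)
      have h2 := (setIntegral_region_of_eqOn hS (nodeLayer_subset y 0)
        (F := fun c p => (if c ∈ S.sub T then g p else 0) * piece c w p)
        (fun c => by
          refine ContinuousOn.mul ?_ (continuous_affine _).continuousOn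
          split_ifs
          · exact (continuous_affine g).continuousOn
          · exact continuousOn_const) key).2
      refine Eq.trans ?_ h2.symm
      refine Finset.sum_congr rfl fun T' hT' => ?_
      have hT'c := nodeLayer_subset y 0 hT'
      by_cases hne : T' = T
      · subst hne
        obtain ⟨q, hq⟩ := exists_affine_of_mem_coarseSpace hw (cut_mem_coarse hT'c)
        have hwq : ∀ c ∈ S.sub T', piece c w = q := fun c hc =>
          piece_eq hS (mem_sub.1 hc).1 (hq.mono (Set.inter_subset_left.trans (mem_sub.1 hc).2))
        have e1 := hg' q
        rw [bubbleForm_apply] at e1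
        change _ = ∑ c ∈ S.sub T', ∫ p in simplex c, g p * q p at e1
        rw [Finset.sum_congr rfl fun c hc => by rw [hbT c hc, hwq c hc], e1]
        exact Finset.sum_congr rfl fun c hc => by simp only [if_pos hc, hwq c hc]
      · rw [hb0' w T' hT'c hne]
        refine (Finset.sum_eq_zero fun c hc => ?_).symm
        have hcT : c ∉ S.sub T := fun h => hne (parent_unique (mem_sub.1 hc).1
          (cut_mem_coarse hT'c) (cut_mem_coarse hTc) (mem_sub.1 hc).2 (mem_sub.1 h).2)
        simp [hcT]
    · rw [if_neg fun h : y = x => hyT (h ▸ hxT), ← Pi.zero_apply (M := fun _ : E d => ℝ) y,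
        ← projValue_coarse hS hR hσ hy S.coarseSpace.zero_mem]
      refine projValue_congr fun w hw => ?_
      rw [hbw y w hw]
      simp only [Pi.zero_apply, zero_mul, integral_zero]
      refine Finset.sum_eq_zero fun T' hT' => ?_
      obtain ⟨hT'c, hyT'⟩ := mem_nodeLayer_zero.1 hT'
      refine hb0' w T' hT'c fun h => hyT ?_
      exact mem_of_node_mem_simplex (interiorNodes_subset hy) (cut_mem_coarse hTc) (h ▸ hyT')
  · exact hb0 T' hT' (fun h => hxT' (h ▸ hxT)) c hc
  · by_cases hne : T' = T
    · subst hne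
      have e1 : energyForm hS hd T' ⟨b, hb⟩ ⟨b, hb⟩ =
          ∑ c ∈ S.sub T', volume.real (simplex c) *
            inner ℝ (grad (piece c b)) (grad (piece c b)) := by
        rw [energyForm_apply]
        refine Finset.sum_congr rfl fun c hc => ?_
        rw [form, robinVerts_eq_empty hS hd hTc hc hTb, Finset.sum_empty, add_zero]
      rw [e1]
      refine sum_volume_grad_le hS hR hTc fun c hc => ?_
      obtain ⟨hcc, hcT⟩ := mem_sub.1 hc
      have hcs := isSimplex_cell hcc
      have hdc := hcs.diam_pos hd
      obtain ⟨z, hz⟩ := cell_ball hR hσ hcc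
      obtain ⟨y₀, hy₀⟩ := hcs.nonempty
      rw [hbT c hc]
      -- The oscillation over the cell is proportional to its diameter, which cancels against the
      -- inradius.
      have := hcs.norm_grad_interp_le (div_pos hdc hσ) hz (a := bubble T' y₀ * g' y₀)
        (V := 2 * σ * m / S.H * Metric.diam (simplex c)) (F := fun y => bubble T' y * g' y)
        fun y hy => by
          refine (abs_bubble_mul_sub_le hS hR hσ (cut_mem_coarse hTc) hgb
            (hcT (vertex_mem_simplex hy)) (hcT (vertex_mem_simplex hy₀))).trans ?_
          have := dist_le_diam_simplex (vertex_mem_simplex hy) (vertex_mem_simplex hy₀)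
          gcongr
      refine this.trans (le_of_eq ?_)
      field_simp
    · have e1 : energyForm hS hd T' ⟨b, hb⟩ ⟨b, hb⟩ = 0 := by
        rw [energyForm_apply]
        refine Finset.sum_eq_zero fun c hc => ?_
        simp [form, hb0 T' hT' hne c hc]
      have := unitVol_pos (d := d)
      rw [e1, zero_mul]; positivity

/-- The energy of the dual functions, up to `H ^ (d - 2)`. -/
def dualConst (d : ℕ) (σ K Λ : ℝ) : ℝ :=
  unitVol d * σ ^ 2 + |K| + unitVol d * (2 * σ ^ 2 * (|Λ| / bubbleConst d σ)) ^ 2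

lemma dualConst_nonneg (σ K Λ : ℝ) : 0 ≤ dualConst d σ K Λ := by
  have := unitVol_pos (d := d)
  unfold dualConst; positivity

/-- The hat function serves unless it is nonzero somewhere on the Dirichlet boundary; only then is
the bubble construction, and with it the assumption on `θ` and `Λ`, needed. -/
lemma exists_dual {M K Λ : ℝ} (hA : S.IsAdmissible σ (bubbleConst d σ / (2 * σ)) M K Λ)
    (hd : 1 ≤ d) (hσ : 0 < σ) {x : E d} (hx : x ∈ S.interiorNodes) :
    ∃ b : S.pw, S.ZeroOnD b.1 ∧
      (∀ y ∈ S.interiorNodes, S.projValue y b.1 = if y = x then 1 else 0) ∧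
      (∀ T ∈ S.cutMesh, x ∉ T → ∀ c ∈ S.sub T, piece c b.1 = 0) ∧
      ∀ T ∈ S.cutMesh, energyForm hA.setup hd T b b * S.H ^ 2 ≤
        dualConst d σ K Λ * S.H ^ d := by
  have hS := hA.setup
  have hH := hS.H_pos
  have hu := unitVol_pos (d := d)
  by_cases h : ∃ t ∈ S.fine.elems, ∃ y ∈ t, simplex (t.erase y) ⊆ S.ΓD ∧
      ∃ p ∈ simplex (t.erase y), S.φ x p ≠ 0
  · obtain ⟨T, hT, hxT, hdiam, hΛ⟩ := hA.dirichlet x hx h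
    -- The node `x` is a vertex of an element with a boundary side, so `T` is at most one layer away
    -- from the boundary and is refined because `k ≥ 1`.
    have hTk : T ∈ S.boundaryLayer S.k := by
      obtain ⟨t, ht, y, hy, hface, p, hp, hφp⟩ := h
      obtain ⟨T', hT', htT', -⟩ := exists_parent hS (fine_mem_cells ht)
      have hT'b := mem_boundaryLayer_of_face hS hd hT' (mem_sub.2 ⟨fine_mem_cells ht, htT'⟩) hy
        (hface.trans (dirichlet_subset hS))
      rw [φ_eq (cut_mem_coarse hT') (htT' (face_subset _ _ hp))] at hφp
      have hxT' : x ∈ T' := by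
        by_contra hn
        rw [bary_of_notMem hn] at hφp; exact hφp rfl
      refine boundaryLayer_mono hS.one_le_k (Finset.mem_filter.2
        ⟨(mem_interiorElems.1 hT).1, T', hT'b, x, vertex_mem_simplex hxT, vertex_mem_simplex hxT'⟩)
    obtain ⟨b, h1, h2, h3, h4⟩ := exists_dual_bubble hS hd hA.regular hσ hT hTk hxT
      (fun c hc => hdiam c (fine_of_mem_sub hS hTk hc) (mem_sub.1 hc).2) hΛ
    refine ⟨b, h1, h2, h3, fun T hT => (h4 T hT).trans ?_⟩
    refine mul_le_mul_of_nonneg_right (le_add_of_nonneg_left ?_) (by positivity)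
    positivity
  · push Not at h
    obtain ⟨b, h1, h2, h3, h4⟩ := exists_dual_coarse hS hd hA.regular hσ hA.robin hx h
    refine ⟨b, h1, h2, h3, fun T hT => (h4 T hT).trans ?_⟩
    refine mul_le_mul_of_nonneg_right (le_add_of_nonneg_right ?_) (by positivity)
    positivity

end Setting

/-! ### Positive semidefinite forms -/

section Forms

variable {V : Type*} [AddCommGroup V] [Module ℝ V] {B : LinearMap.BilinForm ℝ V}

lemma bilin_sum_le (hs : B.IsSymm) (hp : ∀ v, 0 ≤ B v v) {ι : Type*} (A : Finset ι) (v : ι → V) :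
    B (∑ i ∈ A, v i) (∑ i ∈ A, v i) ≤ A.card * ∑ i ∈ A, B (v i) (v i) := by
  have h1 : ∀ i j, B (v i) (v j) ≤ (B (v i) (v i) + B (v j) (v j)) / 2 := by
    intro i j
    have h := hp (v i - v j)
    simp only [map_sub, LinearMap.sub_apply] at h
    have := hs.eq (v i) (v j)
    linarith
  simp only [map_sum, LinearMap.sum_apply]
  calc ∑ j ∈ A, ∑ i ∈ A, B (v i) (v j)
      ≤ ∑ j ∈ A, ∑ i ∈ A, (B (v i) (v i) + B (v j) (v j)) / 2 :=
        Finset.sum_le_sum fun j _ => Finset.sum_le_sum fun i _ => h1 i j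
    _ = _ := by
        simp only [← Finset.sum_div, Finset.sum_add_distrib, Finset.sum_const, nsmul_eq_mul,
          ← Finset.mul_sum]
        ring

lemma bilin_sub_le (hp : ∀ v, 0 ≤ B v v) (u v : V) :
    B (u - v) (u - v) ≤ 2 * B u u + 2 * B v v := by
  have h := hp (u + v)
  simp only [map_sub, map_add, LinearMap.sub_apply, LinearMap.add_apply] at h ⊢
  linarith

end Forms

namespace Setting

variable {S : Setting d} {σ : ℝ}

/-! ### Fine scale functions -/

lemma interp_eq (S : Setting d) (v : E d → ℝ) {x : E d} (hx : x ∈ S.interiorNodes) :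
    S.interp v x = S.projValue x v := by
  rw [interp, Finset.sum_eq_single x]
  · rw [φ_node (interiorNodes_subset hx), if_pos rfl, mul_one]
  · intro y _ hne
    rw [φ_node (interiorNodes_subset hx), if_neg hne.symm, mul_zero]
  · exact fun h => absurd hx h

/-- Evaluating the interpolant at an interior node isolates one coefficient, so the kernel is
described by finitely many local functionals. -/
lemma isFineScale_iff (hS : S.IsSetup) {v : E d → ℝ} :
    S.IsFineScale v ↔ S.IsPW v ∧ ∀ x ∈ S.interiorNodes, S.projValue x v = 0 := by
  rw [IsFineScale, isReference_iff hS]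
  refine and_congr_right fun _ => ⟨fun h x hx => ?_, fun h p _ => ?_⟩
  · rw [← interp_eq S v hx]; exact h x (mem_Ω_of_interiorNode hx)
  · exact Finset.sum_eq_zero fun x hx => by rw [h x hx, zero_mul]

lemma projValue_congr_piece (hS : S.IsSetup) {x : E d} {u v : E d → ℝ} (hu : S.IsPW u)
    (hv : S.IsPW v) (h : ∀ T ∈ S.nodeLayer x 0, ∀ c ∈ S.sub T, piece c u = piece c v) :
    S.projValue x u = S.projValue x v := by
  have key : ∀ {f : E d → ℝ}, S.IsPW f → ∀ w ∈ S.coarseSpace,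
      ∫ p in S.nodePatch x 0, f p * w p =
      ∑ T ∈ S.nodeLayer x 0, ∑ c ∈ S.sub T, ∫ p in simplex c, piece c f p * piece c w p := by
    intro f hf w hw
    have hwp := isPW_of_mem_coarseSpace hS hw
    exact (setIntegral_region_of_eqOn hS (nodeLayer_subset x 0)
      (F := fun c p => piece c f p * piece c w p)
      (fun c => ((continuous_affine _).mul (continuous_affine _)).continuousOn)
      fun T' _ c hc p hp => by
        simp only [hf.eqOn_interior hS (mem_sub.1 hc).1 hp,
          hwp.eqOn_interior hS (mem_sub.1 hc).1 hp]).2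
  refine projValue_congr fun w hw => ?_
  rw [key hu w hw, key hv w hw]
  exact Finset.sum_congr rfl fun T hT => Finset.sum_congr rfl fun c hc => by rw [h T hT c hc]

lemma projValue_sum (hS : S.IsSetup) (hR : S.IsRegular σ) (hσ : 0 < σ) {x : E d}
    (hx : x ∈ S.interiorNodes) {ι : Type*} (A : Finset ι) (α : ι → ℝ) (b : ι → S.pw) :
    S.projValue x (∑ i ∈ A, α i • b i : S.pw).1 = ∑ i ∈ A, α i * S.projValue x (b i).1 := by
  induction A using Finset.induction_on with
  | empty =>
    exact projValue_coarse hS hR hσ hx S.coarseSpace.zero_mem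
  | insert i A hi ih =>
    rw [Finset.sum_insert hi, Finset.sum_insert hi, ← ih,
      ← projValue_smul hS hR hσ hx ((b i).2.memLp hS _)]
    exact projValue_add hS hR hσ hx (IsPW.memLp (α i • b i).2 hS _)
      (IsPW.memLp (∑ j ∈ A, α j • b j : S.pw).2 hS _)

lemma piece_sum_smul (hS : S.IsSetup) {c : Finset (E d)} (hc : c ∈ S.cells) {ι : Type*}
    (A : Finset ι) (α : ι → ℝ) (b : ι → S.pw) :
    piece c (∑ i ∈ A, α i • b i : S.pw).1 = ∑ i ∈ A, α i • piece c (b i).1 := by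
  rw [Submodule.coe_sum, piece_sum hS hc A fun i _ => (α i • b i).2]
  exact Finset.sum_congr rfl fun i _ => piece_smul hS hc (b i).2 (α i)

lemma energyForm_congr (hS : S.IsSetup) (hd : 1 ≤ d) {T : Finset (E d)} {u u' v v' : S.pw}
    (hu : ∀ c ∈ S.sub T, piece c u.1 = piece c u'.1)
    (hv : ∀ c ∈ S.sub T, piece c v.1 = piece c v'.1) :
    energyForm hS hd T u v = energyForm hS hd T u' v' := by
  rw [energyForm_apply, energyForm_apply]
  exact Finset.sum_congr rfl fun c hc => by rw [hu c hc, hv c hc]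

/-! ### Sums over neighbouring elements -/

/-- The sum of `f` over the elements that touch `T`. -/
def nbrSum (S : Setting d) (f : Finset (E d) → ℝ) (T : Finset (E d)) : ℝ :=
  ∑ T' ∈ S.addLayer {T}, f T'

lemma nbrSum_nonneg {f : Finset (E d) → ℝ} (hf : ∀ T, 0 ≤ f T) (T : Finset (E d)) :
    0 ≤ S.nbrSum f T := Finset.sum_nonneg fun _ _ => hf _

lemma le_nbrSum {f : Finset (E d) → ℝ} (hf : ∀ T, 0 ≤ f T) {T : Finset (E d)}
    (hT : T ∈ S.cutMesh) : f T ≤ S.nbrSum f T := by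
  obtain ⟨p, hp⟩ := simplex_nonempty_of_cut hT
  exact Finset.single_le_sum (f := f) (fun _ _ => hf _) (mem_addLayer_singleton hT hp hp)

lemma nbrSum_mono {f g : Finset (E d) → ℝ} (h : ∀ T ∈ S.cutMesh, f T ≤ g T) (T : Finset (E d)) :
    S.nbrSum f T ≤ S.nbrSum g T :=
  Finset.sum_le_sum fun _ hT' => h _ (addLayer_subset _ hT')

lemma nbrSum_mul (a : ℝ) (f : Finset (E d) → ℝ) (T : Finset (E d)) :
    S.nbrSum (fun T => a * f T) T = a * S.nbrSum f T := (Finset.mul_sum _ _ _).symm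

lemma nodeLayer_zero_subset {x : E d} {T : Finset (E d)} (hx : x ∈ T) :
    S.nodeLayer x 0 ⊆ S.addLayer {T} := fun _ hT' =>
  mem_addLayer_singleton (mem_nodeLayer_zero.1 hT').1 (vertex_mem_simplex hx)
    (mem_nodeLayer_zero.1 hT').2

/-- After exchanging the sums, every element is counted once for each element it touches, and
touching is symmetric with bounded multiplicity. -/
lemma sum_nbrSum_le (hS : S.IsSetup) (hR : S.IsRegular σ) (hσ : 0 < σ)
    {f : Finset (E d) → ℝ} (hf : ∀ T, 0 ≤ f T) {A : Finset (Finset (E d))} (hA : A ⊆ S.cutMesh) :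
    ∑ T ∈ A, S.nbrSum f T ≤ (2 * σ) ^ d * ∑ T ∈ S.addLayer A, f T := by
  have h1 : ∑ T ∈ A, S.nbrSum f T = ∑ T' ∈ S.addLayer A, ∑ T ∈ A with T' ∈ S.addLayer {T}, f T' := by
    simp only [nbrSum]
    refine Finset.sum_comm' fun T T' => ?_
    rw [Finset.mem_filter]
    constructor
    · rintro ⟨h1, h2⟩
      exact ⟨⟨h1, h2⟩, addLayer_mono (Finset.singleton_subset_iff.2 h1) h2⟩
    · rintro ⟨⟨h1, h2⟩, -⟩
      exact ⟨h1, h2⟩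
  rw [h1, Finset.mul_sum]
  refine Finset.sum_le_sum fun T' hT' => ?_
  rw [Finset.sum_const, nsmul_eq_mul]
  refine mul_le_mul_of_nonneg_right ?_ (hf T')
  have h2 : (A.filter fun T => T' ∈ S.addLayer {T}) ⊆ S.addLayer {T'} := by
    intro T hT
    obtain ⟨h3, h4⟩ := Finset.mem_filter.1 hT
    obtain ⟨h5, T'', h6, p, hp, hp'⟩ := Finset.mem_filter.1 h4
    rw [Finset.mem_singleton] at h6
    subst h6
    exact mem_addLayer_singleton (hA h3) hp hp'
  exact (Nat.cast_le.2 (Finset.card_le_card h2)).trans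
    (card_neighbours_le hS hR hσ (cut_mem_coarse (addLayer_subset _ hT')))

/-! ### Cutoff in the space of fine scale functions -/

/-- `r` is a fine scale function obtained by cutting off the fine scale function `w` with the
coarse function `η`, with stability constant `C`. -/
structure IsFineCutoff (hS : S.IsSetup) (hd : 1 ≤ d) (C : ℝ) (η : E d → ℝ) (w r : S.pw) :
    Prop where
  fineScale : S.IsFineScale r.1
  piece_of_const : ∀ T ∈ S.cutMesh, ∀ a : ℝ, (∀ T' ∈ S.addLayer {T}, ∀ y ∈ T', η y = a) →
    ∀ c ∈ S.sub T, piece c r.1 = a • piece c w.1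
  energy_le : ∀ A ⊆ S.cutMesh, ∑ T ∈ A, energyForm hS hd T r r ≤
    C * ∑ T ∈ S.addLayer (S.addLayer (S.addLayer A)), energyForm hS hd T w w
  zeroOnD : (∀ T ∈ S.cutMesh, ∀ t ∈ S.fine.elems, t ∈ S.sub T → ∀ x ∈ t,
    simplex (t.erase x) ⊆ S.ΓD → ∀ y ∈ t.erase x, affInterp T η y * piece t w.1 y = 0) →
    S.ZeroOnD r.1

/-- Every element, however badly cut, has a vertex that is an interior node, and the Friedrichs
inequality on the patch of that node covers it. -/
lemma mass_le_nbrSum (hS : S.IsSetup) (hd : 1 ≤ d) (hR : S.IsRegular σ) (hσ : 0 < σ)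
    (hV : S.SharesInteriorVertex) {M : ℝ}
    (hM : ∀ x ∈ S.interiorNodes, PoincareConstLE (S.nodePatch x 0) M) {w : S.pw}
    (hw : S.IsFineScale w.1) {T : Finset (E d)} (hT : T ∈ S.cutMesh) :
    S.mass T w.1 ≤ (8 + 8 * 4 ^ (d + 1) * σ ^ d) * M ^ 2 * S.H ^ 2 *
      S.nbrSum (fun T => energyForm hS hd T w w) T := by
  obtain ⟨T', hT', x, hx⟩ := hV T hT
  obtain ⟨hxT, hxT'⟩ := Finset.mem_inter.1 hx
  have hxI := mem_interiorNodes hT' hxT'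
  have h1 := friedrichs hS hR hσ hxI (hM x hxI) w.2 (((isFineScale_iff hS).1 hw).2 x hxI)
  have h2 : S.mass T w.1 ≤ ∑ T ∈ S.nodeLayer x 0, S.mass T w.1 :=
    Finset.single_le_sum (f := fun T => S.mass T w.1) (fun _ _ => mass_nonneg _ _)
      (mem_nodeLayer_zero.2 ⟨hT, vertex_mem_simplex hxT⟩)
  have h3 : ∑ T ∈ S.nodeLayer x 0, S.dirichletForm T w.1 ≤
      S.nbrSum (fun T => energyForm hS hd T w w) T :=
    (Finset.sum_le_sum fun T' _ => dirichletForm_le hS hd T' w).trans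
      (Finset.sum_le_sum_of_subset_of_nonneg (nodeLayer_zero_subset hxT)
        fun T' _ _ => energyForm_nonneg hS hd T' w)
  refine (h2.trans h1).trans (mul_le_mul_of_nonneg_left h3 ?_)
  positivity

/-- The constant of `IsFineCutoff`. -/
def cutoffConst (d : ℕ) (σ M K Λ : ℝ) : ℝ :=
  let F := (8 + 8 * 4 ^ (d + 1) * σ ^ d) * M ^ 2
  (2 * ((2 + 4 ^ d) + 4 * (2 * σ + σ ^ 2) ^ 2 * (1 + σ ^ d) * 4 ^ (d + 1) * F) +
    2 * ((d + 1 : ℝ) ^ 2 * dualConst d σ K Λ *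
      (σ ^ d / unitVol d * (4 ^ (d + 1) * ((2 + 8 * σ ^ d) * 4 ^ (d + 1) * F))))) *
    ((2 * σ) ^ d) ^ 3

lemma cutoffConst_pos {M K Λ : ℝ} (hσ : 0 < σ) : 0 < cutoffConst d σ M K Λ := by
  have := dualConst_nonneg (d := d) σ K Λ
  have := unitVol_pos (d := d)
  unfold cutoffConst
  positivity

/-- The local projections of a cutoff are bounded by the energy of the function. -/
lemma IsCutoff.projValue_sq_le (hS : S.IsSetup) (hd : 1 ≤ d) (hR : S.IsRegular σ)
    (hσ : 0 < σ) {η : E d → ℝ} {w : S.pw} {R : E d → ℝ} (h : S.IsCutoff η w.1 R)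
    (hη : ∀ y, |η y| ≤ 1) {F : ℝ} (hF : 0 ≤ F)
    (hpm : ∀ T ∈ S.cutMesh, S.patchMass T w.1 ≤ F * S.H ^ 2 *
      S.nbrSum (S.nbrSum (fun T => energyForm hS hd T w w)) T)
    {x : E d} (hx : x ∈ S.interiorNodes) {T : Finset (E d)} (hxT : x ∈ T) :
    (S.projValue x R) ^ 2 * S.H ^ d ≤
      σ ^ d / unitVol d * (4 ^ (d + 1) * ((2 + 8 * σ ^ d) * 4 ^ (d + 1) * F)) * S.H ^ 2 *
      S.nbrSum (S.nbrSum (S.nbrSum (fun T => energyForm hS hd T w w))) T := by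
  have hH := hS.H_pos
  have hu := unitVol_pos (d := d)
  have h0 : ∀ T, 0 ≤ energyForm hS hd T w w := fun T => energyForm_nonneg hS hd T w
  set N2 := S.nbrSum (S.nbrSum (fun T => energyForm hS hd T w w))
  have h1 : ∫ y in S.nodePatch x 0, (R y) ^ 2 ≤
      (2 + 8 * σ ^ d) * 4 ^ (d + 1) * (F * S.H ^ 2) * S.nbrSum N2 T := by
    rw [nodePatch, h.1.setIntegral_sq hS (nodeLayer_subset x 0)]
    have h2 : ∀ T' ∈ S.nodeLayer x 0,
        S.mass T' R ≤ (2 + 8 * σ ^ d) * 4 ^ (d + 1) * (F * S.H ^ 2) * N2 T' := by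
      intro T' hT'
      have hT'c := nodeLayer_subset x 0 hT'
      refine (h.mass_le w.2 hS hd hR hσ hη hT'c).trans ?_
      rw [mul_assoc _ (F * S.H ^ 2)]
      exact mul_le_mul_of_nonneg_left (hpm T' hT'c) (by positivity)
    refine (Finset.sum_le_sum h2).trans ?_
    rw [← Finset.mul_sum]
    refine mul_le_mul_of_nonneg_left ?_ (by positivity)
    exact Finset.sum_le_sum_of_subset_of_nonneg (nodeLayer_zero_subset hxT)
      fun _ _ _ => nbrSum_nonneg (nbrSum_nonneg h0) _
  have h3 := S.projValue_sq_le hS hR hσ hx (h.1.memLp hS (S.nodeLayer x 0))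
  have h4 := h3.trans (mul_le_mul_of_nonneg_left h1 (by positivity))
  have h5 := mul_le_mul_of_nonneg_left h4 (show 0 ≤ σ ^ d / unitVol d by positivity)
  calc _ = σ ^ d / unitVol d * (unitVol d * (S.H / σ) ^ d * (S.projValue x R) ^ 2) := by
        rw [div_pow]; field_simp
    _ ≤ _ := h5
    _ = _ := by ring

/-- The interpolated product `R` is not a fine scale function; subtracting the `b_x` with
coefficients `(P_x R)(x)` makes it one. These coefficients are bounded by the `L²` norm of `w`,
hence by `H` times its energy norm, which balances both the gradient of `η` and the energy of `b_x`.
As `b_x` vanishes on the Dirichlet boundary, the values of `R` there are kept. -/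
lemma exists_fineCutoff {M K Λ : ℝ} (hA : S.IsAdmissible σ (bubbleConst d σ / (2 * σ)) M K Λ)
    (hd : 1 ≤ d) (hσ : 0 < σ) {η : E d → ℝ} (hη : ∀ y, |η y| ≤ 1) {w : S.pw}
    (hw : S.IsFineScale w.1) :
    ∃ r, IsFineCutoff hA.setup hd (cutoffConst d σ M K Λ) η w r := by
  have hS := hA.setup
  have hR := hA.regular
  have hH := hS.H_pos
  have hu := unitVol_pos (d := d)
  have hCb := dualConst_nonneg (d := d) σ K Λ
  obtain ⟨R, hRc⟩ := exists_cutoff hS η w.2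
  change S.IsCutoff η w.1 R at hRc
  have hdual : ∀ x, ∃ b : S.pw, x ∈ S.interiorNodes → S.ZeroOnD b.1 ∧
      (∀ y ∈ S.interiorNodes, S.projValue y b.1 = if y = x then 1 else 0) ∧
      (∀ T ∈ S.cutMesh, x ∉ T → ∀ c ∈ S.sub T, piece c b.1 = 0) ∧
      ∀ T ∈ S.cutMesh, energyForm hA.setup hd T b b * S.H ^ 2 ≤
        dualConst d σ K Λ * S.H ^ d := by
    intro x
    by_cases hx : x ∈ S.interiorNodes
    · obtain ⟨b, hb⟩ := exists_dual hA hd hσ hx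
      exact ⟨b, fun _ => hb⟩
    · exact ⟨0, fun h => absurd h hx⟩
  choose b hb using hdual
  set α : E d → ℝ := fun x => S.projValue x R with hα
  set Rp : S.pw := ⟨R, hRc.1⟩ with hRp
  set u : S.pw := ∑ x ∈ S.interiorNodes, α x • b x with hudef
  have hpu : ∀ T ∈ S.cutMesh, ∀ c ∈ S.sub T,
      piece c u.1 = ∑ x ∈ S.interiorNodes.filter (· ∈ T), α x • piece c (b x).1 := by
    intro T hT c hc
    rw [hudef, piece_sum_smul hS (mem_sub.1 hc).1, Finset.sum_filter]
    refine Finset.sum_congr rfl fun x hx => ?_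
    split_ifs with h
    · rfl
    · rw [(hb x hx).2.2.1 T hT h c hc, smul_zero]
  have hpr : ∀ c ∈ S.cells, piece c (Rp - u).1 = piece c R - piece c u.1 := fun c hc =>
    piece_sub hS hc Rp.2 u.2
  have hw' := (isFineScale_iff hS).1 hw
  refine ⟨Rp - u, ?_, ?_, ?_, ?_⟩
  · refine (isFineScale_iff hS).2 ⟨(Rp - u).2, fun y hy => ?_⟩
    have e1 : (Rp - u).1 = R + ((-1 : ℝ) • u : S.pw).1 := by
      rw [neg_one_smul ℝ u, sub_eq_add_neg]; rfl
    rw [e1, projValue_add hS hR hσ hy (hRc.1.memLp hS _) (IsPW.memLp ((-1 : ℝ) • u).2 hS _)]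
    change _ + S.projValue y ((-1 : ℝ) • u.1) = 0
    rw [projValue_smul hS hR hσ hy (IsPW.memLp u.2 hS _), hudef, projValue_sum hS hR hσ hy,
      Finset.sum_congr rfl fun x hx => by rw [(hb x hx).2.1 y hy]]
    simp [hα, hy]
  · intro T hT a ha c hc
    have hTT : T ∈ S.addLayer {T} := by
      obtain ⟨p, hp⟩ := simplex_nonempty_of_cut hT
      exact mem_addLayer_singleton hT hp hp
    rw [hpr c (mem_sub.1 hc).1, hpu T hT c hc, hRc.piece_of_const hT hc (ha T hTT)]
    rw [Finset.sum_eq_zero, sub_zero]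
    intro x hx
    obtain ⟨hxI, hxT⟩ := Finset.mem_filter.1 hx
    -- If `η` equals `a` on all elements touching `T`, then `R = a w` on the patch of each vertex of
    -- `T`, so its local projections vanish with those of `w` and nothing is subtracted on `T`. This
    -- is why constancy is required one layer beyond `T`.
    have h1 : α x = 0 := by
      have h2 : S.projValue x R = S.projValue x (a • w.1) := by
        refine projValue_congr_piece hS hRc.1 (w.2.smul a) fun T' hT' c' hc' => ?_
        have hT'c := nodeLayer_subset x 0 hT'
        rw [hRc.piece_of_const hT'c hc' (ha T' (nodeLayer_zero_subset hxT hT')),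
          piece_smul hS (mem_sub.1 hc').1 w.2]
      change S.projValue x R = 0
      rw [h2, projValue_smul hS hR hσ hxI (w.2.memLp hS _), hw'.2 x hxI, mul_zero]
    rw [h1, zero_smul]
  · have he : ∀ T, 0 ≤ energyForm hA.setup hd T w w := fun T => energyForm_nonneg hS hd T w
    set e : Finset (E d) → ℝ := fun T => energyForm hA.setup hd T w w
    set F := (8 + 8 * 4 ^ (d + 1) * σ ^ d) * M ^ 2 with hF
    have hF0 : 0 ≤ F := by positivity
    have hN1 := nbrSum_nonneg (S := S) he
    have hN2 := nbrSum_nonneg (S := S) hN1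
    have hN3 := nbrSum_nonneg (S := S) hN2
    -- Counting layers: one neighbour sum is already in `patchMass`, one comes from the Friedrichs
    -- inequality, and the projection of `R` on `ω_x^0` will add the third.
    have hpm : ∀ T ∈ S.cutMesh, S.patchMass T w.1 ≤ F * S.H ^ 2 * S.nbrSum (S.nbrSum e) T := by
      intro T _
      rw [← nbrSum_mul]
      exact nbrSum_mono (fun T' hT' => mass_le_nbrSum hS hd hR hσ hA.sharesInteriorVertex
        hA.poincare hw hT') T
    set G := σ ^ d / unitVol d * (4 ^ (d + 1) * ((2 + 8 * σ ^ d) * 4 ^ (d + 1) * F))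
    have hG0 : 0 ≤ G := by positivity
    set Ce := 4 * (2 * σ + σ ^ 2) ^ 2 * (1 + σ ^ d) * 4 ^ (d + 1)
    have hCe : 0 ≤ Ce := by positivity
    have key : ∀ T ∈ S.cutMesh, energyForm hA.setup hd T (Rp - u) (Rp - u) ≤
        (2 * ((2 + 4 ^ d) + Ce * F) + 2 * ((d + 1 : ℝ) ^ 2 * dualConst d σ K Λ * G)) *
          S.nbrSum (S.nbrSum (S.nbrSum e)) T := by
      intro T hT
      set N := S.nbrSum (S.nbrSum (S.nbrSum e)) T
      have hN : 0 ≤ N := hN3 T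
      have l3 : S.nbrSum (S.nbrSum e) T ≤ N := le_nbrSum hN2 hT
      have l1 : e T ≤ N := (le_nbrSum he hT).trans ((le_nbrSum hN1 hT).trans l3)
      have k1 : energyForm hA.setup hd T Rp Rp ≤ ((2 + 4 ^ d) + Ce * F) * N := by
        have h1 := IsCutoff.energy_le (R := Rp) hRc w.2 hS hd hR hσ hη hT
        have h2 : S.patchMass T w.1 / S.H ^ 2 ≤ F * N := by
          rw [div_le_iff₀ (by positivity)]
          calc _ ≤ _ := hpm T hT
            _ ≤ F * S.H ^ 2 * N := by gcongr
            _ = _ := by ring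
        calc _ ≤ _ := h1
          _ ≤ (2 + 4 ^ d) * N + Ce * (F * N) := by gcongr
          _ = _ := by ring
      have k2 : energyForm hA.setup hd T u u ≤ (d + 1 : ℝ) ^ 2 * dualConst d σ K Λ * G * N := by
        set A := S.interiorNodes.filter (· ∈ T) with hAdef
        have hcong : ∀ c ∈ S.sub T, piece c u.1 = piece c (∑ x ∈ A, α x • b x : S.pw).1 := by
          intro c hc
          rw [hpu T hT c hc, piece_sum_smul hS (mem_sub.1 hc).1]
        rw [energyForm_congr hS hd hcong hcong]
        have h1 := bilin_sum_le (energyForm_isSymm hS hd T) (energyForm_nonneg hS hd T) A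
          fun x => α x • b x
        -- At most `d + 1` dual functions live on `T`. The factor enters twice, from Cauchy–Schwarz
        -- and from the number of summands.
        have hcard : (A.card : ℝ) ≤ d + 1 := by
          have h2 : A ⊆ T := fun x hx => (Finset.mem_filter.1 hx).2
          have h3 := Finset.card_le_card h2
          rw [(isSimplex_cut hT).1] at h3
          exact_mod_cast h3
        have h2 : ∀ x ∈ A, energyForm hA.setup hd T (α x • b x) (α x • b x) ≤
            dualConst d σ K Λ * G * N := by
          intro x hx
          obtain ⟨hxI, hxT⟩ := Finset.mem_filter.1 hx
          have h3 := IsCutoff.projValue_sq_le hS hd hR hσ hRc hη hF0 hpm hxI hxT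
          have h4 := (hb x hxI).2.2.2 T hT
          simp only [map_smul, LinearMap.smul_apply, smul_eq_mul]
          refine le_of_mul_le_mul_right ?_ (show 0 < S.H ^ 2 by positivity)
          calc _ = (α x) ^ 2 * (energyForm hA.setup hd T (b x) (b x) * S.H ^ 2) := by ring
            _ ≤ (α x) ^ 2 * (dualConst d σ K Λ * S.H ^ d) := by gcongr
            _ = dualConst d σ K Λ * ((α x) ^ 2 * S.H ^ d) := by ring
            _ ≤ dualConst d σ K Λ * (G * S.H ^ 2 * N) := by gcongr
            _ = _ := by ring
        have h3 : ∑ x ∈ A, energyForm hA.setup hd T (α x • b x) (α x • b x) ≤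
            (d + 1) * (dualConst d σ K Λ * G * N) := by
          refine (Finset.sum_le_card_nsmul A _ _ h2).trans ?_
          rw [nsmul_eq_mul]
          gcongr
        calc _ ≤ _ := h1
          _ ≤ (d + 1) * ((d + 1) * (dualConst d σ K Λ * G * N)) := by
              refine mul_le_mul hcard h3 (Finset.sum_nonneg fun x _ => energyForm_nonneg hS hd T _)
                (by positivity)
          _ = _ := by ring
      have k3 := bilin_sub_le (energyForm_nonneg hS hd T) Rp u
      calc _ ≤ _ := k3
        _ ≤ 2 * (((2 + 4 ^ d) + Ce * F) * N) +
          2 * ((d + 1 : ℝ) ^ 2 * dualConst d σ K Λ * G * N) := by gcongr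
        _ = _ := by ring
    intro A hAc
    refine (Finset.sum_le_sum fun T hT => key T (hAc hT)).trans ?_
    rw [← Finset.mul_sum]
    have s1 := sum_nbrSum_le hS hR hσ hN2 hAc
    have s2 := sum_nbrSum_le hS hR hσ hN1 (addLayer_subset A)
    have s3 := sum_nbrSum_le hS hR hσ he (addLayer_subset (S.addLayer A))
    have s4 : ∑ T ∈ A, S.nbrSum (S.nbrSum (S.nbrSum e)) T ≤ ((2 * σ) ^ d) ^ 3 *
        ∑ T ∈ S.addLayer (S.addLayer (S.addLayer A)), e T := by
      have hp : 0 ≤ (2 * σ) ^ d := by positivity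
      calc _ ≤ _ := s1
        _ ≤ (2 * σ) ^ d * ((2 * σ) ^ d * ((2 * σ) ^ d * _)) :=
          mul_le_mul_of_nonneg_left (s2.trans (mul_le_mul_of_nonneg_left s3 hp)) hp
        _ = _ := by ring
    calc _ ≤ _ := mul_le_mul_of_nonneg_left s4 (by positivity)
      _ = _ := by rw [cutoffConst]; ring
  · intro hD t ht x hx hface p hp
    obtain ⟨T, hT, htT, -⟩ := exists_parent hS (fine_mem_cells ht)
    have htc : t ∈ S.sub T := mem_sub.2 ⟨fine_mem_cells ht, htT⟩
    have hTb := mem_boundaryLayer_of_face hS hd hT htc hx (hface.trans (dirichlet_subset hS))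
    have hpt := face_subset _ _ hp
    rw [trace_eq hS ht (Rp - u).2 hpt, hpr t (fine_mem_cells ht)]
    have h1 : piece t R p = 0 := by
      rw [hRc.piece_of_boundary hS hTb htc, ← abs_nonpos_iff]
      refine abs_affine_le _ (fun y hy => ?_) hp
      rw [(S.fine.isSimplex ht).affInterp_vertex _ (Finset.mem_of_mem_erase hy),
        hD T hT t ht htc x hx hface y hy, abs_zero]
    have h2 : piece t u.1 p = 0 := by
      rw [hudef, piece_sum_smul hS (fine_mem_cells ht), affineMap_sum_apply]
      refine Finset.sum_eq_zero fun z hz => ?_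
      have := (hb z hz).1 t ht x hx hface p hp
      rw [trace_eq hS ht (b z).2 hpt] at this
      simp [this]
    simp [h1, h2]

end Setting

lemma bilin_le {V : Type*} [AddCommGroup V] [Module ℝ V] {B : LinearMap.BilinForm ℝ V}
    (hs : B.IsSymm) (hp : ∀ v, 0 ≤ B v v) (u v : V) : B u v ≤ (B u u + B v v) / 2 := by
  have h := hp (u - v)
  simp only [map_sub, LinearMap.sub_apply] at h
  have := hs.eq u v
  linarith

lemma neg_bilin_le {V : Type*} [AddCommGroup V] [Module ℝ V] {B : LinearMap.BilinForm ℝ V}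
    (hs : B.IsSymm) (hp : ∀ v, 0 ≤ B v v) (u v : V) : -B u v ≤ (B u u + B v v) / 2 := by
  have h := bilin_le hs hp u (-v)
  simpa using h

namespace Setting

variable {S : Setting d} {σ : ℝ}

/-! ### The spaces of the corrector problems -/

/-- The piecewise affine functions that vanish on the Dirichlet boundary. -/
def pwD (hS : S.IsSetup) : Submodule ℝ (E d → ℝ) where
  carrier := {v | S.IsPW v ∧ S.ZeroOnD v}
  zero_mem' := ⟨S.pw.zero_mem, fun t ht x _ _ p hp => by
    have hpt := face_subset _ _ hp
    have h0 : piece t (0 : E d → ℝ) = 0 := (S.fine.isSimplex ht).piece_eq fun _ _ => rfl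
    rw [trace_eq hS ht S.pw.zero_mem hpt, h0]; rfl⟩
  add_mem' := by
    rintro u v ⟨hu, hu0⟩ ⟨hv, hv0⟩
    refine ⟨hu.add hv, fun t ht x hx hf p hp => ?_⟩
    have hpt := face_subset _ _ hp
    have h1 := hu0 t ht x hx hf p hp
    have h2 := hv0 t ht x hx hf p hp
    rw [trace_eq hS ht hu hpt] at h1
    rw [trace_eq hS ht hv hpt] at h2
    rw [trace_eq hS ht (hu.add hv) hpt, piece_add hS (fine_mem_cells ht) hu hv]
    simp [h1, h2]
  smul_mem' := by
    rintro a v ⟨hv, hv0⟩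
    refine ⟨hv.smul a, fun t ht x hx hf p hp => ?_⟩
    have hpt := face_subset _ _ hp
    have h2 := hv0 t ht x hx hf p hp
    rw [trace_eq hS ht hv hpt] at h2
    rw [trace_eq hS ht (hv.smul a) hpt, piece_smul hS (fine_mem_cells ht) hv]
    simp [h2]

/-- The space of fine scale functions. -/
def fineScaleSpace (hS : S.IsSetup) (hR : S.IsRegular σ) (hσ : 0 < σ) :
    Submodule ℝ (E d → ℝ) where
  carrier := {v | S.IsFineScale v}
  zero_mem' := (isFineScale_iff hS).2 ⟨S.pw.zero_mem, fun _ hx =>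
    projValue_coarse hS hR hσ hx S.coarseSpace.zero_mem⟩
  add_mem' := by
    intro u v hu hv
    obtain ⟨hu, hu0⟩ := (isFineScale_iff hS).1 hu
    obtain ⟨hv, hv0⟩ := (isFineScale_iff hS).1 hv
    refine (isFineScale_iff hS).2 ⟨hu.add hv, fun x hx => ?_⟩
    rw [projValue_add hS hR hσ hx (hu.memLp hS _) (hv.memLp hS _), hu0 x hx, hv0 x hx, add_zero]
  smul_mem' := by
    intro a v hv
    obtain ⟨hv, hv0⟩ := (isFineScale_iff hS).1 hv
    refine (isFineScale_iff hS).2 ⟨hv.smul a, fun x hx => ?_⟩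
    rw [projValue_smul hS hR hσ hx (hv.memLp hS _), hv0 x hx, mul_zero]

lemma IsFineScale.isPW (hS : S.IsSetup) {v : E d → ℝ} (hv : S.IsFineScale v) : S.IsPW v :=
  ((isFineScale_iff hS).1 hv).1

/-- The bilinear form `a` on piecewise affine functions. -/
def totalForm (hS : S.IsSetup) (hd : 1 ≤ d) : LinearMap.BilinForm ℝ S.pw :=
  ∑ T ∈ S.cutMesh, energyForm hS hd T

lemma totalForm_apply (hS : S.IsSetup) (hd : 1 ≤ d) (u v : S.pw) :
    totalForm hS hd u v = ∑ T ∈ S.cutMesh, energyForm hS hd T u v := by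
  simp [totalForm, LinearMap.sum_apply]

lemma a_eq_totalForm (hS : S.IsSetup) (hd : 1 ≤ d) (u v : S.pw) :
    S.a u.1 v.1 = totalForm hS hd u v := by
  rw [totalForm_apply, a_eq hS hd u.2 v.2]

lemma totalForm_nonneg (hS : S.IsSetup) (hd : 1 ≤ d) (u : S.pw) : 0 ≤ totalForm hS hd u u := by
  rw [totalForm_apply]
  exact Finset.sum_nonneg fun T _ => energyForm_nonneg hS hd T u

lemma totalForm_isSymm (hS : S.IsSetup) (hd : 1 ≤ d) : (totalForm (S := S) hS hd).IsSymm :=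
  ⟨fun u v => by
    rw [totalForm_apply, totalForm_apply]
    exact Finset.sum_congr rfl fun T _ => (energyForm_isSymm hS hd T).eq u v⟩

lemma energyForm_eq_zero_left (hS : S.IsSetup) (hd : 1 ≤ d) {T : Finset (E d)} {u : S.pw}
    (hu : ∀ c ∈ S.sub T, piece c u.1 = 0) (v : S.pw) : energyForm hS hd T u v = 0 := by
  rw [energyForm_apply]
  exact Finset.sum_eq_zero fun c hc => by simp [form, hu c hc]

lemma energyForm_eq_zero_right (hS : S.IsSetup) (hd : 1 ≤ d) {T : Finset (E d)} {v : S.pw}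
    (hv : ∀ c ∈ S.sub T, piece c v.1 = 0) (u : S.pw) : energyForm hS hd T u v = 0 := by
  rw [energyForm_apply]
  exact Finset.sum_eq_zero fun c hc => by simp [form, hv c hc]

/-! ### Layers -/

lemma mem_addLayer_symm {T T' : Finset (E d)} (hT : T ∈ S.cutMesh) (h : T' ∈ S.addLayer {T}) :
    T ∈ S.addLayer {T'} := by
  obtain ⟨_, T'', h2, p, hp, hp'⟩ := Finset.mem_filter.1 h
  rw [Finset.mem_singleton] at h2
  subst h2
  exact mem_addLayer_singleton hT hp hp'

lemma mem_nodeLayer_succ {x : E d} {l : ℕ} {T T' : Finset (E d)} (hT : T ∈ S.nodeLayer x l)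
    (h : T' ∈ S.addLayer {T}) : T' ∈ S.nodeLayer x (l + 1) :=
  addLayer_mono (Finset.singleton_subset_iff.2 hT) h

lemma addLayer_sdiff (x : E d) (l : ℕ) :
    S.addLayer (S.cutMesh \ S.nodeLayer x (l + 1)) ⊆ S.cutMesh \ S.nodeLayer x l := by
  intro T hT
  obtain ⟨h1, T', h2, p, hp, hp'⟩ := Finset.mem_filter.1 hT
  obtain ⟨h3, h4⟩ := Finset.mem_sdiff.1 h2
  exact Finset.mem_sdiff.2 ⟨h1, fun h => h4 (mem_nodeLayer_succ h (mem_addLayer_singleton h3 hp hp'))⟩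

lemma addLayer_three_sdiff (x : E d) (l : ℕ) :
    S.addLayer (S.addLayer (S.addLayer (S.cutMesh \ S.nodeLayer x (l + 3)))) ⊆
      S.cutMesh \ S.nodeLayer x l :=
  (addLayer_mono ((addLayer_mono (addLayer_sdiff x (l + 2))).trans (addLayer_sdiff x (l + 1)))).trans
    (addLayer_sdiff x l)

/-- The nodal values `0` on the `l`-layer patch of `x`, and `1` elsewhere. -/
def nodeCut (S : Setting d) (x : E d) (l : ℕ) (y : E d) : ℝ :=
  if ∃ T ∈ S.nodeLayer x l, y ∈ T then 0 else 1

lemma abs_nodeCut_le (x : E d) (l : ℕ) (y : E d) : |S.nodeCut x l y| ≤ 1 := by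
  unfold nodeCut; split_ifs <;> simp

lemma nodeCut_eq_zero {x : E d} {l : ℕ} {T : Finset (E d)} (hT : T ∈ S.nodeLayer x l) {y : E d}
    (hy : y ∈ T) : S.nodeCut x l y = 0 := if_pos ⟨T, hT, hy⟩

lemma nodeCut_eq_one {x : E d} {l : ℕ} {T : Finset (E d)} (hTc : T ∈ S.cutMesh)
    (hT : T ∉ S.nodeLayer x (l + 1)) {y : E d} (hy : y ∈ T) : S.nodeCut x l y = 1 := by
  refine if_neg ?_
  rintro ⟨T', hT', hy'⟩
  exact hT (mem_nodeLayer_succ hT'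
    (mem_addLayer_singleton hTc (vertex_mem_simplex hy') (vertex_mem_simplex hy)))

variable {hS : S.IsSetup} {hd : 1 ≤ d} {C : ℝ} {w r : S.pw} {x : E d} {l : ℕ}

lemma IsFineCutoff.piece_eq_zero (h : IsFineCutoff hS hd C (S.nodeCut x (l + 1)) w r)
    {T c : Finset (E d)} (hT : T ∈ S.nodeLayer x l) (hc : c ∈ S.sub T) : piece c r.1 = 0 := by
  rw [h.piece_of_const T (nodeLayer_subset x l hT) 0 (fun T' hT' y hy =>
    nodeCut_eq_zero (mem_nodeLayer_succ hT hT') hy) c hc, zero_smul]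

/-- All neighbours of `T` must carry the nodal value one. They do if they are outside layer `l + 1`,
which holds when `T` is outside layer `l + 2`. -/
lemma IsFineCutoff.piece_eq (h : IsFineCutoff hS hd C (S.nodeCut x l) w r)
    {T c : Finset (E d)} (hTc : T ∈ S.cutMesh) (hT : T ∉ S.nodeLayer x (l + 2))
    (hc : c ∈ S.sub T) : piece c r.1 = piece c w.1 := by
  rw [h.piece_of_const T hTc 1 (fun T' hT' y hy => nodeCut_eq_one (addLayer_subset _ hT')
    (fun hT'' => hT (mem_nodeLayer_succ hT'' (mem_addLayer_symm hTc hT'))) hy) c hc, one_smul]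

/-! ### Properties of the correctors -/

/-- On the Dirichlet boundary `q` is supported near `x`. -/
def DirichletSupported (S : Setting d) (x : E d) (q : E d → ℝ) : Prop :=
  ∀ T ∈ S.cutMesh, x ∉ T → ∀ t ∈ S.fine.elems, t ∈ S.sub T → ∀ z ∈ t,
    simplex (t.erase z) ⊆ S.ΓD → ∀ y ∈ t.erase z, piece t q y = 0

lemma dirichletSupported_of_add (hS : S.IsSetup) {q : E d → ℝ} (hq : S.IsPW q)
    (hx : x ∈ S.nodes) (h : S.ZeroOnD (q + S.φ x)) : S.DirichletSupported x q := by
  intro T hT hxT t ht htT z hz hface y hy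
  have hφ := isPW_of_mem_coarseSpace hS (φ_mem_coarseSpace hx)
  have hyf := vertex_mem_simplex hy
  have h1 := h t ht z hz hface y hyf
  rw [trace_eq hS ht (hq.add hφ) (face_subset _ _ hyf), piece_add hS (fine_mem_cells ht) hq hφ,
    piece_φ hS hT htT, bary_of_notMem hxT, add_zero] at h1
  exact h1

lemma dirichletSupported_of_zeroOnD (hS : S.IsSetup) {q : E d → ℝ} (hq : S.IsPW q)
    (h : S.ZeroOnD q) : S.DirichletSupported x q := by
  intro T _ _ t ht _ z hz hface y hy
  have hyf := vertex_mem_simplex hy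
  have h1 := h t ht z hz hface y hyf
  rwa [trace_eq hS ht hq (face_subset _ _ hyf)] at h1

/-- On elements at `x` the cut function vanishes, on all others `w` does on the Dirichlet sides.
This makes the cutoff of a corrector an admissible test function although the corrector has boundary
values. -/
lemma IsFineCutoff.zeroOnD_of_supported (h : IsFineCutoff hS hd C (S.nodeCut x l) w r)
    (hw : S.DirichletSupported x w.1) : S.ZeroOnD r.1 := by
  refine h.zeroOnD fun T hT t ht htT z hz hface y hy => ?_
  by_cases hxT : x ∈ T
  · have hTl : T ∈ S.nodeLayer x l :=
      nodeLayer_mono x (Nat.zero_le l) (mem_nodeLayer_zero.2 ⟨hT, vertex_mem_simplex hxT⟩)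
    have h0 : affInterp T (S.nodeCut x l) = 0 :=
      Finset.sum_eq_zero fun v hv => by rw [nodeCut_eq_zero hTl hv, zero_smul]
    rw [h0]; simp
  · rw [hw T hT hxT t ht htT z hz hface y hy, mul_zero]

lemma totalForm_φ_eq_zero (hS : S.IsSetup) (hd : 1 ≤ d) (hx : S.IsPW (S.φ x)) {r : S.pw}
    (hr : ∀ T ∈ S.nodeLayer x 0, ∀ c ∈ S.sub T, piece c r.1 = 0) :
    totalForm hS hd ⟨S.φ x, hx⟩ r = 0 := by
  rw [totalForm_apply]
  refine Finset.sum_eq_zero fun T hT => ?_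
  by_cases hxT : x ∈ T
  · exact energyForm_eq_zero_right hS hd
      (hr T (mem_nodeLayer_zero.2 ⟨hT, vertex_mem_simplex hxT⟩)) _
  · exact energyForm_eq_zero_left hS hd
      (fun c hc => by rw [piece_φ hS hT hc, bary_of_notMem hxT]) _

/-- The energy outside the `l`-layer patch of `x`. -/
def tail (hS : S.IsSetup) (hd : 1 ≤ d) (x : E d) (l : ℕ) (q : S.pw) : ℝ :=
  ∑ T ∈ S.cutMesh \ S.nodeLayer x l, energyForm hS hd T q q

lemma tail_anti (hS : S.IsSetup) (hd : 1 ≤ d) (x : E d) (q : S.pw) :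
    Antitone fun l => tail hS hd x l q := fun _ _ h =>
  Finset.sum_le_sum_of_subset_of_nonneg (Finset.sdiff_subset_sdiff subset_rfl (nodeLayer_mono x h))
    fun T _ _ => energyForm_nonneg hS hd T q

lemma tail_le (hS : S.IsSetup) (hd : 1 ≤ d) (x : E d) (l : ℕ) (q : S.pw) :
    tail hS hd x l q ≤ totalForm hS hd q q := by
  rw [totalForm_apply]
  exact Finset.sum_le_sum_of_subset_of_nonneg Finset.sdiff_subset
    fun T _ _ => energyForm_nonneg hS hd T q

/-- The Caccioppoli argument: outside a patch, the energy is controlled by the energy in a ring. -/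
lemma tail_step {q r : S.pw} (h : IsFineCutoff hS hd C (S.nodeCut x (l + 4)) q r) (hC : 0 ≤ C)
    (h0 : totalForm hS hd q r = 0) :
    tail hS hd x (l + 9) q ≤ (1 + C) / 2 * (tail hS hd x l q - tail hS hd x (l + 9) q) := by
  set N := S.nodeLayer x with hN
  have hsub : ∀ m, N m ⊆ S.cutMesh := nodeLayer_subset x
  have hmono : ∀ {m n}, m ≤ n → N m ⊆ N n := fun h => nodeLayer_mono x h
  have e1 : tail hS hd x l q - tail hS hd x (l + 9) q =
      ∑ T ∈ (S.cutMesh \ N l) \ (S.cutMesh \ N (l + 9)), energyForm hS hd T q q := by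
    rw [tail, tail, ← Finset.sum_sdiff (Finset.sdiff_subset_sdiff (subset_refl S.cutMesh)
      (hmono (show l ≤ l + 9 by omega)))]
    ring
  set W := (S.cutMesh \ N l) \ (S.cutMesh \ N (l + 9)) with hW
  have hWmem : ∀ T, T ∈ N (l + 9) → T ∉ N l → T ∈ W := fun T h1 h2 =>
    Finset.mem_sdiff.2 ⟨Finset.mem_sdiff.2 ⟨hsub _ h1, h2⟩, fun h => (Finset.mem_sdiff.1 h).2 h1⟩
  set V := N (l + 6) \ N (l + 3) with hV
  have e2 : ∑ T ∈ V, energyForm hS hd T q q ≤ ∑ T ∈ W, energyForm hS hd T q q := by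
    refine Finset.sum_le_sum_of_subset_of_nonneg (fun T hT => ?_)
      fun T _ _ => energyForm_nonneg hS hd T q
    obtain ⟨h1, h2⟩ := Finset.mem_sdiff.1 hT
    exact hWmem T (hmono (by omega) h1) fun h => h2 (hmono (by omega) h)
  have e3 : ∑ T ∈ V, energyForm hS hd T r r ≤ C * ∑ T ∈ W, energyForm hS hd T q q := by
    refine (h.energy_le V (Finset.sdiff_subset.trans (hsub _))).trans
      (mul_le_mul_of_nonneg_left ?_ hC)
    refine Finset.sum_le_sum_of_subset_of_nonneg (fun T hT => ?_)
      fun T _ _ => energyForm_nonneg hS hd T q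
    refine hWmem T ?_ ?_
    · exact addLayer_mono (addLayer_mono (addLayer_mono Finset.sdiff_subset)) hT
    · have := addLayer_three_sdiff x l (addLayer_mono (addLayer_mono (addLayer_mono
        (Finset.sdiff_subset_sdiff (hsub (l + 6)) subset_rfl))) hT)
      exact (Finset.mem_sdiff.1 this).2
  have e4 : ∑ T ∈ S.cutMesh \ N (l + 6), energyForm hS hd T q r = tail hS hd x (l + 6) q := by
    refine Finset.sum_congr rfl fun T hT => ?_
    obtain ⟨h1, h2⟩ := Finset.mem_sdiff.1 hT
    exact energyForm_congr hS hd (fun _ _ => rfl) fun c hc => h.piece_eq h1 h2 hc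
  have e5 : ∑ T ∈ N (l + 6), energyForm hS hd T q r = ∑ T ∈ V, energyForm hS hd T q r := by
    rw [← Finset.sum_sdiff (hmono (show l + 3 ≤ l + 6 by omega)),
      Finset.sum_eq_zero (s := N (l + 3)) fun T hT => energyForm_eq_zero_right hS hd
        (fun c hc => h.piece_eq_zero hT hc) q, add_zero]
  have e6 : -∑ T ∈ V, energyForm hS hd T q r ≤
      (∑ T ∈ V, energyForm hS hd T q q + ∑ T ∈ V, energyForm hS hd T r r) / 2 := by
    rw [← Finset.sum_neg_distrib, ← Finset.sum_add_distrib, Finset.sum_div]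
    exact Finset.sum_le_sum fun T _ =>
      neg_bilin_le (energyForm_isSymm hS hd T) (energyForm_nonneg hS hd T) q r
  -- Orthogonality now reads: tail beyond layer `l + 6` plus the mixed terms on `V` equals zero.
  rw [totalForm_apply, ← Finset.sum_sdiff (hsub (l + 6)), e4, e5] at h0
  have e7 := tail_anti hS hd x q (show l + 6 ≤ l + 9 by omega)
  simp only at e7
  rw [e1]
  linarith

/-- The local energy of a cutoff. -/
lemma IsFineCutoff.totalForm_le (h : IsFineCutoff hS hd C (S.nodeCut x (l + 4)) w r) (hC : 0 ≤ C) :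
    totalForm hS hd r r ≤ C * tail hS hd x l w := by
  rw [totalForm_apply, ← Finset.sum_sdiff (nodeLayer_subset x (l + 3)),
    Finset.sum_eq_zero (s := S.nodeLayer x (l + 3)) fun T hT => energyForm_eq_zero_right hS hd
      (fun c hc => h.piece_eq_zero hT hc) r, add_zero]
  refine (h.energy_le _ Finset.sdiff_subset).trans (mul_le_mul_of_nonneg_left ?_ hC)
  exact Finset.sum_le_sum_of_subset_of_nonneg (addLayer_three_sdiff x l)
    fun T _ _ => energyForm_nonneg hS hd T w

lemma IsFineCutoff.totalForm_le_totalForm {η : E d → ℝ} (h : IsFineCutoff hS hd C η w r)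
    (hC : 0 ≤ C) : totalForm hS hd r r ≤ C * totalForm hS hd w w := by
  rw [totalForm_apply, totalForm_apply]
  refine (h.energy_le _ subset_rfl).trans (mul_le_mul_of_nonneg_left ?_ hC)
  exact Finset.sum_le_sum_of_subset_of_nonneg (addLayer_subset _)
    fun T _ _ => energyForm_nonneg hS hd T w

/-! ### Supports -/

lemma piece_eq_zero_of_support (hS : S.IsSetup) {w : E d → ℝ}
    (h : ∀ p ∈ S.Ω \ S.nodePatch x l, w p = 0) {T c : Finset (E d)} (hT : T ∈ S.cutMesh)
    (hTl : T ∉ S.nodeLayer x l) (hc : c ∈ S.sub T) : piece c w = 0 := by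
  obtain ⟨hcc, hcT⟩ := mem_sub.1 hc
  refine (isSimplex_cell hcc).piece_eq fun p hp => h p ⟨cell_interior_subset hS hcc hp, fun hpp => ?_⟩
  obtain ⟨T', hT', hpT'⟩ := Set.mem_iUnion₂.1 (interior_subset hpp).1
  have hne : T ≠ T' := fun h => hTl (h ▸ hT')
  exact Set.disjoint_left.1 (S.coarse.interior_disjoint (cut_mem_coarse hT)
    (cut_mem_coarse (nodeLayer_subset x l hT')) hne) (interior_mono hcT hp) hpT'

lemma IsPW.eq_zero_of_piece (hS : S.IsSetup) {w : E d → ℝ} (hw : S.IsPW w) {T : Finset (E d)}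
    (hT : T ∈ S.cutMesh) (h : ∀ c ∈ S.sub T, piece c w = 0) {p : E d} (hpT : p ∈ simplex T)
    (hp : p ∈ S.Ω) : w p = 0 := by
  have h1 : ∀ q ∈ interior (simplex T) ∩ S.Ω, w q = 0 := by
    rintro q ⟨hqT, hq⟩
    obtain ⟨c, hc, hqc⟩ := exists_cell hS hq
    obtain ⟨T', hT', hcT', -⟩ := exists_parent hS hc
    have : T = T' := by
      by_contra hne
      exact Set.disjoint_left.1 (S.coarse.interior_disjoint (cut_mem_coarse hT)
        (cut_mem_coarse hT') hne) hqT (hcT' hqc)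
    subst this
    rw [hw.eqOn hS hc ⟨hqc, hq⟩, h c (mem_sub.2 ⟨hc, hcT'⟩)]; rfl
  have h2 : (𝓝[interior (simplex T) ∩ S.Ω] p).NeBot :=
    mem_closure_iff_nhdsWithin_neBot.1 (inter_subset_closure hS hT ⟨hpT, hp⟩)
  have h3 : Tendsto w (𝓝[interior (simplex T) ∩ S.Ω] p) (𝓝 (w p)) :=
    (hw.1 p hp).mono_left (nhdsWithin_mono _ Set.inter_subset_right)
  refine tendsto_nhds_unique h3 (tendsto_const_nhds.congr' ?_)
  filter_upwards [self_mem_nhdsWithin] with q hq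
  exact (h1 q hq).symm

lemma support_of_piece_eq_zero (hS : S.IsSetup) {w : E d → ℝ} (hw : S.IsPW w)
    (h : ∀ T ∈ S.cutMesh, T ∉ S.nodeLayer x l → ∀ c ∈ S.sub T, piece c w = 0) :
    ∀ p ∈ S.Ω \ S.nodePatch x l, w p = 0 := by
  rintro p ⟨hp, hpn⟩
  obtain ⟨T, hT, hTl, hpT⟩ := exists_elem_of_notMem_region hS hp hpn
  exact hw.eq_zero_of_piece hS hT (h T hT hTl) hpT hp

/-! ### The number of nodes with overlapping patches -/

lemma dist_le_of_mem_nodeLayer (hR : S.IsRegular σ) {n : ℕ} {T : Finset (E d)}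
    (hT : T ∈ S.nodeLayer x n) {p : E d} (hp : p ∈ simplex T) : dist p x ≤ (n + 1) * S.H := by
  induction n generalizing T p with
  | zero =>
    obtain ⟨hTc, hxT⟩ := mem_nodeLayer_zero.1 hT
    simpa using (dist_le_diam_simplex hp hxT).trans (hR.coarse_diam T (cut_mem_coarse hTc))
  | succ n ih =>
    obtain ⟨hTc, T', hT', y, hy, hy'⟩ := Finset.mem_filter.1 hT
    have h1 := (dist_le_diam_simplex hp hy).trans (hR.coarse_diam T (cut_mem_coarse hTc))
    have h2 := ih hT' hy'
    have h3 := dist_triangle p y x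
    push_cast
    linarith

/-- Such a node is a vertex of an interior element within distance `(n + 2) H` of a point of `T`;
these elements are counted by packing, with `d + 1` vertices each. -/
lemma card_nodes_le (hS : S.IsSetup) (hR : S.IsRegular σ) (hσ : 0 < σ) (n : ℕ) {T : Finset (E d)}
    (hT : T ∈ S.cutMesh) :
    ((S.interiorNodes.filter fun x => T ∈ S.nodeLayer x n).card : ℝ) ≤
      (d + 1) * (σ * (n + 2)) ^ d := by
  have hH := hS.H_pos
  obtain ⟨p, hp⟩ := simplex_nonempty_of_cut hT
  set B := S.cutMesh.filter fun T' => simplex T' ⊆ Metric.closedBall p ((n + 2) * S.H) with hB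
  have h1 : (S.interiorNodes.filter fun x => T ∈ S.nodeLayer x n) ⊆ B.biUnion id := by
    intro x hx
    obtain ⟨hxI, hxT⟩ := Finset.mem_filter.1 hx
    obtain ⟨T', hT', hxT'⟩ := exists_interiorElem hxI
    have hT'c := (mem_interiorElems.1 hT').1
    refine Finset.mem_biUnion.2 ⟨T', Finset.mem_filter.2 ⟨hT'c, fun q hq => ?_⟩, hxT'⟩
    have e1 := dist_le_of_mem_nodeLayer hR hxT hp
    have e2 := (dist_le_diam_simplex hq (vertex_mem_simplex hxT')).trans
      (hR.coarse_diam T' (cut_mem_coarse hT'c))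
    have e3 := dist_triangle_right q p x
    rw [Metric.mem_closedBall]
    linarith
  have h2 : (B.biUnion id).card ≤ B.card * (d + 1) :=
    Finset.card_biUnion_le_card_mul _ _ _ fun T' hT' =>
      (isSimplex_cut (Finset.mem_filter.1 hT').1).1.le
  have h3 := card_le_of_subset_closedBall hS hR hσ (A := B) (p := p) (r := (n + 2) * S.H)
    (fun T' hT' => cut_mem_coarse (Finset.mem_filter.1 hT').1) (by positivity)
    fun T' hT' => (Finset.mem_filter.1 hT').2
  have e : σ * ((n + 2) * S.H) / S.H = σ * (n + 2) := by field_simp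
  rw [e] at h3
  have h4 : ((S.interiorNodes.filter fun x => T ∈ S.nodeLayer x n).card : ℝ) ≤
      B.card * (d + 1) := by
    exact_mod_cast (Finset.card_le_card h1).trans h2
  calc _ ≤ (B.card : ℝ) * (d + 1) := h4
    _ ≤ (σ * (n + 2)) ^ d * (d + 1) := by gcongr
    _ = _ := mul_comm _ _

end Setting

namespace Setting

variable {S : Setting d} {σ M K Λ : ℝ}

/-! ### Exponential decay and the localization error. -/

/-- The decay rate over nine layers. -/
def decayRate (C : ℝ) : ℝ := (1 + C) / (3 + C)

lemma decayRate_pos {C : ℝ} (hC : 0 < C) : 0 < decayRate C := by unfold decayRate; positivity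

lemma decayRate_lt_one {C : ℝ} (hC : 0 < C) : decayRate C < 1 := by
  unfold decayRate; rw [div_lt_one (by positivity)]; linarith

lemma tail_le_pow
    (hA : S.IsAdmissible σ (bubbleConst d σ / (2 * σ)) M K Λ) (hd : 1 ≤ d) (hσ : 0 < σ)
    {x : E d} {q : S.pw} (hq : S.IsFineScale q.1) (hqD : S.DirichletSupported x q.1)
    (h0 : ∀ r : S.pw, S.IsFineScale r.1 → S.ZeroOnD r.1 →
      (∀ T ∈ S.nodeLayer x 0, ∀ c ∈ S.sub T, piece c r.1 = 0) →
      totalForm hA.setup hd q r = 0) (j : ℕ) :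
    tail hA.setup hd x (9 * j) q ≤
      decayRate (cutoffConst d σ M K Λ) ^ j * totalForm hA.setup hd q q := by
  have hC := cutoffConst_pos (d := d) (M := M) (K := K) (Λ := Λ) hσ
  set C := cutoffConst d σ M K Λ
  induction j with
  | zero => simpa using tail_le hA.setup hd x 0 q
  | succ j ih =>
    obtain ⟨r, hr⟩ := exists_fineCutoff hA hd hσ (abs_nodeCut_le x (9 * j + 4)) hq
    have h1 := tail_step hr hC.le (h0 r hr.fineScale (hr.zeroOnD_of_supported hqD)
      fun T hT c hc => hr.piece_eq_zero (nodeLayer_mono x (Nat.zero_le _) hT) hc)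
    -- Hole filling: the new tail occurs on both sides of `tail_step`, and solving for it gives the
    -- rate `(1 + C) / (3 + C)`.
    have h2 : tail hA.setup hd x (9 * (j + 1)) q ≤
        decayRate C * tail hA.setup hd x (9 * j) q := by
      rw [decayRate, div_mul_eq_mul_div, le_div_iff₀ (by positivity), show 9 * (j + 1) = 9 * j + 9 by ring]
      linarith
    calc _ ≤ _ := h2
      _ ≤ decayRate C * (decayRate C ^ j * totalForm hA.setup hd q q) :=
        mul_le_mul_of_nonneg_left ih (decayRate_pos hC).le
      _ = _ := by ring

/-- The right-hand side of the corrector problem lives on the elements at `x`, where the test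
function is zero. -/
lemma corrector_orthogonal (hd : 1 ≤ d) (hS : S.IsSetup) {x : E d} (hx : x ∈ S.interiorNodes) {q : S.pw}
    (hq : S.IsCorrector (S.φ x) q.1) (r : S.pw) (hr : S.IsFineScale r.1) (hrD : S.ZeroOnD r.1)
    (hr0 : ∀ T ∈ S.nodeLayer x 0, ∀ c ∈ S.sub T, piece c r.1 = 0) :
    totalForm hS hd q r = 0 := by
  have hφ := isPW_of_mem_coarseSpace hS (φ_mem_coarseSpace (interiorNodes_subset hx))
  have h1 := hq.2.2 r.1 hr hrD
  have h2 := a_eq_totalForm hS hd ⟨S.φ x, hφ⟩ r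
  rw [totalForm_φ_eq_zero hS hd hφ hr0] at h2
  change S.a (S.φ x) r.1 = 0 at h2
  rw [← a_eq_totalForm, h1, h2, neg_zero]

/-- The local and the global corrector differ by a function orthogonal to the local test space. -/
lemma corrector_sub_orthogonal (hd : 1 ≤ d) (hS : S.IsSetup) {L : ℕ} {x : E d} {q qL : S.pw}
    (hq : S.IsCorrector (S.φ x) q.1) (hqL : S.IsLocalCorrector L x qL.1) {w : S.pw}
    (hw : S.IsFineScale w.1) (hwD : S.ZeroOnD w.1)
    (hw0 : ∀ T ∈ S.cutMesh, T ∉ S.nodeLayer x L → ∀ c ∈ S.sub T, piece c w.1 = 0) :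
    totalForm hS hd (q - qL) w = 0 := by
  have h1 := hq.2.2 w.1 hw hwD
  have h2 := hqL.2.2.2 w.1 hw (support_of_piece_eq_zero hS w.2 hw0) hwD
  rw [a_eq_totalForm hS hd] at h1 h2
  rw [map_sub, LinearMap.sub_apply, h1, h2, sub_self]

/-- Quasi-optimality: with a cutoff `r` of `q` that equals `q` outside the patch, `q - qL - r` is a
local test function, so the energy of `q - qL` is at most that of `r`. The latter is controlled by
the tail of `q`. -/
lemma local_error_le
    (hA : S.IsAdmissible σ (bubbleConst d σ / (2 * σ)) M K Λ) (hd : 1 ≤ d) (hσ : 0 < σ)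
    {L : ℕ} (hL : 3 ≤ L) {x : E d} (hx : x ∈ S.interiorNodes) {q qL : S.pw}
    (hq : S.IsCorrector (S.φ x) q.1) (hqL : S.IsLocalCorrector L x qL.1) :
    totalForm hA.setup hd (q - qL) (q - qL) ≤ cutoffConst d σ M K Λ *
      (decayRate (cutoffConst d σ M K Λ) ^ ((L - 6) / 9) * totalForm hA.setup hd q q) := by
  have hS := hA.setup
  have hR := hA.regular
  have hC := cutoffConst_pos (d := d) (M := M) (K := K) (Λ := Λ) hσ
  set C := cutoffConst d σ M K Λ
  have hxn := interiorNodes_subset hx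
  have hqD := dirichletSupported_of_add hS q.2 hxn hq.2.1
  -- The cut is placed at layer `L - 2` because a cutoff agrees with `q` only from two layers
  -- further out, and this has to be the edge of the patch.
  obtain ⟨m, rfl⟩ : ∃ m, L = m + 2 := ⟨L - 2, by omega⟩
  obtain ⟨r, hr⟩ := exists_fineCutoff hA hd hσ (abs_nodeCut_le x m) hq.1
  have hrD := hr.zeroOnD_of_supported hqD
  have hφ := isPW_of_mem_coarseSpace hS (φ_mem_coarseSpace hxn)
  have hwF : S.IsFineScale (q - qL - r).1 := (fineScaleSpace hS hR hσ).sub_mem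
    ((fineScaleSpace hS hR hσ).sub_mem hq.1 hqL.1) hr.fineScale
  have hwD : (q - qL - r).1 ∈ pwD hS := by
    have e : (q - qL - r).1 = (q.1 + S.φ x) - (qL.1 + S.φ x) - r.1 := by
      simp
    rw [e]
    exact (pwD hS).sub_mem ((pwD hS).sub_mem ⟨q.2.add hφ, hq.2.1⟩ ⟨qL.2.add hφ, hqL.2.2.1⟩)
      ⟨r.2, hrD⟩
  have h1 : totalForm hS hd (q - qL) (q - qL - r) = 0 := by
    refine corrector_sub_orthogonal hd hS hq hqL hwF hwD.2 fun T hT hTl c hc => ?_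
    have hcc := (mem_sub.1 hc).1
    have e1 := piece_sub hS hcc (q - qL).2 r.2
    have e2 := piece_sub hS hcc q.2 qL.2
    have e3 := piece_eq_zero_of_support hS hqL.2.1 hT hTl hc
    change piece c ((q - qL).1 - r.1) = 0
    rw [e1]
    change piece c (q.1 - qL.1) - _ = 0
    rw [e2, e3, hr.piece_eq hT hTl hc, sub_zero, sub_self]
  rw [map_sub, sub_eq_zero] at h1
  have h2 := bilin_le (totalForm_isSymm hS hd) (totalForm_nonneg hS hd) (q - qL) r
  have h3 : totalForm hS hd (q - qL) (q - qL) ≤ totalForm hS hd r r := by linarith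
  refine h3.trans ?_
  -- The energy of `r` is bounded by the tail from layer `L - 6`. For smaller `L` the truncated
  -- exponent is zero, and plain stability of the cutoff is enough.
  by_cases h6 : 6 ≤ m + 2
  · obtain ⟨l, rfl⟩ : ∃ l, m = l + 4 := ⟨m - 4, by omega⟩
    refine (hr.totalForm_le hC.le).trans (mul_le_mul_of_nonneg_left ?_ hC.le)
    have h4 := tail_le_pow hA hd hσ hq.1 hqD
      (fun r => corrector_orthogonal hd hS hx hq r) (l / 9)
    have h5 := tail_anti hS hd x q (show 9 * (l / 9) ≤ l by omega)
    rw [show l + 4 + 2 - 6 = l by omega]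
    exact h5.trans h4
  · rw [show (m + 2 - 6) / 9 = 0 by omega, pow_zero, one_mul]
    exact hr.totalForm_le_totalForm hC.le

/-- Only the energy near the boundary of the patch enters the error equation. -/
lemma exists_ring
    (hA : S.IsAdmissible σ (bubbleConst d σ / (2 * σ)) M K Λ) (hd : 1 ≤ d) (hσ : 0 < σ)
    {L : ℕ} (hL : 3 ≤ L) {x : E d} (hx : x ∈ S.interiorNodes) {q qL z : S.pw}
    (hq : S.IsCorrector (S.φ x) q.1) (hqL : S.IsLocalCorrector L x qL.1)
    (hz : S.IsFineScale z.1) (hzD : S.ZeroOnD z.1) :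
    ∃ r : S.pw, totalForm hA.setup hd (q - qL) z = totalForm hA.setup hd (q - qL) r ∧
      totalForm hA.setup hd r r ≤ 4 * cutoffConst d σ M K Λ *
        ∑ T ∈ S.nodeLayer x (L + 6), energyForm hA.setup hd T z z := by
  have hS := hA.setup
  have hR := hA.regular
  obtain ⟨m, rfl⟩ : ∃ m, L = m + 3 := ⟨L - 3, by omega⟩
  have hzs : S.DirichletSupported x z.1 := dirichletSupported_of_zeroOnD hS z.2 hzD
  obtain ⟨r₁, hr₁⟩ := exists_fineCutoff hA hd hσ (abs_nodeCut_le x (m + 1)) hz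
  obtain ⟨r₂, hr₂⟩ := exists_fineCutoff hA hd hσ (abs_nodeCut_le x (m + 4)) hz
  have hD₁ := hr₁.zeroOnD_of_supported hzs
  have hD₂ := hr₂.zeroOnD_of_supported hzs
  -- The first cut leaves `z - r₁` supported in the `L`-layer patch, so it is a local test function.
  have h1 : totalForm hS hd (q - qL) (z - r₁) = 0 := by
    refine corrector_sub_orthogonal hd hS hq hqL
      ((fineScaleSpace hS hR hσ).sub_mem hz hr₁.fineScale)
      ((pwD hS).sub_mem ⟨z.2, hzD⟩ ⟨r₁.2, hD₁⟩).2 fun T hT hTl c hc => ?_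
    have e1 := piece_sub hS (mem_sub.1 hc).1 z.2 r₁.2
    change piece c (z.1 - r₁.1) = 0
    rw [e1, hr₁.piece_eq hT hTl hc, sub_self]
  -- The second cut vanishes on the `L`-layer patch. It is invisible to `qL` by disjoint supports
  -- and to `q` by its equation, so it may be subtracted, and `r₁ - r₂` has no part far away.
  have h2 : totalForm hS hd q r₂ = 0 :=
    corrector_orthogonal hd hS hx hq r₂ hr₂.fineScale hD₂ fun T hT c hc =>
      hr₂.piece_eq_zero (nodeLayer_mono x (Nat.zero_le _) hT) hc
  have h3 : totalForm hS hd qL r₂ = 0 := by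
    rw [totalForm_apply]
    refine Finset.sum_eq_zero fun T hT => ?_
    by_cases hTl : T ∈ S.nodeLayer x (m + 3)
    · exact energyForm_eq_zero_right hS hd (fun c hc => hr₂.piece_eq_zero hTl hc) _
    · exact energyForm_eq_zero_left hS hd
        (fun c hc => piece_eq_zero_of_support hS hqL.2.1 hT hTl hc) _
  refine ⟨r₁ - r₂, ?_, ?_⟩
  · rw [map_sub, sub_eq_zero] at h1
    have h4 : totalForm hS hd (q - qL) r₂ = 0 := by
      rw [map_sub, LinearMap.sub_apply, h2, h3, sub_zero]
    rw [map_sub _ r₁, h4, sub_zero, h1]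
  · have hout : ∀ T ∈ S.cutMesh \ S.nodeLayer x (m + 6),
        energyForm hS hd T (r₁ - r₂) (r₁ - r₂) = 0 := by
      intro T hT
      obtain ⟨hTc, hTl⟩ := Finset.mem_sdiff.1 hT
      refine energyForm_eq_zero_left hS hd (fun c hc => ?_) _
      have e1 := piece_sub hS (mem_sub.1 hc).1 r₁.2 r₂.2
      change piece c (r₁.1 - r₂.1) = 0
      rw [e1, hr₁.piece_eq hTc (fun h => hTl (nodeLayer_mono x (by omega) h)) hc,
        hr₂.piece_eq hTc hTl hc, sub_self]
    have hsub := nodeLayer_subset (S := S) x (m + 6)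
    rw [totalForm_apply, ← Finset.sum_sdiff hsub, Finset.sum_eq_zero hout, zero_add]
    have e1 := hr₁.energy_le _ hsub
    have e2 := hr₂.energy_le _ hsub
    change _ ≤ _ * ∑ T ∈ S.nodeLayer x (m + 3 + 6), _ at e1
    change _ ≤ _ * ∑ T ∈ S.nodeLayer x (m + 3 + 6), _ at e2
    calc _ ≤ ∑ T ∈ S.nodeLayer x (m + 6),
          (2 * energyForm hS hd T r₁ r₁ + 2 * energyForm hS hd T r₂ r₂) :=
          Finset.sum_le_sum fun T _ => bilin_sub_le (energyForm_nonneg hS hd T) r₁ r₂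
      _ = 2 * ∑ T ∈ S.nodeLayer x (m + 6), energyForm hS hd T r₁ r₁ +
          2 * ∑ T ∈ S.nodeLayer x (m + 6), energyForm hS hd T r₂ r₂ := by
          rw [Finset.sum_add_distrib, ← Finset.mul_sum, ← Finset.mul_sum]
      _ ≤ _ := by linarith

lemma sum_nodeLayer_le (hS : S.IsSetup) (hR : S.IsRegular σ) (hσ : 0 < σ) {L : ℕ} (hL : 3 ≤ L)
    {f : Finset (E d) → ℝ} (hf : ∀ T, 0 ≤ f T) :
    ∑ x ∈ S.interiorNodes, ∑ T ∈ S.nodeLayer x (L + 6), f T ≤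
      (d + 1) * (4 * σ) ^ d * (L : ℝ) ^ d * ∑ T ∈ S.cutMesh, f T := by
  have h1 : ∑ x ∈ S.interiorNodes, ∑ T ∈ S.nodeLayer x (L + 6), f T =
      ∑ T ∈ S.cutMesh, ∑ x ∈ S.interiorNodes with T ∈ S.nodeLayer x (L + 6), f T := by
    refine Finset.sum_comm' fun x T => ?_
    rw [Finset.mem_filter]
    exact ⟨fun h => ⟨h, nodeLayer_subset x _ h.2⟩, fun h => h.1⟩
  rw [h1, Finset.mul_sum]
  refine Finset.sum_le_sum fun T hT => ?_
  rw [Finset.sum_const, nsmul_eq_mul]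
  refine mul_le_mul_of_nonneg_right ((card_nodes_le hS hR hσ (L + 6) hT).trans ?_) (hf T)
  have hL' : (3 : ℝ) ≤ L := by exact_mod_cast hL
  rw [mul_assoc, ← mul_pow]
  -- `L + 8 ≤ 4 L` holds because `L ≥ 3`.
  have h2 : σ * (((L + 6 : ℕ) : ℝ) + 2) ≤ 4 * σ * L := by
    push_cast
    nlinarith
  gcongr

/-- The error `z` is itself a fine scale function that vanishes on the Dirichlet boundary. Testing
with it reduces the claim to the nodal errors, each paired only with the part of `z` near its patch;
bounded overlap then lets Young's inequality absorb the energy of `z`. -/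
theorem corrector_error_le
    (hA : S.IsAdmissible σ (bubbleConst d σ / (2 * σ)) M K Λ) (hd : 1 ≤ d) (hσ : 0 < σ)
    {L : ℕ} (hL : 3 ≤ L) {Qφ QLφ : E d → E d → ℝ}
    (hQ : ∀ x ∈ S.interiorNodes, S.IsCorrector (S.φ x) (Qφ x))
    (hQL : ∀ x ∈ S.interiorNodes, S.IsLocalCorrector L x (QLφ x)) {v : E d → ℝ} {Qv : E d → ℝ}
    (hQv : S.IsCorrector (∑ x ∈ S.interiorNodes, v x • S.φ x) Qv) :
    S.energySq (Qv - ∑ x ∈ S.interiorNodes, v x • QLφ x) ≤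
      4 * cutoffConst d σ M K Λ * ((d + 1) * (4 * σ) ^ d * (L : ℝ) ^ d) *
        (cutoffConst d σ M K Λ * decayRate (cutoffConst d σ M K Λ) ^ ((L - 6) / 9)) *
          ∑ x ∈ S.interiorNodes, v x ^ 2 * S.energySq (Qφ x) := by
  have hS := hA.setup
  have hR := hA.regular
  have hC := cutoffConst_pos (d := d) (M := M) (K := K) (Λ := Λ) hσ
  set C := cutoffConst d σ M K Λ
  set ρ := decayRate C ^ ((L - 6) / 9)
  have hL' : (0 : ℝ) < L := by exact_mod_cast (by omega : 0 < L)
  -- This Young weight makes the summed terms in `z` equal to at most half of the left-hand side.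
  set t := 4 * C * ((d + 1) * (4 * σ) ^ d * (L : ℝ) ^ d) with ht
  have ht0 : 0 < t := by positivity
  have hφ : ∀ x ∈ S.interiorNodes, S.IsPW (S.φ x) := fun x hx =>
    isPW_of_mem_coarseSpace hS (φ_mem_coarseSpace (interiorNodes_subset hx))
  have hlift : ∀ f : E d → E d → ℝ, (∀ x ∈ S.interiorNodes, S.IsPW (f x)) →
      ∃ g : E d → S.pw, ∀ x ∈ S.interiorNodes, (g x).1 = f x := fun f hf =>
    ⟨fun x => if h : x ∈ S.interiorNodes then ⟨f x, mem_pw.2 (hf x h)⟩ else 0,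
      fun x hx => by simp only [dif_pos hx]⟩
  obtain ⟨p, hp⟩ := hlift S.φ hφ
  obtain ⟨q, hq⟩ := hlift Qφ fun x hx => (hQ x hx).1.isPW hS
  obtain ⟨qL, hqL⟩ := hlift QLφ fun x hx => (hQL x hx).1.isPW hS
  have hsum : ∀ (f : E d → E d → ℝ) (g : E d → S.pw), (∀ x ∈ S.interiorNodes, (g x).1 = f x) →
      (∑ x ∈ S.interiorNodes, v x • g x : S.pw).1 = ∑ x ∈ S.interiorNodes, v x • f x := by
    intro f g h
    rw [Submodule.coe_sum]
    exact Finset.sum_congr rfl fun x hx => by rw [Submodule.coe_smul, h x hx]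
  set qv : S.pw := ⟨Qv, hQv.1.isPW hS⟩
  set z : S.pw := qv - ∑ x ∈ S.interiorNodes, v x • qL x with hz
  have hz1 : z.1 = Qv - ∑ x ∈ S.interiorNodes, v x • QLφ x := by
    rw [hz, Submodule.coe_sub, hsum QLφ qL hqL]
  have hzF : S.IsFineScale z.1 := by
    rw [hz1]
    exact (fineScaleSpace hS hR hσ).sub_mem hQv.1 (Submodule.sum_mem _ fun x hx =>
      Submodule.smul_mem _ _ (hQL x hx).1)
  have hzD : z.1 ∈ pwD hS := by
    have e : z.1 = (Qv + ∑ x ∈ S.interiorNodes, v x • S.φ x) -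
        ∑ x ∈ S.interiorNodes, v x • (QLφ x + S.φ x) := by
      rw [hz1]; simp only [smul_add, Finset.sum_add_distrib]; abel
    rw [e]
    refine (pwD hS).sub_mem ⟨qv.2.add ?_, hQv.2.1⟩ (Submodule.sum_mem _ fun x hx =>
      Submodule.smul_mem _ _ ⟨((hQL x hx).1.isPW hS).add (hφ x hx), (hQL x hx).2.2.1⟩)
    rw [← hsum S.φ p hp]
    exact Subtype.property _
  -- `Qv` and the combination of the nodal correctors solve the same equation, so their difference
  -- is orthogonal to the test function `z`; it is not necessary to know that they coincide.
  have horth : totalForm hS hd (qv - ∑ x ∈ S.interiorNodes, v x • q x) z = 0 := by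
    have h1 : totalForm hS hd qv z = -totalForm hS hd (∑ x ∈ S.interiorNodes, v x • p x) z := by
      rw [← a_eq_totalForm, ← a_eq_totalForm, hsum S.φ p hp]
      exact hQv.2.2 z.1 hzF hzD.2
    have h2 : ∀ x ∈ S.interiorNodes, totalForm hS hd (q x) z = -totalForm hS hd (p x) z := by
      intro x hx
      rw [← a_eq_totalForm, ← a_eq_totalForm, hp x hx, hq x hx]
      exact (hQ x hx).2.2 z.1 hzF hzD.2
    rw [map_sub (totalForm hS hd) qv, LinearMap.sub_apply, h1, map_sum, map_sum, LinearMap.sum_apply,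
      LinearMap.sum_apply, ← Finset.sum_neg_distrib, sub_eq_zero]
    refine Finset.sum_congr rfl fun x hx => ?_
    simp only [map_smul, LinearMap.smul_apply, smul_eq_mul, h2 x hx, mul_neg]
  have hring : ∀ x, ∃ r : S.pw, x ∈ S.interiorNodes →
      totalForm hA.setup hd (q x - qL x) z = totalForm hA.setup hd (q x - qL x) r ∧
      totalForm hA.setup hd r r ≤ 4 * C *
        ∑ T ∈ S.nodeLayer x (L + 6), energyForm hA.setup hd T z z := by
    intro x
    by_cases hx : x ∈ S.interiorNodes
    · obtain ⟨r, hr⟩ := exists_ring hA hd hσ hL hx (q := q x) (qL := qL x)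
        ((hq x hx).symm ▸ hQ x hx) ((hqL x hx).symm ▸ hQL x hx) hzF hzD.2
      exact ⟨r, fun _ => hr⟩
    · exact ⟨0, fun h => absurd h hx⟩
  choose r hr using hring
  have hzz : totalForm hS hd z z =
      ∑ x ∈ S.interiorNodes, v x * totalForm hS hd (q x - qL x) (r x) := by
    have e : z = (qv - ∑ x ∈ S.interiorNodes, v x • q x) +
        ∑ x ∈ S.interiorNodes, v x • (q x - qL x) := by
      rw [hz]; simp only [smul_sub, Finset.sum_sub_distrib]; abel
    have e2 : totalForm hS hd z z = totalForm hS hd ((qv - ∑ x ∈ S.interiorNodes, v x • q x) +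
        ∑ x ∈ S.interiorNodes, v x • (q x - qL x)) z := by rw [← e]
    rw [e2, map_add, LinearMap.add_apply, horth, zero_add, map_sum, LinearMap.sum_apply]
    refine Finset.sum_congr rfl fun x hx => ?_
    simp only [map_smul, LinearMap.smul_apply, smul_eq_mul, (hr x hx).1]
  have hyoung : ∀ x ∈ S.interiorNodes, t * (v x * totalForm hS hd (q x - qL x) (r x)) ≤
      t ^ 2 / 2 * (C * ρ * (v x ^ 2 * S.energySq (Qφ x))) +
        4 * C / 2 * ∑ T ∈ S.nodeLayer x (L + 6), energyForm hA.setup hd T z z := by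
    intro x hx
    have h1 := bilin_le (totalForm_isSymm hS hd) (totalForm_nonneg hS hd)
      ((t * v x) • (q x - qL x)) (r x)
    simp only [map_smul, LinearMap.smul_apply, smul_eq_mul] at h1
    have h2 := local_error_le hA hd hσ hL hx (q := q x) (qL := qL x)
        ((hq x hx).symm ▸ hQ x hx) ((hqL x hx).symm ▸ hQL x hx)
    have h3 : totalForm hA.setup hd (q x) (q x) = S.energySq (Qφ x) := by
      rw [energySq, ← hq x hx, a_eq_totalForm hS hd]
    rw [h3] at h2
    have h4 := mul_le_mul_of_nonneg_left h2 (show 0 ≤ t ^ 2 / 2 * v x ^ 2 by positivity)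
    have h5 := (hr x hx).2
    calc _ = t * v x * totalForm hS hd (q x - qL x) (r x) := by ring
      _ ≤ _ := h1
      _ = t ^ 2 / 2 * v x ^ 2 * totalForm hS hd (q x - qL x) (q x - qL x) +
          totalForm hS hd (r x) (r x) / 2 := by ring
      _ ≤ t ^ 2 / 2 * v x ^ 2 * (C * (ρ * S.energySq (Qφ x))) +
          (4 * C * ∑ T ∈ S.nodeLayer x (L + 6), energyForm hA.setup hd T z z) / 2 := by
          linarith
      _ = _ := by ring
  have hcount := sum_nodeLayer_le hS hR hσ hL (energyForm_nonneg hS hd · z)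
  rw [← totalForm_apply] at hcount
  have hfin := Finset.sum_le_sum hyoung
  rw [← Finset.mul_sum, ← hzz, Finset.sum_add_distrib, ← Finset.mul_sum, ← Finset.mul_sum,
    ← Finset.mul_sum] at hfin
  have h6 : 4 * C / 2 * ∑ x ∈ S.interiorNodes, ∑ T ∈ S.nodeLayer x (L + 6),
      energyForm hA.setup hd T z z ≤ t / 2 * totalForm hS hd z z := by
    calc _ ≤ 4 * C / 2 * ((d + 1) * (4 * σ) ^ d * (L : ℝ) ^ d * totalForm hS hd z z) := by
          gcongr
      _ = _ := by rw [ht]; ring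
  have h7 : S.energySq (Qv - ∑ x ∈ S.interiorNodes, v x • QLφ x) = totalForm hS hd z z := by
    rw [energySq, ← hz1, a_eq_totalForm hS hd]
  rw [h7]
  refine le_of_mul_le_mul_left ?_ (show 0 < t / 2 by positivity)
  set V := ∑ x ∈ S.interiorNodes, v x ^ 2 * S.energySq (Qφ x)
  calc _ = t * totalForm hS hd z z - t / 2 * totalForm hS hd z z := by ring
    _ ≤ t ^ 2 / 2 * (C * ρ * V) := by linarith
    _ = _ := by ring

/-- Decay over nine layers at a rate `a` implies decay over three layers at the rate `(2 + a) / 3`. -/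
lemma pow_div_le {a : ℝ} (ha0 : 0 < a) (ha1 : a < 1) (L : ℕ) :
    a ^ ((L - 6) / 9) ≤ (((2 + a) / 3) ^ 3)⁻¹ * ((2 + a) / 3) ^ ((L - 3) / 3) := by
  set g := (2 + a) / 3 with hg
  have hg0 : 0 < g := by rw [hg]; linarith
  have hg1 : g ≤ 1 := by rw [hg]; linarith
  -- The arithmetic and geometric means of `1, 1, a`. This choice avoids the cube root of `a`.
  have h1 : a ≤ g ^ 3 := by
    have : g ^ 3 - a = (1 - a) ^ 2 * (8 + a) / 27 := by rw [hg]; ring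
    have : 0 ≤ (1 - a) ^ 2 * (8 + a) / 27 := by positivity
    linarith
  rw [inv_mul_eq_div, le_div_iff₀ (by positivity)]
  -- The extra factor `g ^ 3` pays for the shift and the floors: `(L - 3) / 3 ≤ 3 * ((L - 6) / 9) +
  -- 3`.
  calc _ ≤ (g ^ 3) ^ ((L - 6) / 9) * g ^ 3 := by gcongr
    _ = g ^ (3 * ((L - 6) / 9) + 3) := by rw [← pow_mul, ← pow_add]
    _ ≤ _ := pow_le_pow_of_le_one hg0.le hg1 (by omega)

end Setting

end LOD

end

theorem mainTheorem3 (d : ℕ) (hd : d = 2 ∨ d = 3) (σ : ℝ) (hσ : 0 < σ) :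
    ∃ θ : ℝ, 0 < θ ∧ ∀ M K Λ : ℝ, ∃ C γ : ℝ, 0 < C ∧ 0 < γ ∧ γ < 1 ∧
      ∀ S : LOD.Setting d, S.IsAdmissible σ θ M K Λ →
      ∀ L : ℕ, 3 ≤ L →
      ∀ (Qφ QLφ : LOD.E d → LOD.E d → ℝ),
        (∀ x ∈ S.interiorNodes, S.IsCorrector (S.φ x) (Qφ x)) →
        (∀ x ∈ S.interiorNodes, S.IsLocalCorrector L x (QLφ x)) →
      ∀ (v : LOD.E d → ℝ) (Qv : LOD.E d → ℝ),
        S.IsCorrector (∑ x ∈ S.interiorNodes, v x • S.φ x) Qv →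
        S.energySq (Qv - ∑ x ∈ S.interiorNodes, v x • QLφ x) ≤
          C * (L : ℝ) ^ d * γ ^ ((L - 3) / 3) *
            ∑ x ∈ S.interiorNodes, v x ^ 2 * S.energySq (Qφ x) := by
  have hd1 : 1 ≤ d := by omega
  -- `θ` is the fineness at which the interpolated bubble form is still coercive; it involves only
  -- `d` and `σ`.
  refine ⟨LOD.Setting.bubbleConst d σ / (2 * σ),
    div_pos (LOD.Setting.bubbleConst_pos hσ) (by positivity), fun M K Λ => ?_⟩
  set C₁ := LOD.Setting.cutoffConst d σ M K Λ with hC₁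
  have hC₁0 : 0 < C₁ := LOD.Setting.cutoffConst_pos hσ
  have ha0 := LOD.Setting.decayRate_pos hC₁0
  have ha1 := LOD.Setting.decayRate_lt_one hC₁0
  set a := LOD.Setting.decayRate C₁ with ha
  refine ⟨4 * C₁ * ((d + 1) * (4 * σ) ^ d) * (C₁ * (((2 + a) / 3) ^ 3)⁻¹), (2 + a) / 3,
    by positivity, by positivity, by linarith, ?_⟩
  intro S hA L hL Qφ QLφ hQ hQL v Qv hQv
  refine (LOD.Setting.corrector_error_le hA hd1 hσ hL hQ hQL hQv).trans ?_
  have hsum : 0 ≤ ∑ x ∈ S.interiorNodes, v x ^ 2 * S.energySq (Qφ x) := by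
    refine Finset.sum_nonneg fun x hx => mul_nonneg (sq_nonneg _) ?_
    have hq := (hQ x hx).1.isPW hA.setup
    have := LOD.Setting.totalForm_nonneg hA.setup hd1 ⟨Qφ x, hq⟩
    rwa [← LOD.Setting.a_eq_totalForm] at this
  refine mul_le_mul_of_nonneg_right ?_ hsum
  rw [← hC₁, ← ha]
  have h := LOD.Setting.pow_div_le ha0 ha1 L
  calc 4 * C₁ * ((d + 1) * (4 * σ) ^ d * (L : ℝ) ^ d) * (C₁ * a ^ ((L - 6) / 9)) ≤
        4 * C₁ * ((d + 1) * (4 * σ) ^ d * (L : ℝ) ^ d) *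
          (C₁ * ((((2 + a) / 3) ^ 3)⁻¹ * ((2 + a) / 3) ^ ((L - 3) / 3))) := by gcongr
    _ = _ := by ring
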